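/- Conventions: logarithms are base $2$. A Boolean circuit is built from gates with exactly two inputs, each computing an arbitrary Boolean function of its two inputs, and $\psi(m,g)$ denotes the number of Boolean functions of $m$ variables that can be computed by Boolean circuits with at most $g$ gates. A function $\gamma:\mathbb{N}\to\mathbb{N}$ is time-constructible if some deterministic multitape Turing machine, given $m$ in unary, outputs $\gamma(m)$ in binary in $O(m+\gamma(m))$ steps. A Boolean function $f$ of $n$ variables is $\gamma$-discriminating if either $n$ is not a power of $2$, or $n=2^m$ for some $m$ and both (a) $f(x)=1$ for at least $2^n/n$ strings $x\in\{0,1\}^n$, and (b) $f(x)=0$ whenever $x$ is the truth table of a Boolean function of $m$ variables that is computable by a Boolean circuit with at most $\gamma(m)$ gates. Lemma. Let $\gamma:\mathbb{N}\to\mathbb{N}$ be a time-constructible function with $\gamma(m)\le 2^m/m$ for all $m\ge 1$, and let $M^\gamma_n$ be the set of all $\gamma$-discriminating Boolean functions of $n$ variables. Then $\gamma$-discrimination, that is, the property $(M^\gamma_n)$, is nearly-linear-natural with density $\Omega\bigl(2^{-\psi(\log n,\gamma(\log n))}\bigr)$. This means: 1. (Largeness.) There is a constant $c>0$ such that $|M^\gamma_n|\ge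 2^{2^n}\cdot c\,2^{-\psi(\log n,\gamma(\log n))}$ for all sufficiently large $n$, where $\log n$ is read as $\lfloor\log n\rfloor$ if $n$ is not a power of $2$. 2. (Constructivity.) There is a constant $c'$ such that the set of truth tables (strings of length $N=2^n$) of the functions in $M^\gamma_n$, over all $n$, is decidable by a deterministic multitape Turing machine in time $O\bigl(N(\log N)^{c'}\bigr)$, i.e. this language is in $\mathrm{DTIME}(N(\log N)^{c'})$, where $N$ is the length of the input. -/

import Mathlib

namespace AlmostNatural

/-! ### Boolean functions, truth tables, circuits -/

/-- Boolean functions of `n` variables. -/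
abbrev BoolFun (n : ℕ) : Type := (Fin n → Bool) → Bool

/-- The `i`-th binary string of length `n` in lexicographic order
(the binary expansion of `i`, most significant digit first). -/
def bitString (n i : ℕ) : Fin n → Bool := fun j => i.testBit (Fin.rev j)

/-- The full truth table of `f`: the `2 ^ n` values of `f`, listed in lexicographic order of
the argument. -/
def truthTable {n : ℕ} (f : BoolFun n) : List Bool :=
  List.ofFn fun i : Fin (2 ^ n) => f (bitString n i)

/-- Boolean circuits with `m` inputs and exactly `g` gates, in topological order. Every gate has
two inputs and computes an arbitrary Boolean function of them. The nodes of the circuit are indexed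
by `Fin (m + g)`: first the `m` input variables, then the gates. -/
inductive Circuit (m : ℕ) : ℕ → Type
  | nil : Circuit m 0
  | gate {g : ℕ} (C : Circuit m g) (op : Bool → Bool → Bool) (i j : Fin (m + g)) :
      Circuit m (g + 1)

/-- The values that all nodes of a circuit take on the input `x`. -/
def Circuit.eval {m : ℕ} (x : Fin m → Bool) : {g : ℕ} → Circuit m g → Fin (m + g) → Bool
  | _, .nil => x
  | _, .gate C op i j =>
      Fin.snoc (α := fun _ => Bool) (C.eval x) (op (C.eval x i) (C.eval x j))

/-- `h` is computable by a Boolean circuit with at most `g` gates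
(the output may be read at any node). -/
def ComputableWithGates {m : ℕ} (g : ℕ) (h : BoolFun m) : Prop :=
  ∃ g' ≤ g, ∃ (C : Circuit m g') (out : Fin (m + g')), ∀ x, C.eval x out = h x

/-- `ψ(m, g)`: the number of Boolean functions of `m` variables that can be computed by Boolean
circuits with at most `g` gates. -/
noncomputable def psi (m g : ℕ) : ℕ := {h : BoolFun m | ComputableWithGates g h}.ncard

/-! ### Deterministic time -/

/-- `f` is computed, with respect to the encodings `ea` and `eb`, by a deterministic multitape
Turing machine in `O(T(N))` steps, where `N` is the length of the input. The machine model is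
Mathlib's `Turing.FinTM2` (finitely many stacks over finite alphabets), which simulates, and is
simulated by, multitape Turing machines with a constant factor of overhead. -/
def ComputableInTime {α β A B : Type} (ea : α → List A) (eb : β → List B) (f : α → β)
    (T : ℕ → ℕ) : Prop :=
  ∃ M : Turing.TM2ComputableInTime ea eb f,
    (∀ k, Finite (M.tm.Γ k)) ∧ ∃ K : ℕ, ∀ N, M.time N ≤ K * T N + K

open Classical in
/-- The class `DTIME(T)` of languages over `{0, 1}`. -/
def DTIME (T : ℕ → ℕ) : Set (Language Bool) :=
  {L | ComputableInTime (id : List Bool → List Bool) Computability.encodeBool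
    (fun w => decide (w ∈ L)) T}

/-- Nearly linear time: the union over all constants `c` of `DTIME(N (log N)^c)`. -/
def NearlyLinearTime : Set (Language Bool) :=
  ⋃ c : ℕ, DTIME fun N => N * Nat.log 2 N ^ c

/-- `γ` is time-constructible: a Turing machine, given `m` in unary, outputs `γ(m)` in binary in
`O(m + γ(m))` steps (the summand `m` is the time needed to read the input, and is absorbed
whenever `γ(m) ≥ m`). -/
def TimeConstructible (γ : ℕ → ℕ) : Prop :=
  ComputableInTime Computability.unaryEncodeNat Computability.encodeNat γ fun m => m + γ m

/-! ### Properties of Boolean functions -/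

/-- A Boolean function property: for each `n`, a set of Boolean functions of `n` variables. -/
abbrev BoolProperty : Type := ∀ n : ℕ, Set (BoolFun n)

/-- The decision problem of a property, as a language: the set of all truth tables of its
members. -/
def BoolProperty.language (C : BoolProperty) : Language Bool :=
  {w | ∃ (n : ℕ) (f : BoolFun n), f ∈ C n ∧ w = truthTable f}

/-- The property `C` is `Γ`-natural with density `δ`. -/
structure IsNatural (Γ : Set (Language Bool)) (δ : ℕ → ℝ) (C : BoolProperty) : Prop where
  largeness : ∀ᶠ n in Filter.atTop, (2 : ℝ) ^ (2 ^ n) * δ n ≤ ((C n).ncard : ℝ)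
  constructivity : C.language ∈ Γ

/-- The Boolean function `f` of `n` variables is `γ`-discriminating: either `n` is not a power of
two, or `n = 2 ^ m` and
* `f x = 1` for at least `2 ^ n / n` strings `x`, and
* `f x = 0` whenever `x` is the truth table of a function of `m` variables that is computable with
  at most `γ m` gates. -/
def IsDiscriminating (γ : ℕ → ℕ) {n : ℕ} (f : BoolFun n) : Prop :=
  (¬ ∃ m, n = 2 ^ m) ∨
    ∃ m, n = 2 ^ m ∧
      (2 : ℝ) ^ n / n ≤ ({x | f x = true}.ncard : ℝ) ∧
      ∀ (x : Fin n → Bool) (h : BoolFun m),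
        ComputableWithGates (γ m) h → List.ofFn x = truthTable h → f x = false

/-- The property `γ`-discrimination. -/
def discrimination (γ : ℕ → ℕ) : BoolProperty := fun _ => {f | IsDiscriminating γ f}

end AlmostNatural

/-! Largeness is a counting argument. Write n = 2^m. A circuit with at most g = γ(m) gates is
described by a bit string, its code, of length L = g(r + 6) + (r + 1), where r bits suffice to name
a node. Since g ≤ 2^m / m, this length is below 2^m as soon as m ≥ 256 (`codeLength_lt`). Hence at
most 2^(n-1) of the 2^n points are truth tables of easy functions (`psi_le`). A function that
vanishes on these points is free at all the others, of which there are at least 2^(n-1).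
Complementing it at the free points shows that at least half of these functions have at least
2^(n-2) ≥ 2^n / n ones (`two_pow_card_sub_le`), which gives the constant 1/2.

Constructivity uses the same codes. For m ≥ 1 every string decodes to a function with at most γ(m)
gates (`computableWithGates_codedFun`), and every such function has a code of length exactly L
(`exists_codedFun`), so counting through all strings of length L meets precisely the forbidden
points. There are O(N) strings, where N = 2^n is the length of the input. The difficulty is that a
machine without random access cannot look up O(N) positions of the input one by one in nearly linear
time. Sorting replaces the lookups. Every position of the input becomes a record (position, bit),
every forbidden point becomes a query, and a stable radix sort with n = log N linear passes puts
each query behind the record with the same key. A single scan then detects a query that meets the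
bit 1 (`scan_radixSort`). The density of ones is tested by paying for the input bits with tokens
(`run_countPhase`).

The algorithm is written in a small language of stack programs with a cost semantics (`Run`). One
simulation theorem (`Run.stepsWithin`, packaged in `computableInTime_of_run`) turns such cost bounds
into running times of a machine, and the machine that computes γ enters as a subroutine. Evaluating
one code at one argument costs O((log N)^3), and there are log N arguments, so the total is O(N (log
N)^4). The finitely many m < 256, where L may exceed 2^m, only affect the constant
(`exists_bounds`). -/

namespace AlmostNatural

open Turing

/-! ### Stack programs and their compilation to `Turing.FinTM2` -/

/-- Structured programs over stacks of bits indexed by `R`. -/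
inductive Cmd (R : Type) : Type
  | skip : Cmd R
  | push (r : R) (b : Bool) : Cmd R
  | seq (P Q : Cmd R) : Cmd R
  | pop (r : R) (P : Bool → Cmd R) (E : Cmd R) : Cmd R
  | loop (r : R) (c : Bool → Bool) (P : Bool → Cmd R) (E : Cmd R) : Cmd R
  | call (a b : R) : Cmd R

/-- The contents of the stacks. -/
abbrev Store (R : Type) : Type := R → List Bool

/-- Big-step semantics of stack programs with an upper bound on the running time. The relation
`O l l' t` says that the called machine outputs `l'` on input `l` within `t` steps. -/
inductive Run {R : Type} [DecidableEq R] (O : List Bool → List Bool → ℕ → Prop) :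
    Cmd R → Store R → ℕ → Store R → Prop
  | skip (s) : Run O .skip s 0 s
  | push (r b s) : Run O (.push r b) s 0 (Function.update s r (b :: s r))
  | seq {P Q s t s' t' s''} : Run O P s t s' → Run O Q s' t' s'' → Run O (.seq P Q) s (t + t') s''
  | pop_none {r P E s t s'} : s r = [] → Run O E s t s' → Run O (.pop r P E) s t s'
  | pop_some {r P E s t s' b l} : s r = b :: l → Run O (P b) (Function.update s r l) t s' →
      Run O (.pop r P E) s t s'
  -- One step of the machine executes a whole statement up to the next jump. Pushes and pops are
  -- therefore free, and only loop tests and calls are charged.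
  | loop_none {r c P E s t s'} : s r = [] → Run O E s t s' → Run O (.loop r c P E) s (t + 1) s'
  | loop_exit {r c P E s t s' b l} : s r = b :: l → c b = false →
      Run O (P b) (Function.update s r l) t s' → Run O (.loop r c P E) s (t + 1) s'
  | loop_cont {r c P E s t s' t' s'' b l} : s r = b :: l → c b = true →
      Run O (P b) (Function.update s r l) t s' → Run O (.loop r c P E) s' t' s'' →
      Run O (.loop r c P E) s (t + t' + 1) s''
  -- Moving a stack symbol by symbol reverses it, which explains both reversals. Each of the two
  -- transfers ends with a failed pop, hence the summand 2.
  | call {a b : R} {s l t} : O (s a).reverse l t →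
      Run O (.call a b) s (t + (s a).length + l.length + 2)
        (Function.update (Function.update s a []) b (l.reverse ++ Function.update s a [] b))
  | mono {P s t t' s'} : Run O P s t s' → t ≤ t' → Run O P s t' s'

section Compile

variable {R : Type} (A : TM2ComputableAux Bool Bool)

/-- The stack alphabets of the compiled machine. -/
@[reducible] def Alph (R : Type) (A : TM2ComputableAux Bool Bool) : R ⊕ A.tm.K → Type
  | .inl _ => Bool
  | .inr k => A.tm.Γ k

/-- The internal states of the compiled machine. -/
abbrev Mem (A : TM2ComputableAux Bool Bool) : Type := Option Bool × A.tm.σ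

/-- The statements of the compiled machine, over labels in `Λ`. -/
abbrev Code (R : Type) (A : TM2ComputableAux Bool Bool) (Λ : Type) : Type :=
  TM2.Stmt (Alph R A) Λ (Mem A)

/-- The labels used in the compilation of a program. -/
@[reducible] def Lab : Cmd R → Type
  | .skip => Empty
  | .push _ _ => Empty
  | .seq P Q => Lab P ⊕ Lab Q
  | .pop _ P E => (Σ b, Lab (P b)) ⊕ Lab E
  | .loop _ _ P E => Option ((Σ b, Lab (P b)) ⊕ Lab E)
  | .call _ _ => Bool ⊕ A.tm.Λ

/-- A program has finitely many labels. -/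
@[reducible] noncomputable def labFintype : (P : Cmd R) → Fintype (Lab A P)
  | .skip => inferInstanceAs (Fintype Empty)
  | .push _ _ => inferInstanceAs (Fintype Empty)
  | .seq P Q =>
    letI := labFintype P
    letI := labFintype Q
    inferInstanceAs (Fintype (Lab A P ⊕ Lab A Q))
  | .pop _ P E =>
    letI := fun b => labFintype (P b)
    letI := labFintype E
    inferInstanceAs (Fintype ((Σ b, Lab A (P b)) ⊕ Lab A E))
  | .loop _ _ P E =>
    letI := fun b => labFintype (P b)
    letI := labFintype E
    inferInstanceAs (Fintype (Option ((Σ b, Lab A (P b)) ⊕ Lab A E)))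
  | .call _ _ =>
    letI := A.tm.ΛFin
    inferInstanceAs (Fintype (Bool ⊕ A.tm.Λ))

/-- Translation of a statement of the called machine; halting becomes a jump to `h`. -/
def embedStmt {Λ : Type} (e : A.tm.Λ → Λ) (h : Λ) : TM2.Stmt A.tm.Γ A.tm.Λ A.tm.σ → Code R A Λ
  | .push k f q => .push (.inr k) (fun v => f v.2) (embedStmt e h q)
  | .peek k f q => .peek (.inr k) (fun v x => (v.1, f v.2 x)) (embedStmt e h q)
  | .pop k f q => .pop (.inr k) (fun v x => (v.1, f v.2 x)) (embedStmt e h q)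
  | .load a q => .load (fun v => (v.1, a v.2)) (embedStmt e h q)
  | .branch p q q' => .branch (fun v => p v.2) (embedStmt e h q) (embedStmt e h q')
  | .goto l => .goto fun v => e (l v.2)
  | .halt => .goto fun _ => h

/-- Pop a bit from `r` and branch on the result. -/
def popBranch {Λ : Type} (r : R) (q : Bool → Code R A Λ) (q' : Code R A Λ) : Code R A Λ :=
  .pop (.inl r) (fun v x => (x, v.2)) <|
    .branch (fun v => v.1.isNone) q' <| .branch (fun v => v.1 == some true) (q true) (q false)

/-- The statement that executes `P` and continues with `k`. -/
def code : (P : Cmd R) → {Λ : Type} → (Lab A P → Λ) → Code R A Λ → Code R A Λ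
  | .skip, _, _, k => k
  | .push r b, _, _, k => .push (.inl r) (fun _ => b) k
  | .seq P Q, _, e, k => code P (fun l => e (.inl l)) (code Q (fun l => e (.inr l)) k)
  | .pop r P E, _, e, k =>
    popBranch A r (fun b => code (P b) (fun l => e (.inl ⟨b, l⟩)) k)
      (code E (fun l => e (.inr l)) k)
  | .loop _ _ _ _, _, e, _ => .goto fun _ => e none
  | .call _ _, _, e, _ => .goto fun _ => e (.inl true)

/-- The statements at the labels of `P`, when `P` is continued with `k`. -/
def body : (P : Cmd R) → {Λ : Type} → (Lab A P → Λ) → Code R A Λ → Lab A P → Code R A Λ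
  | .skip, _, _, _, l => nomatch l
  | .push _ _, _, _, _, l => nomatch l
  | .seq P Q, _, e, k, .inl l =>
    body P (fun l => e (.inl l)) (code A Q (fun l => e (.inr l)) k) l
  | .seq _ Q, _, e, k, .inr l => body Q (fun l => e (.inr l)) k l
  | .pop _ P _, _, e, k, .inl ⟨b, l⟩ => body (P b) (fun l => e (.inl ⟨b, l⟩)) k l
  | .pop _ _ E, _, e, k, .inr l => body E (fun l => e (.inr l)) k l
  | .loop r c P E, _, e, k, none =>
    popBranch A r (fun b => code A (P b) (fun l => e (some (.inl ⟨b, l⟩)))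
      (if c b then .goto fun _ => e none else k)) (code A E (fun l => e (some (.inr l))) k)
  | .loop _ c P _, _, e, k, some (.inl ⟨b, l⟩) =>
    body (P b) (fun l => e (some (.inl ⟨b, l⟩))) (if c b then .goto fun _ => e none else k) l
  | .loop _ _ _ E, _, e, k, some (.inr l) => body E (fun l => e (some (.inr l))) k l
  | .call a _, _, e, _, .inl true =>
    .pop (.inl a) (fun v x => (x, v.2)) <|
      .branch (fun v => v.1.isNone)
        (.load (fun v => (v.1, A.tm.initialState)) <| .goto fun _ => e (.inr A.tm.main))
        (.push (.inr A.tm.k₀) (fun v => A.inputAlphabet.invFun (v.1.getD false)) <|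
          .goto fun _ => e (.inl true))
  | .call _ b, _, e, k, .inl false =>
    .pop (.inr A.tm.k₁) (fun v x => (x.map A.outputAlphabet, v.2)) <|
      .branch (fun v => v.1.isNone) k
        (.push (.inl b) (fun v => v.1.getD false) <| .goto fun _ => e (.inl false))
  | .call _ _, _, e, _, .inr l => embedStmt A (fun l => e (.inr l)) (e (.inl false)) (A.tm.m l)

/-! ### Simulation of stack programs by the compiled machine -/

variable {A}

/-- The stacks of the compiled machine. -/
def join (s : Store R) (S : ∀ k, List (A.tm.Γ k)) : ∀ k, List (Alph R A k)
  | .inl r => s r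
  | .inr k => S k

/-- `b` is reached from `a` in at most `t` steps of `f`. -/
def StepsWithin {C : Type} (f : C → Option C) (t : ℕ) (a b : C) : Prop :=
  ∃ j ≤ t, (flip bind f)^[j] (some a) = some b

theorem StepsWithin.refl {C : Type} (f : C → Option C) (t : ℕ) (a : C) : StepsWithin f t a a :=
  ⟨0, Nat.zero_le _, rfl⟩

theorem StepsWithin.trans {C : Type} {f : C → Option C} {t t' : ℕ} {a b c : C}
    (h : StepsWithin f t a b) (h' : StepsWithin f t' b c) : StepsWithin f (t + t') a c := by
  obtain ⟨j, hj, h⟩ := h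
  obtain ⟨j', hj', h'⟩ := h'
  refine ⟨j' + j, by omega, ?_⟩
  rw [Function.iterate_add_apply, h, h']

theorem StepsWithin.single {C : Type} {f : C → Option C} {a b : C} (h : f a = some b) :
    StepsWithin f 1 a b :=
  ⟨1, le_rfl, by simpa [flip] using h⟩

theorem StepsWithin.mono {C : Type} {f : C → Option C} {t t' : ℕ} {a b : C}
    (h : StepsWithin f t a b) (ht : t ≤ t') : StepsWithin f t' a b := by
  obtain ⟨j, hj, h⟩ := h
  exact ⟨j, hj.trans ht, h⟩

section

variable [DecidableEq R]

theorem update_join_inl (s : Store R) (S : ∀ k, List (A.tm.Γ k)) (r : R) (l : List Bool) :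
    Function.update (join s S) (.inl r) l = join (Function.update s r l) S := by
  funext k
  rcases k with r' | k
  · by_cases h : r' = r
    · subst h
      exact (Function.update_self ..).trans (Function.update_self (f := s) ..).symm
    · exact (Function.update_of_ne (by simpa using h) ..).trans
        (Function.update_of_ne (f := s) h ..).symm
  · exact Function.update_of_ne (by simp) ..

theorem update_join_inr (s : Store R) (S : ∀ k, List (A.tm.Γ k)) (k : A.tm.K)
    (l : List (A.tm.Γ k)) :
    Function.update (join s S) (.inr k) l = join s (Function.update S k l) := by
  funext k'
  rcases k' with r' | k'
  · exact Function.update_of_ne (by simp) ..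
  · by_cases h : k' = k
    · subst h
      exact (Function.update_self ..).trans (Function.update_self (f := S) ..).symm
    · exact (Function.update_of_ne (by simpa using h) ..).trans
        (Function.update_of_ne (f := S) h ..).symm

/-- The configuration of the compiled machine that corresponds to one of the called machine. -/
def embedCfg {Λ : Type} (e : A.tm.Λ → Λ) (h : Λ) (c : Option Bool) (s : Store R)
    (x : TM2.Cfg A.tm.Γ A.tm.Λ A.tm.σ) : TM2.Cfg (Alph R A) Λ (Mem A) :=
  ⟨some (x.l.elim h e), (c, x.var), join s x.stk⟩

/-- A translated statement touches only the stacks of the called machine and its component of the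
internal state, so the stacks `s` and the bit `c` of the caller are carried along unchanged. -/
theorem stepAux_embedStmt {Λ : Type} (e : A.tm.Λ → Λ) (h : Λ) (c : Option Bool) (s : Store R)
    (q : TM2.Stmt A.tm.Γ A.tm.Λ A.tm.σ) (v : A.tm.σ) (S : ∀ k, List (A.tm.Γ k)) :
    TM2.stepAux (embedStmt A e h q) (c, v) (join s S) =
      embedCfg e h c s (TM2.stepAux q v S) := by
  induction q generalizing v S with
  | push k f q ih =>
    exact (congrArg (TM2.stepAux (embedStmt A e h q) (c, v)) (update_join_inr s S k _)).trans
      (ih _ _)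
  | peek k f q ih => exact ih _ _
  | pop k f q ih =>
    exact (congrArg (TM2.stepAux (embedStmt A e h q) (c, f v (S k).head?))
      (update_join_inr s S k _)).trans (ih _ _)
  | load a q ih => exact ih _ _
  | branch p q q' ih ih' =>
    simp only [embedStmt, TM2.stepAux]
    rw [ih, ih']
    cases p v <;> rfl
  | goto l => rfl
  | halt => rfl

theorem stepAux_pop_inl {Λ : Type} {r : R} {f : Mem A → Option Bool → Mem A} {q : Code R A Λ}
    {v : Mem A} {s : Store R} {S : ∀ k, List (A.tm.Γ k)} :
    TM2.stepAux (.pop (.inl r) f q : Code R A Λ) v (join s S) =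
      TM2.stepAux q (f v (s r).head?) (join (Function.update s r (s r).tail) S) :=
  congrArg (TM2.stepAux q (f v (s r).head?)) (update_join_inl s S r _)

theorem stepAux_push_inl {Λ : Type} {r : R} {f : Mem A → Bool} {q : Code R A Λ}
    {v : Mem A} {s : Store R} {S : ∀ k, List (A.tm.Γ k)} :
    TM2.stepAux (.push (.inl r) f q : Code R A Λ) v (join s S) =
      TM2.stepAux q v (join (Function.update s r (f v :: s r)) S) :=
  congrArg (TM2.stepAux q v) (update_join_inl s S r _)

theorem stepAux_pop_inr {Λ : Type} {k : A.tm.K} {f : Mem A → Option (A.tm.Γ k) → Mem A}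
    {q : Code R A Λ} {v : Mem A} {s : Store R} {S : ∀ k, List (A.tm.Γ k)} :
    TM2.stepAux (.pop (.inr k) f q : Code R A Λ) v (join s S) =
      TM2.stepAux q (f v (S k).head?) (join s (Function.update S k (S k).tail)) :=
  congrArg (TM2.stepAux q (f v (S k).head?)) (update_join_inr s S k _)

theorem stepAux_popBranch_nil {Λ : Type} {r : R} {q : Bool → Code R A Λ} {q' : Code R A Λ}
    {v : Mem A} {s : Store R} {S : ∀ k, List (A.tm.Γ k)} (h : s r = []) :
    TM2.stepAux (popBranch A r q q') v (join s S) = TM2.stepAux q' (none, v.2) (join s S) := by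
  have h2 : Function.update s r [] = s := by rw [← h, Function.update_eq_self]
  rw [popBranch, stepAux_pop_inl, h, List.tail_nil, h2]
  rfl

theorem stepAux_popBranch_cons {Λ : Type} {r : R} {q : Bool → Code R A Λ} {q' : Code R A Λ}
    {v : Mem A} {s : Store R} {S : ∀ k, List (A.tm.Γ k)} {b : Bool} {l : List Bool}
    (h : s r = b :: l) :
    TM2.stepAux (popBranch A r q q') v (join s S) =
      TM2.stepAux (q b) (some b, v.2) (join (Function.update s r l) S) := by
  rw [popBranch, stepAux_pop_inl, h]
  cases b <;> rfl

/-- The oracle relation of the called machine. -/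
def Calls (A : TM2ComputableAux Bool Bool) (l l' : List Bool) (t : ℕ) : Prop :=
  Nonempty (TM2OutputsInTime A.tm (l.map A.inputAlphabet.invFun)
    (some (l'.map A.outputAlphabet.invFun)) t)

/-- All stacks of the called machine are empty. -/
abbrev emptyStacks (A : TM2ComputableAux Bool Bool) : ∀ k, List (A.tm.Γ k) := fun _ => []

theorem initList_stk (l : List (A.tm.Γ A.tm.k₀)) :
    (initList A.tm l).stk = Function.update (emptyStacks A) A.tm.k₀ l := by
  funext k
  by_cases h : k = A.tm.k₀
  · subst h; simp [initList]
  · simp [initList, h]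

theorem haltList_stk (l : List (A.tm.Γ A.tm.k₁)) :
    (haltList A.tm l).stk = Function.update (emptyStacks A) A.tm.k₁ l := by
  funext k
  by_cases h : k = A.tm.k₁
  · subst h; simp [haltList]
  · simp [haltList, h]

/-- The correspondence of single steps is iterated. Halting has become a jump to `h`, so the
simulation must stop there. This is consistent because a halted configuration has no successor and
cannot occur before the last of the `j` steps. -/
theorem embed_iterate {Λ : Type} {prog : Λ → Code R A Λ} {e : A.tm.Λ → Λ} {h : Λ}
    (hp : ∀ l, prog (e l) = embedStmt A e h (A.tm.m l)) (c : Option Bool) (s : Store R)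
    {x : TM2.Cfg A.tm.Γ A.tm.Λ A.tm.σ} {x' : TM2.Cfg A.tm.Γ A.tm.Λ A.tm.σ} (j : ℕ)
    (hj : (flip bind (TM2.step A.tm.m))^[j] (some x) = some x') :
    StepsWithin (TM2.step prog) j (embedCfg e h c s x) (embedCfg e h c s x') := by
  induction j generalizing x with
  | zero =>
    obtain rfl : x = x' := by simpa using hj
    exact .refl _ _ _
  | succ j ih =>
    rw [Function.iterate_succ_apply] at hj
    obtain ⟨l, v, S⟩ := x
    cases l with
    | none =>
      have : ∀ j, (flip bind (TM2.step A.tm.m))^[j] none = none := fun j => by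
        induction j with
        | zero => rfl
        | succ j ih => rw [Function.iterate_succ_apply]; exact ih
      have h2 : flip bind (TM2.step A.tm.m) (some ⟨none, v, S⟩) = none := rfl
      rw [h2, this] at hj
      cases hj
    | some l =>
      have h1 := ih hj
      rw [add_comm]
      refine StepsWithin.trans (StepsWithin.single ?_) h1
      simp only [embedCfg, Option.elim, TM2.step, hp]
      exact congrArg some (stepAux_embedStmt e h c s _ v S)

/-- First phase of a call. The list `L` accumulates what has already been transferred, which makes
the induction on the remaining input go through. -/
theorem code_feed {Λ : Type} {prog : Λ → Code R A Λ} {a b : R}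
    {e : Lab A (.call a b : Cmd R) → Λ} {k : Code R A Λ}
    (hp : ∀ l, prog (e l) = body A (.call a b) e k l) (l : List Bool) (s : Store R)
    (L : List Bool) (v : Mem A) (hs : s a = l) :
    StepsWithin (TM2.step prog) (l.length + 1)
      ⟨some (e (.inl true)), v, join s (Function.update (emptyStacks A) A.tm.k₀
        (L.map A.inputAlphabet.invFun))⟩
      ⟨some (e (.inr A.tm.main)), (none, A.tm.initialState), join (Function.update s a [])
        (Function.update (emptyStacks A) A.tm.k₀
          ((l.reverse ++ L).map A.inputAlphabet.invFun))⟩ := by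
  induction l generalizing s L v with
  | nil =>
    have h2 : Function.update s a [] = s := by rw [← hs, Function.update_eq_self]
    refine StepsWithin.single ?_
    rw [TM2.step, hp, body, stepAux_pop_inl, hs, List.tail_nil, h2]
    rfl
  | cons x l ih =>
    rw [List.length_cons, add_comm]
    have := ih (Function.update s a l) (x :: L) (some x, v.2) (by simp)
    rw [Function.update_idem] at this
    refine StepsWithin.trans (StepsWithin.single ?_) (by simpa using this)
    rw [TM2.step, hp, body, stepAux_pop_inl, hs]
    simp only [List.head?_cons, List.tail_cons, TM2.stepAux, Option.isNone_some, cond_false]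
    refine congrArg some (congrArg (TM2.Cfg.mk _ _) ((update_join_inr ..).trans ?_))
    simp [join]

/-- Last phase of a call. The final internal state is left unspecified because no continuation
depends on it: every pop overwrites the buffered bit, and every call resets the state of the called
machine. -/
theorem code_drain {Λ : Type} {prog : Λ → Code R A Λ} {a b : R}
    {e : Lab A (.call a b : Cmd R) → Λ} {k : Code R A Λ}
    (hp : ∀ l, prog (e l) = body A (.call a b) e k l) (l : List Bool) (s : Store R)
    (v : Mem A) : ∃ v',
    StepsWithin (TM2.step prog) (l.length + 1)
      ⟨some (e (.inl false)), v, join s (Function.update (emptyStacks A) A.tm.k₁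
        (l.map A.outputAlphabet.invFun))⟩
      (TM2.stepAux k v' (join (Function.update s b (l.reverse ++ s b)) (emptyStacks A))) := by
  induction l generalizing s v with
  | nil =>
    refine ⟨(none, v.2), StepsWithin.single ?_⟩
    rw [TM2.step, hp, body, stepAux_pop_inr]
    simp
  | cons x l ih =>
    obtain ⟨v', h⟩ := ih (Function.update s b (x :: s b)) (some x, v.2)
    refine ⟨v', ?_⟩
    rw [List.length_cons, add_comm]
    refine StepsWithin.trans (StepsWithin.single ?_) (by simpa using h)
    rw [TM2.step, hp, body, stepAux_pop_inr]
    simp only [TM2.stepAux, Option.isNone_some, cond_false, Function.update_self, List.map_cons,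
      List.head?_cons, Option.map_some, List.tail_cons, Function.update_idem]
    simp only [Equiv.invFun_as_coe, Equiv.apply_symm_apply]
    exact congrArg some (congrArg (TM2.Cfg.mk _ _) (update_join_inl ..))

/-- The compiled program simulates the big-step semantics. -/
theorem Run.stepsWithin {P : Cmd R} {s : Store R} {t : ℕ} {s' : Store R}
    (h : Run (Calls A) P s t s') : ∀ {Λ : Type} (prog : Λ → Code R A Λ) (e : Lab A P → Λ)
      (k : Code R A Λ) (v : Mem A), (∀ l, prog (e l) = body A P e k l) →
      ∃ v', StepsWithin (TM2.step prog) t (TM2.stepAux (code A P e k) v (join s (emptyStacks A)))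
        (TM2.stepAux k v' (join s' (emptyStacks A))) := by
  induction h with
  | skip s => exact fun prog e k v hp => ⟨v, .refl _ _ _⟩
  | push r b s =>
    intro Λ prog e k v hp
    refine ⟨v, ?_⟩
    rw [code, stepAux_push_inl]
    exact .refl _ _ _
  | seq h h' ih ih' =>
    intro Λ prog e k v hp
    obtain ⟨v', h1⟩ := ih prog (fun l => e (.inl l)) _ v (fun l => hp (.inl l))
    obtain ⟨v'', h2⟩ := ih' prog (fun l => e (.inr l)) k v' (fun l => hp (.inr l))
    exact ⟨v'', h1.trans h2⟩
  | pop_none hs h ih =>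
    intro Λ prog e k v hp
    rw [code, stepAux_popBranch_nil hs]
    exact ih prog _ _ _ fun l => hp (.inr l)
  | @pop_some r P E s t s' b l hs h ih =>
    intro Λ prog e k v hp
    rw [code, stepAux_popBranch_cons hs]
    exact ih prog _ _ _ fun l => hp (.inl ⟨b, l⟩)
  | loop_none hs h ih =>
    intro Λ prog e k v hp
    obtain ⟨v', h1⟩ := ih prog (fun l => e (some (.inr l))) k (none, v.2)
      (fun l => hp (some (.inr l)))
    refine ⟨v', ?_⟩
    rw [add_comm]
    refine StepsWithin.trans (StepsWithin.single ?_) h1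
    rw [code, TM2.stepAux, TM2.step, hp, body, stepAux_popBranch_nil hs]
  | @loop_exit r c P E s t s' b l hs hc h ih =>
    intro Λ prog e k v hp
    obtain ⟨v', h1⟩ := ih prog (fun l => e (some (.inl ⟨b, l⟩))) k (some b, v.2)
      (fun l => by rw [hp, body]; simp [hc])
    refine ⟨v', ?_⟩
    rw [add_comm]
    refine StepsWithin.trans (StepsWithin.single ?_) h1
    rw [code, TM2.stepAux, TM2.step, hp, body, stepAux_popBranch_cons hs]
    simp [hc]
  | @loop_cont r c P E s t s' t' s'' b l hs hc h h' ih ih' =>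
    intro Λ prog e k v hp
    obtain ⟨v', h1⟩ := ih prog (fun l => e (some (.inl ⟨b, l⟩))) (.goto fun _ => e none)
      (some b, v.2) (fun l => by rw [hp, body]; simp [hc])
    obtain ⟨v'', h2⟩ := ih' prog e k v' hp
    refine ⟨v'', ?_⟩
    rw [add_comm, ]
    refine StepsWithin.trans (StepsWithin.single ?_) (h1.trans h2)
    rw [code, TM2.stepAux, TM2.step, hp, body, stepAux_popBranch_cons hs]
    simp [hc]
  | @call a b s l t hO =>
    intro Λ prog e k v hp
    obtain ⟨⟨⟨j, hj⟩, hjt⟩⟩ := hO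
    -- The call splits into feeding, running and draining. Apart from input and output the called
    -- machine starts and ends with empty stacks, so the invariant `emptyStacks` is restored and it
    -- can be called again.
    have h1 := code_feed hp (s a) s [] v rfl
    have h2 := embed_iterate (h := e (.inl false)) (e := fun l => e (.inr l))
      (fun l => hp (.inr l)) none (Function.update s a []) j hj
    obtain ⟨v', h3⟩ := code_drain hp l (Function.update s a []) (none, A.tm.initialState)
    refine ⟨v', ?_⟩
    simp only [embedCfg, initList_stk, haltList_stk] at h2
    rw [List.append_nil, List.map_nil, Function.update_eq_self_iff.2 rfl] at h1
    exact ((h1.trans h2).trans h3).mono (by simp only at hjt; omega)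
  | mono h ht ih =>
    intro Λ prog e k v hp
    obtain ⟨v', h⟩ := ih prog e k v hp
    exact ⟨v', h.mono ht⟩

/-- The store in which only the stack `r` is nonempty. -/
def single (r : R) (l : List Bool) : Store R := Function.update (fun _ => []) r l

/-- The machine that executes the program `P`, with input and output on the stack `io`. -/
noncomputable def machine [Fintype R] (A : TM2ComputableAux Bool Bool) (io : R) (P : Cmd R) : FinTM2 :=
  letI := A.tm.kFin
  letI := A.tm.σFin
  letI := labFintype A P
  { K := R ⊕ A.tm.K
    k₀ := .inl io
    k₁ := .inl io
    Γ := Alph R A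
    Λ := Option (Lab A P)
    main := none
    σ := Mem A
    initialState := (none, A.tm.initialState)
    Γk₀Fin := inferInstanceAs (Fintype Bool)
    -- A halting configuration has to carry the initial internal state, hence the reset before
    -- halting.
    m := fun l => l.elim (code A P some (.load (fun _ => (none, A.tm.initialState)) .halt))
      (body A P some (.load (fun _ => (none, A.tm.initialState)) .halt)) }

/-- The interface between the cost semantics and the machine model: from here on only `Run` has to
be considered. -/
theorem computableInTime_of_run [Fintype R] {α β : Type} {ea : α → List Bool}
    {eb : β → List Bool} {f : α → β} {T : ℕ → ℕ} (hA : ∀ k, Finite (A.tm.Γ k)) (io : R)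
    (P : Cmd R) (time : ℕ → ℕ) (K : ℕ) (hT : ∀ N, time N ≤ K * T N + K)
    (h : ∀ a, Run (Calls A) P (single io (ea a)) (time (ea a).length) (single io (eb (f a)))) :
    ComputableInTime ea eb f T := by
  have hstk : ∀ l : List Bool, (fun k : R ⊕ A.tm.K =>
      @dite (List (Alph R A k)) (k = .inl io) (instDecidableEqSum k (.inl io))
        (fun h => by rw [h]; exact l) fun _ => []) = join (single io l) (emptyStacks A) := by
    intro l
    funext k
    rcases k with r | k
    · by_cases hr : r = io
      · subst hr
        refine (dif_pos rfl).trans ?_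
        change l = Function.update (fun _ => []) r l r
        simp
      · rw [dif_neg (by simpa using hr)]
        simp [join, single, hr]
    · rw [dif_neg (by simp)]
      rfl
  refine ⟨{ tm := machine A io P, inputAlphabet := Equiv.refl Bool,
            outputAlphabet := Equiv.refl Bool, time := fun N => time N + 1,
            outputsFun := fun a => Classical.choice ?_ }, ?_, K + 1, ?_⟩
  · obtain ⟨v, h1⟩ := (h a).stepsWithin (machine A io P).m some
      (.load (fun _ => (none, A.tm.initialState)) .halt) (none, A.tm.initialState) (fun l => rfl)
    obtain ⟨j, hj, h2⟩ := h1
    -- The additional step is the execution of the statement at the main label, after which the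
    -- simulation starts.
    refine ⟨⟨⟨j + 1, ?_⟩, by simpa using hj⟩⟩
    rw [Function.iterate_succ_apply]
    have e1 : List.map (Equiv.refl Bool).invFun (ea a) = ea a := List.map_id _
    have e2 : List.map (Equiv.refl Bool).invFun (eb (f a)) = eb (f a) := List.map_id _
    refine Eq.trans (congrArg _ ?_) (h2.trans ?_)
    · refine congrArg some (congrArg (TM2.stepAux _ _) ?_)
      exact (congrArg (fun l => (initList (machine A io P) l).stk) e1).trans (hstk (ea a))
    · refine congrArg some ?_
      refine congrArg (TM2.Cfg.mk _ _) ?_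
      exact ((congrArg (fun l => (haltList (machine A io P) l).stk) e2).trans (hstk (eb (f a)))).symm
  · rintro (r | k)
    · exact inferInstanceAs (Finite Bool)
    · exact hA k
  · intro N
    have := hT N
    show time N + 1 ≤ _
    rw [add_mul]
    omega

end

end Compile

end AlmostNatural

/-! ### Subroutines: moving, copying, unary and binary numbers, counters -/

namespace AlmostNatural

open Function

/-- A bound on the number of bits that `P` pushes between two loop tests. -/
def Cmd.size {R : Type} : Cmd R → ℕ
  | .skip => 0
  | .push _ _ => 1
  | .seq P Q => P.size + Q.size
  | .pop _ P E => (P true).size + (P false).size + E.size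
  | .loop _ _ P E => (P true).size + (P false).size + E.size
  | .call _ _ => 1

theorem Cmd.size_le_pop {R : Type} (P : Bool → Cmd R) (E : Cmd R) (b : Bool) :
    (P b).size ≤ (P true).size + (P false).size + E.size := by
  cases b <;> omega

section Subroutines

variable {R : Type} [DecidableEq R] {O : List Bool → List Bool → ℕ → Prop}

theorem Run.of_eq {P : Cmd R} {s s' s'' : Store R} {t t' : ℕ} (h : Run O P s t s')
    (hs : s' = s'') (ht : t ≤ t') : Run O P s t' s'' :=
  hs ▸ h.mono ht

theorem Run.convert {P : Cmd R} {s s' s₀ s₁ : Store R} {t t' : ℕ} (h : Run O P s t s')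
    (hs : s = s₀) (hs' : s' = s₁) (ht : t ≤ t') : Run O P s₀ t' s₁ :=
  hs ▸ hs' ▸ h.mono ht

theorem Run.push' {r : R} {b : Bool} {s s' : Store R} (h : update s r (b :: s r) = s') :
    Run O (.push r b) s 0 s' :=
  h ▸ .push r b s

namespace Cmd

/-- Pop all bits of `r`, executing `P b` for each bit `b`. -/
def each (r : R) (P : Bool → Cmd R) : Cmd R := .loop r (fun _ => true) P .skip

/-- Move the stack `a` in reverse to the top of `b`. -/
def move (a b : R) : Cmd R := each a fun x => .push b x

/-- Remove the content of `a`. -/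
def clear (a : R) : Cmd R := each a fun _ => .skip

/-- Move the stack `a` in reverse to the tops of `b` and `c`. -/
def moveTwo (a b c : R) : Cmd R := each a fun x => .seq (.push b x) (.push c x)

/-- Copy the stack `a` to the top of `b`, using `c` as temporary storage. -/
def copy (a b c : R) : Cmd R := .seq (move a c) (moveTwo c a b)

/-- Double the length of `I`, using `J` as temporary storage. -/
def double (I J : R) : Cmd R :=
  .seq (each I fun _ => .seq (.push J true) (.push J true)) (move J I)

/-- Halve the length of `x`, writing the result to `y` and the parity to `P`. -/
def halve (x y P : R) : Cmd R := each x fun _ => .pop x (fun _ => .push y true) (.push P true)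

/-- Write the binary digits of the length of `x` to `B`, most significant digit on top. -/
def toBin (x y P B : R) : Cmd R :=
  each x fun _ => .seq (.push x true) <| .seq (halve x y P) <|
    .seq (.pop P (fun _ => .push B true) (.push B false)) (move y x)

/-- Decide whether `B` holds the binary digits of a power of two `2 ^ k`: in this case `k` is
written to `d` in unary, and otherwise `f` becomes nonempty. -/
def isPow (B d f : R) : Cmd R :=
  .pop B (fun b => bif b then each B fun b => bif b then .push f true else .push d true
    else .push f true) (.push f true)

/-- Increment the binary counter `c` (least significant digit on top) modulo a power of two,
and push a bit to `Z` unless it overflows. -/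
def incr (c tmp Z : R) : Cmd R :=
  .seq (.loop c id (fun b => bif b then .push tmp false else .seq (.push c true) (.push Z true))
    .skip) (move tmp c)

/-- Execute `P` for all values of the counter `c`. -/
def countLoop (c tmp Z : R) (P : Cmd R) : Cmd R :=
  .seq (.push Z true) (each Z fun _ => .seq P (incr c tmp Z))

/-- Execute `P` for all elements of `l`. -/
def forAll {α : Type} (P : α → Cmd R) : List α → Cmd R
  | [] => .skip
  | r :: l => .seq (P r) (forAll P l)

end Cmd

open Cmd

/-- The rule for loop invariants: `F d l` is the store when the bits `d` have been processed and `l`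
is still on the stack. The analysis of a simple loop reduces to the choice of `F`. -/
theorem run_each {a : R} {P : Bool → Cmd R} {τ : ℕ} {w : List Bool}
    (F : List Bool → List Bool → Store R) (hF : ∀ d l, d ++ l = w → F d l a = l)
    (hP : ∀ d b l, d ++ b :: l = w → Run O (P b) (update (F d (b :: l)) a l) τ (F (d ++ [b]) l)) :
    Run O (each a P) (F [] w) (w.length * (τ + 1) + 1) (F w []) := by
  suffices ∀ l d, d ++ l = w → Run O (each a P) (F d l) (l.length * (τ + 1) + 1) (F w []) from
    this w [] rfl
  intro l
  induction l with
  | nil =>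
    intro d h
    obtain rfl : d = w := by simpa using h
    exact (Run.loop_none (hF _ _ h) (.skip _)).mono (by simp)
  | cons b l ih =>
    intro d h
    refine (Run.loop_cont (hF _ _ h) rfl (hP d b l h) (ih (d ++ [b]) (by simpa using h))).mono ?_
    rw [List.length_cons]
    ring_nf
    rfl

theorem run_move {a b : R} (hab : a ≠ b) (s : Store R) :
    Run O (move a b) s ((s a).length + 1)
      (update (update s a []) b ((s a).reverse ++ s b)) := by
  have := run_each (O := O) (a := a) (P := fun x => .push b x) (τ := 0) (w := s a)
    (fun d l => update (update s a l) b (d.reverse ++ s b))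
    (fun d l h => by grind) (fun d x l h => .push' (by grind))
  exact this.convert (by simp) rfl (by simp)

theorem run_clear (a : R) (s : Store R) :
    Run O (clear a) s ((s a).length + 1) (update s a []) := by
  have := run_each (O := O) (a := a) (P := fun x => .skip) (τ := 0) (w := s a)
    (fun d l => update s a l)
    (fun d l h => by grind) (fun d x l h => (Run.skip _).of_eq (by grind) le_rfl)
  exact this.convert (by simp) rfl (by simp)

theorem run_moveTwo {a b c : R} (hab : a ≠ b) (hac : a ≠ c) (hbc : b ≠ c) (s : Store R) :
    Run O (moveTwo a b c) s ((s a).length + 1)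
      (update (update (update s a []) b ((s a).reverse ++ s b)) c ((s a).reverse ++ s c)) := by
  have := run_each (O := O) (a := a) (P := fun x => .seq (.push b x) (.push c x)) (τ := 0)
    (w := s a)
    (fun d l => update (update (update s a l) b (d.reverse ++ s b)) c (d.reverse ++ s c))
    (fun d l h => by grind) (fun d x l h => (Run.push' rfl).seq (Run.push' (by grind)))
  exact this.convert (by simp) rfl (by simp)

theorem run_copy {a b c : R} (hab : a ≠ b) (hac : a ≠ c) (hbc : b ≠ c) {s : Store R}
    (hc : s c = []) :
    Run O (copy a b c) s (2 * (s a).length + 2) (update s b (s a ++ s b)) := by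
  refine ((run_move hac s).seq (run_moveTwo hac.symm hbc.symm hab _)).of_eq ?_ ?_
  · grind
  · grind

theorem run_double {I J : R} (hIJ : I ≠ J) {s : Store R} (hJ : s J = []) {k : ℕ}
    (hI : s I = .replicate k true) :
    Run O (double I J) s (3 * k + 2) (update s I (.replicate (2 * k) true)) := by
  have h1 := run_each (O := O) (a := I) (P := fun _ => .seq (.push J true) (.push J true)) (τ := 0)
    (w := s I) (fun d l => update (update s I l) J (.replicate (2 * d.length) true))
    (fun d l h => by grind) (fun d x l h => (Run.push' rfl).seq (Run.push' (by
      funext q; simp only [update_apply, List.length_append, List.length_singleton, mul_add]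
      grind)))
  refine (h1.seq (run_move hIJ.symm _)).convert ?_ ?_ ?_
  · funext q; simp only [update_apply]; grind
  · funext q; simp only [update_apply, hI]; grind
  · simp [hI]; omega

theorem run_halve {x y P : R} (hxy : x ≠ y) (hxP : x ≠ P) (hyP : y ≠ P) (k : ℕ) (s : Store R)
    (hx : (s x).length = k) :
    Run O (halve x y P) s (k / 2 + 2) (update (update (update s x []) y
      (.replicate (k / 2) true ++ s y)) P (.replicate (k % 2) true ++ s P)) := by
  induction k using Nat.strong_induction_on generalizing s with
  | _ k ih =>
    match hl : s x with
    | [] =>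
      obtain rfl : k = 0 := by simpa [hl] using hx.symm
      refine (Run.loop_none hl (.skip _)).of_eq ?_ (by omega)
      funext q; simp only [update_apply]; grind
    | [b] =>
      obtain rfl : k = 1 := by simpa [hl] using hx.symm
      refine (Run.loop_cont hl rfl (.pop_none (by simp) (.push _ _ _))
        (.loop_none (by grind) (.skip _))).of_eq ?_ ?_
      · funext q; simp only [update_apply]; grind
      · simp
    | b :: b' :: l =>
      obtain rfl : k = l.length + 2 := by simp [← hx, hl]
      refine (Run.loop_cont hl rfl (.pop_some (P := fun _ => .push y true) (update_self ..)
        (.push _ _ _))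
        (ih l.length (by omega) (update (update s x l) y (true :: s y)) (by grind) |>.convert ?_ rfl
          le_rfl)).of_eq ?_ ?_
      · funext q; simp only [update_apply]; grind
      · have h1 : (l.length + 2) / 2 = l.length / 2 + 1 := by omega
        have h2 : (l.length + 2) % 2 = l.length % 2 := by omega
        rw [h1, h2]
        funext q
        simp only [update_apply, List.replicate_succ']
        grind
      · omega

/-- Each round splits off the parity of the length and halves it at a cost linear in the current
length, so the geometric series keeps the total linear. The bit removed by the loop test is pushed
back first. Parities appear from the least significant one on, so the most significant digit ends on
top. -/
theorem run_toBin {x y P B : R} (hxy : x ≠ y) (hxP : x ≠ P) (hyP : y ≠ P) (hxB : x ≠ B)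
    (hyB : y ≠ B) (hPB : P ≠ B) (k : ℕ) (s : Store R)
    (hx : (s x).length = k) (hy : s y = []) (hP : s P = []) :
    Run O (toBin x y P B) s (8 * k + 1) (update (update s x []) B (k.bits.reverse ++ s B)) := by
  induction k using Nat.strong_induction_on generalizing s with
  | _ k ih =>
    match hl : s x with
    | [] =>
      obtain rfl : k = 0 := by simpa [hl] using hx.symm
      exact (Run.loop_none hl (.skip _)).of_eq (by simp; grind) (by omega)
    | b :: l =>
      have hk : k = l.length + 1 := by simp [← hx, hl]
      have hbits : k.bits = (k % 2 == 1) :: (k / 2).bits := by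
        conv_lhs => rw [← Nat.bit_bodd_div2 k]
        rw [Nat.bits_append_bit, Nat.div2_val]
        · congr 1
          have := Nat.mod_two_of_bodd k
          rw [this]; cases k.bodd <;> rfl
        · intro h; rw [Nat.div2_val] at h
          have : k = 1 := by omega
          subst this; rfl
      have h1 := (run_halve (O := O) hxy hxP hyP k (update (update s x l) x (true :: l))
        (by simp [hk]))
      have h2 : Run O (.pop P (fun _ => .push B true) (.push B false))
          (update (update (update (update (update s x l) x (true :: l)) x []) y
            (.replicate (k / 2) true ++ (update (update s x l) x (true :: l)) y)) P
            (.replicate (k % 2) true ++ (update (update s x l) x (true :: l)) P)) 0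
          (update (update (update s x []) y (.replicate (k / 2) true)) B
            ((k % 2 == 1) :: s B)) := by
        rcases Nat.mod_two_eq_zero_or_one k with h | h
        · refine .pop_none (by simp [h]; grind) (Run.push' ?_)
          simp [h]; grind
        · refine .pop_some (b := true) (l := []) (by simp [h]; grind) (Run.push' ?_)
          simp [h]; grind
      have h3 := run_move (O := O) hxy.symm
        (update (update (update s x []) y (.replicate (k / 2) true)) B ((k % 2 == 1) :: s B))
      have h4 := ih (k / 2) (by omega) (update (update (update s x []) x
        (.replicate (k / 2) true)) B ((k % 2 == 1) :: s B)) (by simp; grind) (by grind) (by grind)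
      refine (Run.loop_cont hl rfl ((Run.push' (by simp)).seq (h1.seq (h2.seq h3)))
        (h4.convert ?_ rfl le_rfl)).of_eq ?_ ?_
      · simp; grind
      · simp [hbits]; grind
      · have : (update (update (update s x []) y (List.replicate (k / 2) true)) B
          ((k % 2 == 1) :: s B) y).length = k / 2 := by grind
        rw [this]
        omega

theorem reverse_bits_two_pow (k : ℕ) : (2 ^ k).bits.reverse = true :: .replicate k false := by
  have : (2 ^ k).bits = .replicate k false ++ [true] := by
    induction k with
    | zero => simp
    | succ k ih =>
      rw [pow_succ, mul_comm, Nat.bit0_bits _ (by positivity), ih]; rfl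
  simp [this]

theorem eq_two_pow_of_reverse_bits {a k : ℕ}
    (h : a.bits.reverse = true :: .replicate k false) : a = 2 ^ k := by
  rw [← reverse_bits_two_pow, List.reverse_inj] at h
  have h2 : ∀ n : ℕ, n.bits.foldr Nat.bit 0 = n := fun n => by
    induction n using Nat.binaryRec' with
    | zero => simp
    | bit b n h ih => rw [Nat.bits_append_bit _ _ h, List.foldr_cons, ih]
  rw [← h2 a, h, h2]

theorem run_isPow {B d f : R} (hBd : B ≠ d) {k : ℕ} {s : Store R}
    (hB : s B = (2 ^ k).bits.reverse) (hd : s d = []) :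
    Run O (isPow B d f) s (k + 1) (update (update s B []) d (.replicate k true)) := by
  rw [reverse_bits_two_pow] at hB
  have := run_each (O := O) (a := B)
    (P := fun b => bif b then .push f true else .push d true) (τ := 0)
    (w := .replicate k false) (fun e l => update (update s B l) d (.replicate e.length true))
    (fun d l h => by grind) (fun e x l h => by
      have : x ∈ List.replicate k false := by rw [← h]; simp
      obtain rfl := List.eq_of_mem_replicate this
      refine Run.push' ?_
      funext q
      simp only [update_apply, List.length_append, List.length_singleton, List.replicate_succ]
      grind)
  refine (Run.pop_some hB (this.convert ?_ (by simp) le_rfl)).mono (by simp)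
  funext q; simp only [update_apply]; grind

theorem run_isPow_of_ne {B d f : R} (hBd : B ≠ d) (hBf : B ≠ f) (hdf : d ≠ f) {a : ℕ} {s : Store R}
    (hB : s B = a.bits.reverse) (ha : ∀ k, a ≠ 2 ^ k) :
    ∃ s', s' f ≠ [] ∧ (∀ q, q ≠ B → q ≠ d → q ≠ f → s' q = s q) ∧
      Run O (isPow B d f) s (a.bits.length + 1) s' := by
  match hl : s B with
  | [] =>
    exact ⟨_, by simp, by grind, (Run.pop_none hl (.push f true s)).mono (by simp)⟩
  | false :: l =>
    exact ⟨_, by simp, by grind, (Run.pop_some hl (.push f true _)).mono (by simp)⟩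
  | true :: w =>
    have := run_each (O := O) (a := B)
      (P := fun b => bif b then .push f true else .push d true) (τ := 0) (w := w)
      (fun e l => update (update (update s B l) d (.replicate (e.count false) true ++ s d)) f
        (.replicate (e.count true) true ++ s f))
      (fun d l h => by grind) (fun e x l h => by
        cases x
        · refine Run.push' ?_
          funext q
          simp only [update_apply, List.count_append, List.count_cons, List.count_nil]
          simp [List.replicate_succ]
          grind
        · refine Run.push' ?_
          funext q
          simp only [update_apply, List.count_append, List.count_cons, List.count_nil]
          simp [List.replicate_succ]
          grind)
    refine ⟨_, ?_, ?_, (Run.pop_some hl (this.convert ?_ rfl le_rfl)).mono ?_⟩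
    · rw [update_self]
      intro h
      -- If `f` were empty, no digit below the leading one would be `true`, and the number would be
      -- a power of two.
      have h1 : w.count true = 0 := by simpa using (List.append_eq_nil_iff.1 h).1
      refine ha w.length (eq_two_pow_of_reverse_bits ?_)
      rw [← hB, hl, List.cons.injEq]
      refine ⟨rfl, List.eq_replicate_iff.2 ⟨rfl, fun b hb => ?_⟩⟩
      cases b
      · rfl
      · exact absurd hb (List.count_eq_zero.1 h1)
    · intro q h1 h2 h3
      simp [h1, h2, h3]
    · funext q; simp only [update_apply]; grind
    · have : a.bits.length = w.length + 1 := by rw [← List.length_reverse, ← hB, hl]; rfl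
      omega

/-- The successor of a binary number of fixed length (least significant digit first),
modulo a power of two. -/
def succBits : List Bool → List Bool
  | [] => []
  | true :: l => false :: succBits l
  | false :: l => true :: l

/-- The last `L` binary digits of `i`, least significant digit first. -/
def bitsLE (L i : ℕ) : List Bool := (List.range L).map i.testBit

@[simp] theorem length_bitsLE (L i : ℕ) : (bitsLE L i).length = L := by simp [bitsLE]

theorem bitsLE_succ (L i : ℕ) : bitsLE (L + 1) i = i.testBit 0 :: bitsLE L (i / 2) := by
  simp [bitsLE, List.range_succ_eq_map, Function.comp_def, Nat.testBit_succ]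

theorem succBits_bitsLE (L i : ℕ) : succBits (bitsLE L i) = bitsLE L (i + 1) := by
  induction L generalizing i with
  | zero => rfl
  | succ L ih =>
    rw [bitsLE_succ, bitsLE_succ, Nat.testBit_zero, Nat.testBit_zero]
    rcases Nat.mod_two_eq_zero_or_one i with h | h
    · have h1 : (i + 1) % 2 = 1 := by omega
      have h2 : (i + 1) / 2 = i / 2 := by omega
      simp [h, h1, h2, succBits]
    · have h1 : (i + 1) % 2 = 0 := by omega
      have h2 : (i + 1) / 2 = i / 2 + 1 := by omega
      simp [h, h1, h2, succBits, ih]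

theorem bitsLE_two_pow (L : ℕ) : bitsLE L (2 ^ L) = bitsLE L 0 := by
  refine List.map_congr_left fun j hj => ?_
  rw [List.mem_range] at hj
  simp [hj.ne']

theorem bitsLE_zero (L : ℕ) : bitsLE L 0 = .replicate L false := by
  simp [bitsLE, List.eq_replicate_iff]

theorem all_bitsLE {L i : ℕ} (hi : i < 2 ^ L) : (bitsLE L i).all id ↔ i + 1 = 2 ^ L := by
  induction L generalizing i with
  | zero => simp at hi; simp [bitsLE, hi]
  | succ L ih =>
    rw [bitsLE_succ, List.all_cons, Bool.and_eq_true, ih (by omega), Nat.testBit_zero]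
    simp
    omega

theorem run_incr {c tmp Z : R} (hct : c ≠ tmp) (hcZ : c ≠ Z) (htZ : tmp ≠ Z) {s : Store R}
    (ht : s tmp = []) :
    Run O (incr c tmp Z) s (2 * (s c).length + 2) (update (update s c (succBits (s c))) Z
      (if (s c).all id then s Z else true :: s Z)) := by
  have key : ∀ (l : List Bool) (s : Store R), s c = l → ∃ d e, succBits l = d.reverse ++ e ∧
      d.length ≤ l.length ∧
      Run O (.loop c id (fun b => bif b then .push tmp false else .seq (.push c true)
        (.push Z true)) .skip) s (l.length + 1) (update (update (update s c e) tmp (d ++ s tmp))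
          Z (if l.all id then s Z else true :: s Z)) := by
    intro l
    induction l with
    | nil =>
      intro s hs
      refine ⟨[], [], rfl, le_rfl, (Run.loop_none hs (.skip _)).of_eq ?_ (by simp)⟩
      funext q; simp only [update_apply]; grind
    | cons b l ih =>
      intro s hs
      cases b
      · refine ⟨[], true :: l, rfl, by simp, (Run.loop_exit hs rfl
          ((Run.push _ _ _).seq (Run.push _ _ _))).of_eq ?_ (by simp)⟩
        funext q; simp only [update_apply]; simp; grind
      · obtain ⟨d, e, h1, h2, h3⟩ := ih (update (update s c l) tmp (false :: s tmp)) (by grind)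
        refine ⟨d ++ [false], e, by simp [succBits, h1], by simpa using h2,
          (Run.loop_cont (P := fun b => bif b then .push tmp false else .seq (.push c true)
            (.push Z true)) hs rfl (Run.push tmp false _) (h3.convert ?_ rfl le_rfl)).of_eq ?_ ?_⟩
        · grind
        · funext q; simp only [update_apply]; simp; grind
        · simp
  obtain ⟨d, e, h1, h2, h3⟩ := key (s c) s rfl
  refine (h3.seq (run_move hct.symm _)).of_eq ?_ ?_
  · rw [h1]
    funext q; simp only [update_apply]; grind
  · simp [ht, htZ]; omega

/-- The stack `Z` holds a token as long as the counter has not overflowed, so the loop makes exactly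
`2 ^ L` rounds and leaves the counter at zero, ready for reuse. `F i` is the store before round `i`
and `F' i` the store between `P` and the increment. -/
theorem run_countLoop {c tmp Z : R} (hct : c ≠ tmp) (hcZ : c ≠ Z) (htZ : tmp ≠ Z) {P : Cmd R}
    {L τ : ℕ} (F F' : ℕ → Store R) (hZ : ∀ i ≤ 2 ^ L, F i Z = [])
    (hP : ∀ i < 2 ^ L, Run O P (F i) τ (F' i)) (hF' : ∀ i < 2 ^ L, F' i c = bitsLE L i)
    (htmp : ∀ i < 2 ^ L, F' i tmp = []) (hZ' : ∀ i < 2 ^ L, F' i Z = [])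
    (hF : ∀ i < 2 ^ L, update (F' i) c (bitsLE L (i + 1)) = F (i + 1)) :
    Run O (countLoop c tmp Z P) (F 0) (2 ^ L * (τ + 2 * L + 3) + 1) (F (2 ^ L)) := by
  suffices ∀ j i, i + j = 2 ^ L → 0 < j → Run O (each Z fun _ => .seq P (incr c tmp Z))
      (update (F i) Z [true]) (j * (τ + 2 * L + 3) + 1) (F (2 ^ L)) from
    ((Run.push' (by rw [hZ 0 (by simp)])).seq
      (this (2 ^ L) 0 (by simp) (by positivity))).mono (by simp)
  intro j
  induction j with
  | zero => simp
  | succ j ih =>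
    intro i hij _
    have hi : i < 2 ^ L := by omega
    have h0 : update (update (F i) Z [true]) Z [] = F i := by
      rw [update_idem, ← hZ i hi.le, update_eq_self]
    have h1 := (run_incr (O := O) hct hcZ htZ (htmp i hi))
    rw [hF' i hi, succBits_bitsLE, hF i hi, length_bitsLE, hZ' i hi] at h1
    rcases Nat.eq_zero_or_pos j with rfl | hj
    · have hL : i + 1 = 2 ^ L := by omega
      rw [if_pos ((all_bitsLE hi).2 hL), hL] at h1
      have h2 : update (F (2 ^ L)) Z [] = F (2 ^ L) := by
        rw [← hZ _ le_rfl, update_eq_self]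
      rw [h2] at h1
      exact (Run.loop_cont (update_self ..) rfl (h0 ▸ (hP i hi).seq h1)
        (.loop_none (hZ _ le_rfl) (.skip _))).mono (by omega)
    · have hL : i + 1 ≠ 2 ^ L := by omega
      rw [if_neg (mt (all_bitsLE hi).1 hL)] at h1
      refine (Run.loop_cont (update_self ..) rfl (h0 ▸ (hP i hi).seq h1)
        (ih (i + 1) (by omega) hj)).mono ?_
      rw [add_mul j]
      omega

/-! ### Space bounds and clearing of all stacks -/

theorem sum_update [Fintype R] (s : Store R) (r : R) (l : List Bool) :
    (∑ q, (update s r l q).length) + (s r).length = (∑ q, (s q).length) + l.length := by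
  rw [← Finset.add_sum_erase _ _ (Finset.mem_univ r),
    ← Finset.add_sum_erase Finset.univ (fun q => (s q).length) (Finset.mem_univ r)]
  have : ∑ q ∈ Finset.univ.erase r, (update s r l q).length =
      ∑ q ∈ Finset.univ.erase r, (s q).length :=
    Finset.sum_congr rfl fun q hq => by rw [update_of_ne (Finset.ne_of_mem_erase hq)]
  rw [this, update_self]
  omega

/-- The total length of the stacks grows at most linearly with the running time. -/
theorem Run.sum_length_le [Fintype R] {P : Cmd R} {s : Store R} {t : ℕ} {s' : Store R}
    (h : Run O P s t s') :
    ∑ q, (s' q).length ≤ (∑ q, (s q).length) + P.size * (t + 1) := by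
  induction h with
  | skip s => simp
  | push r b s =>
    have := sum_update s r (b :: s r)
    simp [Cmd.size] at this ⊢
    omega
  | seq h h' ih ih' =>
    simp only [Cmd.size]
    nlinarith
  | pop_none hs h ih =>
    refine ih.trans (Nat.add_le_add_left (Nat.mul_le_mul_right _ ?_) _)
    simp [Cmd.size]
  | @pop_some r P E s t s' b l hs h ih =>
    have h1 := sum_update s r l
    have h2 := Nat.mul_le_mul_right (t + 1) (Cmd.size_le_pop P E b)
    simp only [Cmd.size]
    rw [hs, List.length_cons] at h1
    omega
  | @loop_none r c P E s t s' hs h ih =>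
    simp only [Cmd.size]
    nlinarith
  | @loop_exit r c P E s t s' b l hs hc h ih =>
    have h1 := sum_update s r l
    have h2 := Nat.mul_le_mul_right (t + 1) (Cmd.size_le_pop P E b)
    simp only [Cmd.size]
    rw [hs, List.length_cons] at h1
    nlinarith
  | @loop_cont r c P E s t s' t' s'' b l hs hc h h' ih ih' =>
    have h1 := sum_update s r l
    have h2 := Nat.mul_le_mul_right (t + 1) (Cmd.size_le_pop P E b)
    simp only [Cmd.size] at ih' ⊢
    rw [hs, List.length_cons] at h1
    nlinarith
  | @call a b s l t hO =>
    have h1 := sum_update (update s a []) b (l.reverse ++ update s a [] b)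
    have h2 := sum_update s a []
    simp [Cmd.size] at h1 h2 ⊢
    omega
  | mono h ht ih =>
    exact ih.trans (Nat.add_le_add_left (Nat.mul_le_mul_left _ (by omega)) _)

theorem run_forAll_clear (l : List R) (s : Store R) :
    Run O (forAll clear l) s ((l.map fun r => (s r).length).sum + l.length)
      (fun r => if r ∈ l then [] else s r) := by
  induction l generalizing s with
  | nil => exact (Run.skip s).of_eq (by simp) le_rfl
  | cons r l ih =>
    refine ((run_clear r s).seq (ih _)).of_eq ?_ ?_
    · funext q; simp only [update_apply]; grind
    · have : (l.map fun q => (update s r [] q).length).sum ≤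
          (l.map fun q => (s q).length).sum := by
        refine List.sum_le_sum fun q _ => ?_
        rw [update_apply]; split <;> simp
      simp
      omega

theorem run_clearAll [Fintype R] (s : Store R) :
    Run O (forAll clear (Finset.univ (α := R)).toList) s ((∑ q, (s q).length) + Fintype.card R)
      (fun _ => []) :=
  (run_forAll_clear _ s).of_eq (by simp) (by simp)

end Subroutines

end AlmostNatural

namespace AlmostNatural

/-! ### Codes of circuits -/

/-- The binary operation with the given truth table. -/
def gateOp (b₁ b₂ b₃ b₄ : Bool) : Bool → Bool → Bool := fun x y =>
  bif x then (bif y then b₁ else b₂) else (bif y then b₃ else b₄)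

theorem exists_gateOp (op : Bool → Bool → Bool) :
    gateOp (op true true) (op true false) (op false true) (op false false) = op := by
  funext x y
  cases x <;> cases y <;> rfl

/-- The number with the given binary digits, most significant digit first. -/
def horner (l : List Bool) : ℕ := l.foldl (fun a b => 2 * a + b.toNat) 0

theorem horner_concat (l : List Bool) (b : Bool) : horner (l ++ [b]) = 2 * horner l + b.toNat := by
  simp [horner]

theorem horner_lt (l : List Bool) : horner l < 2 ^ l.length := by
  induction l using List.reverseRecOn with
  | nil => simp [horner]
  | append_singleton l b ih =>
    rw [horner_concat, List.length_append, List.length_singleton, pow_succ]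
    have : b.toNat ≤ 1 := Bool.toNat_le b
    omega

theorem exists_horner {r i : ℕ} (hi : i < 2 ^ r) : ∃ l : List Bool, l.length = r ∧ horner l = i := by
  induction r generalizing i with
  | zero => exact ⟨[], rfl, by simp at hi; simp [horner, hi]⟩
  | succ r ih =>
    obtain ⟨l, h1, h2⟩ := ih (i := i / 2) (by omega)
    refine ⟨l ++ [i % 2 == 1], by simp [h1], ?_⟩
    rw [horner_concat, h2]
    rcases Nat.mod_two_eq_zero_or_one i with h | h <;> simp [h] <;> omega

/-- The state of the evaluation of a code: an operand stack, a table of all values that have been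
computed so far, and the number of gates that may still be used. -/
structure EvalState (α : Type) where
  /-- operands -/
  V : List α
  /-- table -/
  T : List α
  /-- budget -/
  G : ℕ

namespace EvalState

variable {α β : Type}

/-- Apply a gate to the two topmost operands. -/
def gate (ap : (Bool → Bool → Bool) → α → α → α) (op : Bool → Bool → Bool) :
    EvalState α → EvalState α
  | ⟨v₂ :: v₁ :: V, T, G + 1⟩ => ⟨ap op v₁ v₂ :: V, ap op v₁ v₂ :: T, G⟩
  | s => s

/-- Push the value with index `i` in the table. -/
def ref (i : ℕ) (s : EvalState α) : EvalState α := ⟨s.T[i]?.toList ++ s.V, s.T, s.G⟩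

/-- Apply a function to all values. -/
def map (φ : α → β) (s : EvalState α) : EvalState β := ⟨s.V.map φ, s.T.map φ, s.G⟩

/-- The initial state with input values `T` and at most `g` gates. -/
def init (T : List α) (g : ℕ) : EvalState α := ⟨T.take 1, T, g⟩

end EvalState

/-- Evaluate a code. A bit `true` and four further bits apply a gate, and a bit `false` and `r`
further bits push a value from the table. -/
def evalCode {α : Type} (ap : (Bool → Bool → Bool) → α → α → α) (r : ℕ) :
    List Bool → EvalState α → EvalState α
  | [], s => s
  | true :: b₁ :: b₂ :: b₃ :: b₄ :: y, s => evalCode ap r y (s.gate ap (gateOp b₁ b₂ b₃ b₄))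
  | true :: _, s => s
  | false :: y, s => evalCode ap r (y.drop r) (s.ref (horner (y.take r)))
termination_by y => y.length
decreasing_by
  · simp only [List.length_cons]; omega
  · simp only [List.length_cons, List.length_drop]; omega

section

variable {α β : Type} {ap : (Bool → Bool → Bool) → α → α → α}
  {ap' : (Bool → Bool → Bool) → β → β → β}

theorem EvalState.map_gate {φ : α → β} (h : ∀ op u v, φ (ap op u v) = ap' op (φ u) (φ v))
    (op : Bool → Bool → Bool) (s : EvalState α) :
    (s.gate ap op).map φ = (s.map φ).gate ap' op := by
  obtain ⟨V, T, G⟩ := s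
  match V, G with
  | [], _ => rfl
  | [_], _ => rfl
  | _ :: _ :: _, 0 => rfl
  | _ :: _ :: _, _ + 1 => simp [gate, map, h]

theorem EvalState.map_ref (φ : α → β) (i : ℕ) (s : EvalState α) :
    (s.ref i).map φ = (s.map φ).ref i := by
  simp only [ref, map, List.map_append, List.getElem?_map]
  cases s.T[i]? <;> rfl

/-- The control flow of an evaluation depends on the code and on the lengths of the lists, never on
the values. Applied to evaluation at a point, this relates the coded function to the bitwise
evaluation that the machine performs. -/
theorem map_evalCode {φ : α → β} (h : ∀ op u v, φ (ap op u v) = ap' op (φ u) (φ v)) (r : ℕ)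
    (y : List Bool) (s : EvalState α) :
    (evalCode ap r y s).map φ = evalCode ap' r y (s.map φ) := by
  fun_induction evalCode ap r y s with
  | case1 s => rw [evalCode]
  | case2 s b₁ b₂ b₃ b₄ y ih => rw [ih, evalCode, EvalState.map_gate h]
  | case3 s y hy => rw [evalCode.eq_3 _ _ _ _ hy]
  | case4 s y ih => rw [ih, evalCode, EvalState.map_ref]

/-- A property of states that is preserved by gates and references is preserved by `evalCode`. -/
theorem evalCode_induction {p : EvalState α → Prop} (hg : ∀ op s, p s → p (s.gate ap op))
    (hr : ∀ i s, p s → p (s.ref i)) {r : ℕ} {y : List Bool} {s : EvalState α} (hs : p s) :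
    p (evalCode ap r y s) := by
  fun_induction evalCode ap r y s with
  | case1 s => exact hs
  | case2 s b₁ b₂ b₃ b₄ y ih => exact ih (hg _ _ hs)
  | case3 s y hy => exact hs
  | case4 s y ih => exact ih (hr _ _ hs)

/-- Gates replace two operands by one and references only add operands. Starting with one operand
thus guarantees a result even for meaningless codes. -/
theorem evalCode_V_ne_nil {r : ℕ} {y : List Bool} {s : EvalState α} (hs : s.V ≠ []) :
    (evalCode ap r y s).V ≠ [] := by
  refine evalCode_induction (p := fun s => s.V ≠ []) (fun op s h => ?_) (fun i s h => ?_) hs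
  · obtain ⟨V, T, G⟩ := s
    match V, G with
    | [], _ => exact h
    | [_], _ => exact h
    | _ :: _ :: _, 0 => exact h
    | _ :: _ :: _, _ + 1 => simp [EvalState.gate]
  · simp only [EvalState.ref]
    exact fun h' => h (List.append_eq_nil_iff.1 h').2

end

/-- Pointwise application of a gate to Boolean functions. -/
def applyGate {m : ℕ} (op : Bool → Bool → Bool) (u v : BoolFun m) : BoolFun m :=
  fun x => op (u x) (v x)

/-- The input variables, in reverse order. -/
def inputFuns (m : ℕ) : List (BoolFun m) := List.ofFn fun j : Fin m => fun x => x (Fin.rev j)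

/-- The Boolean function with code `y`. -/
def codedFun (m g r : ℕ) (y : List Bool) : BoolFun m :=
  (evalCode applyGate r y (.init (inputFuns m) g)).V.headD fun _ => false

theorem inputFuns_ne_nil {m : ℕ} (hm : 1 ≤ m) : inputFuns m ≠ [] := by
  intro h
  have := congrArg List.length h
  simp [inputFuns] at this
  omega

/-- Reversing the variables turns the argument with index `i` into its binary digits with the least
significant one first, which is how a counter is stored on a stack. -/
theorem map_inputFuns (m i : ℕ) : (inputFuns m).map (fun h => h (bitString m i)) = bitsLE m i := by
  rw [inputFuns, List.map_ofFn, bitsLE]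
  refine List.ext_getElem (by simp) fun j h1 h2 => ?_
  simp [bitString]

/-- The code of a function, evaluated at a single argument. -/
theorem evalCode_bitsLE {m : ℕ} (hm : 1 ≤ m) (g r i : ℕ) (y : List Bool) :
    ∃ V, (evalCode (fun op => op) r y (.init (bitsLE m i) g)).V =
      codedFun m g r y (bitString m i) :: V := by
  have h := map_evalCode (ap := applyGate) (ap' := fun op => op) (φ := fun h => h (bitString m i))
    (fun _ _ _ => rfl) r y (.init (inputFuns m) g)
  have h1 : (EvalState.init (inputFuns m) g).map (fun h => h (bitString m i)) =
      .init (bitsLE m i) g := by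
    simp [EvalState.init, EvalState.map, map_inputFuns]
  rw [h1] at h
  have h2 : (evalCode applyGate r y (.init (inputFuns m) g)).V ≠ [] := by
    refine evalCode_V_ne_nil ?_
    have := inputFuns_ne_nil hm
    simpa [EvalState.init] using this
  rw [← h, EvalState.map, codedFun]
  obtain ⟨v, V, h3⟩ := List.exists_cons_of_ne_nil h2
  exact ⟨V.map fun h => h (bitString m i), by simp [h3]⟩

/-! ### Codes and circuits describe the same functions -/

theorem Circuit.eval_castAdd {m : ℕ} {g : ℕ} (C : Circuit m g) (x : Fin m → Bool) (i : Fin m) :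
    C.eval x (Fin.castAdd g i) = x i := by
  induction C with
  | nil => rfl
  | @gate g C op a b ih =>
    have : (Fin.castAdd (g + 1) i : Fin (m + g + 1)) = Fin.castSucc (Fin.castAdd g i) := rfl
    rw [Circuit.eval]
    exact (congrArg _ this).trans ((Fin.snoc_castSucc (α := fun _ => Bool) ..).trans ih)

theorem Circuit.exists_gate {m : ℕ} {g : ℕ} (C : Circuit m g) (v : Fin (m + g)) (hv : m ≤ v) :
    ∃ (op : Bool → Bool → Bool) (i j : Fin (m + g)), i < v ∧ j < v ∧
      ∀ x, C.eval x v = op (C.eval x i) (C.eval x j) := by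
  induction C with
  | nil => have := v.isLt; omega
  | @gate g C op a b ih =>
    induction v using Fin.lastCases with
    | last =>
      refine ⟨op, Fin.castSucc a, Fin.castSucc b, Fin.castSucc_lt_last a, Fin.castSucc_lt_last b,
        fun x => ?_⟩
      rw [Circuit.eval]
      simp only [Fin.snoc_castSucc, Fin.snoc_last]
    | cast v =>
      obtain ⟨op', i, j, hi, hj, h⟩ := ih v hv
      refine ⟨op', Fin.castSucc i, Fin.castSucc j, hi, hj, fun x => ?_⟩
      rw [Circuit.eval]
      simp only [Fin.snoc_castSucc, h]

/-- Invariant: all operands and table entries are nodes of a single circuit whose size plus the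
remaining budget is at most `g`. A gate instruction extends the circuit and lowers the budget by
one, and a reference changes neither. This makes the enumeration of arbitrary strings sound. -/
theorem computableWithGates_codedFun {m : ℕ} (hm : 1 ≤ m) (g r : ℕ) (y : List Bool) :
    ComputableWithGates g (codedFun m g r y) := by
  let p : EvalState (BoolFun m) → Prop := fun s => ∃ (g' : ℕ) (C : Circuit m g'), g' + s.G ≤ g ∧
    ∀ v ∈ s.V ++ s.T, ∃ out, ∀ x, C.eval x out = v x
  have h0 : p (evalCode applyGate r y (.init (inputFuns m) g)) := by
    refine evalCode_induction (fun op s hs => ?_) (fun i s hs => ?_) ?_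
    · obtain ⟨V, T, G⟩ := s
      match V, G with
      | [], _ => exact hs
      | [_], _ => exact hs
      | _ :: _ :: _, 0 => exact hs
      | v₂ :: v₁ :: V, G + 1 =>
        obtain ⟨g', C, hC, h⟩ := hs
        obtain ⟨o₁, h₁⟩ := h v₁ (by simp)
        obtain ⟨o₂, h₂⟩ := h v₂ (by simp)
        refine ⟨g' + 1, C.gate op o₁ o₂, by simp only [EvalState.gate] at hC ⊢; omega, ?_⟩
        have key : ∀ v : BoolFun m, v = applyGate op v₁ v₂ ∨ v ∈ V ++ T →
            ∃ out, ∀ x, (C.gate op o₁ o₂).eval x out = v x := by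
          rintro v (rfl | hv)
          · refine ⟨Fin.last _, fun x => ?_⟩
            rw [Circuit.eval]
            simp only [Fin.snoc_last, h₁, h₂]
            rfl
          · obtain ⟨o, ho⟩ := h v (by simp at hv ⊢; tauto)
            refine ⟨Fin.castSucc o, fun x => ?_⟩
            rw [Circuit.eval]
            simp only [Fin.snoc_castSucc, ho]
        intro v hv
        refine key v ?_
        simp [EvalState.gate] at hv ⊢
        tauto
    · obtain ⟨g', C, hC, h⟩ := hs
      refine ⟨g', C, hC, fun v hv => h v ?_⟩
      simp only [EvalState.ref, List.mem_append, Option.mem_toList] at hv ⊢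
      rcases hv with (hv | hv) | hv
      · exact .inr (List.mem_of_getElem? hv)
      · exact .inl hv
      · exact .inr hv
    · refine ⟨0, .nil, by simp [EvalState.init], fun v hv => ?_⟩
      have hv : v ∈ inputFuns m := by
        simp only [EvalState.init, List.mem_append] at hv
        exact hv.elim List.mem_of_mem_take id
      obtain ⟨j, rfl⟩ := (List.mem_ofFn' _ _).1 hv
      exact ⟨Fin.rev j, fun x => rfl⟩
  have h2 : (evalCode applyGate r y (.init (inputFuns m) g)).V ≠ [] := by
    refine evalCode_V_ne_nil ?_
    simpa [EvalState.init] using inputFuns_ne_nil hm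
  obtain ⟨g', C, hC, h⟩ := h0
  obtain ⟨v, V, h3⟩ := List.exists_cons_of_ne_nil h2
  obtain ⟨out, ho⟩ := h v (by simp [h3])
  refine ⟨g', by omega, C, out, fun x => ?_⟩
  simp [codedFun, h3, ho]

/-- The length of the codes of circuits with `g` gates, where references have `r` bits. -/
def codeLength (g r : ℕ) : ℕ := g * (r + 6) + (r + 1)

/-- A code that computes the node `v` of a circuit if the nodes in `D` are in the table. -/
theorem exists_code_node {m g r : ℕ} (C : Circuit m g) (hr : m + g ≤ 2 ^ r) (k : ℕ) :
    ∀ (v : Fin (m + g)) (D : List (Fin (m + g))), (v : ℕ) < k → D.Nodup →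
      (∀ i : Fin m, Fin.castAdd g i ∈ D) → ∃ (y : List Bool) (D' : List (Fin (m + g))),
        (D' ++ D).Nodup ∧ (∀ u ∈ D', m ≤ u ∧ u ≤ v) ∧ y.length = codeLength D'.length r ∧
        ∀ (z : List Bool) (V : List (BoolFun m)) (G : ℕ), D'.length ≤ G →
          evalCode applyGate r (y ++ z) ⟨V, D.map fun u x => C.eval x u, G⟩ =
          evalCode applyGate r z ⟨(fun x => C.eval x v) :: V,
            (D' ++ D).map fun u x => C.eval x u, G - D'.length⟩ := by
  induction k with
  | zero => intro v D hv; omega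
  | succ k ih =>
    intro v D hv hD hin
    -- A node in the table is named by its index in `r` bits. Any other node is a gate: its operands
    -- are coded in turn, the second with the table already enlarged by the first, so a shared node
    -- is computed only once.
    by_cases hvD : v ∈ D
    · obtain ⟨i, hi, rfl⟩ := List.mem_iff_getElem.1 hvD
      have hlen : D.length ≤ m + g := by simpa using hD.length_le_card
      obtain ⟨l, hl, hli⟩ := exists_horner (r := r) (i := i) (by omega)
      refine ⟨false :: l, [], by simpa using hD, by simp, by simp [hl, codeLength], ?_⟩
      intro z V G _
      rw [List.cons_append, evalCode]
      have h1 : (l ++ z).drop r = z := by rw [← hl, List.drop_left]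
      have h2 : (l ++ z).take r = l := by rw [← hl, List.take_left]
      rw [h1, h2, hli]
      simp [EvalState.ref, hi]
    · have hmv : m ≤ v := by
        by_contra hlt
        exact hvD (hin ⟨v, by omega⟩)
      obtain ⟨op, i, j, hi, hj, hop⟩ := C.exists_gate v hmv
      obtain ⟨y₁, D₁, hn₁, hu₁, hl₁, he₁⟩ := ih i D (by omega) hD hin
      obtain ⟨y₂, D₂, hn₂, hu₂, hl₂, he₂⟩ := ih j (D₁ ++ D) (by omega) hn₁
        (fun i => List.mem_append_right _ (hin i))
      refine ⟨y₁ ++ (y₂ ++ [true, op true true, op true false, op false true, op false false]),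
        v :: (D₂ ++ D₁), ?_, ?_, ?_, ?_⟩
      · rw [List.cons_append, List.append_assoc, List.nodup_cons]
        refine ⟨?_, hn₂⟩
        -- The node `v` is new, since the codes of its operands compute only nodes below `v`.
        simp only [List.mem_append, not_or]
        exact ⟨fun h => absurd (hu₂ _ h).2 (not_le.2 hj),
          fun h => absurd (hu₁ _ h).2 (not_le.2 hi), hvD⟩
      · intro u hu
        rcases List.mem_cons.1 hu with rfl | hu
        · exact ⟨hmv, le_rfl⟩
        · rcases List.mem_append.1 hu with hu | hu
          · exact ⟨(hu₂ u hu).1, (hu₂ u hu).2.trans hj.le⟩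
          · exact ⟨(hu₁ u hu).1, (hu₁ u hu).2.trans hi.le⟩
      -- A gate joins two subcodes with 5 further bits. A code with `d` gates thus has `d + 1`
      -- references of `r + 1` bits each, which is the formula in `codeLength`.
      · simp only [List.length_append, List.length_cons, List.length_nil, hl₁, hl₂, codeLength]
        ring
      · intro z V G hG
        simp only [List.length_cons, List.length_append] at hG
        obtain ⟨G', rfl⟩ : ∃ G', G = D₁.length + (D₂.length + (G' + 1)) :=
          ⟨G - (D₂.length + D₁.length + 1), by omega⟩
        rw [List.append_assoc, List.append_assoc, he₁ _ _ _ (by omega), he₂ _ _ _ (by omega)]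
        have h1 : D₁.length + (D₂.length + (G' + 1)) - D₁.length - D₂.length = G' + 1 := by omega
        have h2 : D₁.length + (D₂.length + (G' + 1)) - (v :: (D₂ ++ D₁)).length = G' := by
          simp; omega
        rw [h1, h2]
        simp only [List.cons_append, List.nil_append]
        rw [evalCode, exists_gateOp]
        have h3 : applyGate op (fun x => C.eval x i) (fun x => C.eval x j) =
          fun x => C.eval x v := by funext x; exact (hop x).symm
        simp [EvalState.gate, h3]

/-- Redundant gates that do not change the topmost operand. -/
theorem exists_padding {m : ℕ} (r k : ℕ) : ∃ y : List Bool, y.length = k * (r + 6) ∧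
    ∀ (v : BoolFun m) (V T : List (BoolFun m)), T ≠ [] →
      ∃ T', evalCode applyGate r y ⟨v :: V, T, k⟩ = ⟨v :: V, T', 0⟩ := by
  induction k with
  | zero => exact ⟨[], by simp, fun v V T _ => ⟨T, by rw [evalCode]⟩⟩
  | succ k ih =>
    obtain ⟨y, hy, h⟩ := ih
    obtain ⟨l, hl, hl0⟩ := exists_horner (r := r) (i := 0) (by positivity)
    refine ⟨false :: (l ++ (true :: true :: true :: false :: false :: y)), ?_, ?_⟩
    · simp [hl, hy]; ring
    · intro v V T hT
      obtain ⟨u, T, rfl⟩ := List.exists_cons_of_ne_nil hT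
      have h1 : ∀ z, (l ++ z).drop r = z := fun z => by rw [← hl, List.drop_left]
      have h2 : ∀ z, (l ++ z).take r = l := fun z => by rw [← hl, List.take_left]
      -- The padding gate is the projection to the first operand; its second operand is the table
      -- entry with index 0. Reference and gate take `(r + 1) + 5` bits.
      have h3 : applyGate (gateOp true true false false) v u = v := by
        funext x
        simp only [applyGate, gateOp]
        cases v x <;> simp
      obtain ⟨T', h4⟩ := h v V (v :: u :: T) (by simp)
      refine ⟨T', ?_⟩
      rw [evalCode, h1, h2, hl0, EvalState.ref]
      simp only [List.getElem?_cons_zero, Option.toList_some, List.cons_append, List.nil_append]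
      rw [evalCode, EvalState.gate, h3, h4]

/-- Only the nodes needed for the output are computed, and the unused budget is spent on padding.
All codes thereby get the same length and can be enumerated by a binary counter. -/
theorem exists_codedFun {m g r : ℕ} (hr : m + g ≤ 2 ^ r) {h : BoolFun m}
    (hh : ComputableWithGates g h) :
    ∃ y : List Bool, y.length = codeLength g r ∧ codedFun m g r y = h := by
  obtain ⟨g', hg', C, out, hC⟩ := hh
  let D : List (Fin (m + g')) := List.ofFn fun j : Fin m => Fin.castAdd g' (Fin.rev j)
  have hD : D.Nodup := by
    rw [List.nodup_ofFn]
    intro i j hij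
    simpa using hij
  have hmem : ∀ i : Fin m, Fin.castAdd g' i ∈ D := fun i =>
    (List.mem_ofFn' _ _).2 ⟨Fin.rev i, by simp⟩
  obtain ⟨y, D', hn, hu, hl, he⟩ := exists_code_node C (r := r) (by omega) (m + g') out D out.isLt hD
    hmem
  have hcard : D'.length ≤ g' := by
    have h1 : (D' ++ D).length ≤ m + g' := by simpa using hn.length_le_card
    simp [D] at h1
    omega
  obtain ⟨z, hz, hpad⟩ := exists_padding (m := m) r (g - D'.length)
  refine ⟨y ++ z, ?_, ?_⟩
  · rw [List.length_append, hl, hz, codeLength, codeLength]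
    obtain ⟨k, rfl⟩ : ∃ k, g = D'.length + k := ⟨g - D'.length, by omega⟩
    rw [Nat.add_sub_cancel_left]
    ring
  · have hT : inputFuns m = D.map fun u x => C.eval x u := by
      rw [inputFuns, List.map_ofFn]
      congr 1
      funext j x
      exact (C.eval_castAdd x _).symm
    -- Padding refers to a table entry, so the table must not be empty.
    have hne : (D' ++ D).map (fun u x => C.eval x u) ≠ [] := by
      intro h0
      simp only [List.map_eq_nil_iff, List.append_eq_nil_iff] at h0
      by_cases hout : (out : ℕ) < m
      · have := hmem ⟨out, hout⟩
        simp [h0.2] at this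
      -- Without inputs there are no nodes at all: each node would be a gate with an operand
      -- strictly below it, and this descent would never end.
      · by_cases hm : m = 0
        · have : ∀ k (v : Fin (m + g')), (v : ℕ) < k → False := by
            intro k
            induction k with
            | zero => intro v hv; omega
            | succ k ih =>
              intro v hv
              obtain ⟨_, i, _, hi, _⟩ := C.exists_gate v (by omega)
              exact ih i (by omega)
          exact this _ out out.isLt
        · have := hmem ⟨0, by omega⟩
          simp [h0.2] at this
    obtain ⟨T', h2⟩ := hpad (fun x => C.eval x out) ((inputFuns m).take 1) _ hne
    have h1 := he z ((inputFuns m).take 1) g (by omega)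
    rw [h2, ← hT] at h1
    rw [codedFun, EvalState.init, h1]
    funext x
    exact hC x

theorem psi_le {m g r : ℕ} (hr : m + g ≤ 2 ^ r) : psi m g ≤ 2 ^ codeLength g r := by
  have h1 : {h : BoolFun m | ComputableWithGates g h} ⊆
      (fun y : List.Vector Bool (codeLength g r) => codedFun m g r y.toList) '' Set.univ := by
    intro h hh
    obtain ⟨y, hy, rfl⟩ := exists_codedFun hr hh
    exact ⟨⟨y, hy⟩, trivial, rfl⟩
  refine (Set.ncard_le_ncard h1 (Set.toFinite _)).trans ((Set.ncard_image_le (Set.toFinite _)).trans ?_)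
  rw [Set.ncard_univ, Nat.card_eq_fintype_card, card_vector, Fintype.card_bool]

/-- Write `m = k + 8`. From `m ≥ 256 = 2 ^ 8` follows `g ≤ 2 ^ k`, so a reference needs at most `k +
1` bits and a gate costs at most `k + 7 = m - 1`. The total is at most `g * (m - 1) + (m - 6) ≤ 2 ^
m - g + (m - 6)`, which is small enough if `g > m`. For `g ≤ m` the length is quadratic in `m`. -/
theorem codeLength_lt {m g : ℕ} (hm : 256 ≤ m) (hg : g * m ≤ 2 ^ m) :
    codeLength g (Nat.size (m + g)) < 2 ^ m := by
  obtain ⟨k, rfl⟩ : ∃ k, m = k + 8 := ⟨m - 8, by omega⟩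
  have h1 : g ≤ 2 ^ k := by
    have : g * 256 ≤ 2 ^ (k + 8) := (Nat.mul_le_mul_left g hm).trans hg
    rw [pow_add] at this
    omega
  have h2 : k * k + 100 * k + 1000 < 2 ^ k := by
    have : ∀ j, (j + 248) * (j + 248) + 100 * (j + 248) + 1000 < 2 ^ (j + 248) := by
      intro j
      induction j with
      | zero => norm_num
      | succ j ih =>
        rw [show j + 1 + 248 = j + 248 + 1 by ring, pow_succ]
        nlinarith
    simpa [show k - 248 + 248 = k by omega] using this (k - 248)
  have hr : Nat.size (k + 8 + g) ≤ k + 1 := by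
    rw [Nat.size_le, pow_succ]
    nlinarith
  have h3 : codeLength g (Nat.size (k + 8 + g)) ≤ g * (k + 7) + (k + 2) := by
    rw [codeLength]
    exact Nat.add_le_add (Nat.mul_le_mul_left _ (by omega)) (by omega)
  have h4 : 2 ^ k ≤ 2 ^ (k + 8) := Nat.pow_le_pow_right (by norm_num) (by omega)
  rcases le_or_gt g (k + 8) with h | h
  · have : g * (k + 7) ≤ (k + 8) * (k + 7) := Nat.mul_le_mul_right _ h
    nlinarith
  · nlinarith

end AlmostNatural

namespace AlmostNatural

/-! ### Largeness -/

/-- At least half of the predicates that vanish on `S` hold for at least half of the other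
points. -/
theorem two_pow_card_sub_le {X : Type*} [Fintype X] (S : Finset X) {t : ℕ}
    (ht : 2 * t ≤ Fintype.card X - S.card) :
    2 ^ (Fintype.card X - S.card) ≤ 2 * {f : X → Bool |
      (∀ x ∈ S, f x = false) ∧ t ≤ {x | f x = true}.ncard}.ncard := by
  classical
  have hones : ∀ f : X → Bool, {x | f x = true}.ncard =
      (Finset.univ.filter fun x => f x = true).card := fun f => by
    rw [← Set.ncard_coe_finset]; simp
  have hY' : {f : X → Bool | (∀ x ∈ S, f x = false) ∧ t ≤ {x | f x = true}.ncard}.ncard =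
      (Finset.univ.filter fun f : X → Bool =>
      (∀ x ∈ S, f x = false) ∧ t ≤ (Finset.univ.filter fun x => f x = true).card).card := by
    rw [← Set.ncard_coe_finset]; simp [hones]
  rw [hY']
  rw [← Finset.card_compl] at ht ⊢
  set Z : Finset (X → Bool) := Finset.univ.filter fun f => ∀ x ∈ S, f x = false with hZ
  set Y : Finset (X → Bool) := Finset.univ.filter fun f : X → Bool =>
      (∀ x ∈ S, f x = false) ∧ t ≤ (Finset.univ.filter fun x => f x = true).card with hY
  have hcard : Z.card = 2 ^ Sᶜ.card := by
    have h1 : Z = Fintype.piFinset fun x => if x ∈ S then {false} else Finset.univ := by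
      ext f
      simp only [hZ, Finset.mem_filter, Finset.mem_univ, true_and, Fintype.mem_piFinset]
      refine forall_congr' fun x => ?_
      by_cases hx : x ∈ S <;> simp [hx]
    rw [h1, Fintype.card_piFinset, ← Finset.prod_filter_mul_prod_filter_not Finset.univ (· ∈ S)]
    rw [Finset.prod_congr rfl (g := fun _ => 1), Finset.prod_congr (s₁ := Finset.univ.filter (· ∉ S))
      (s₂ := Sᶜ) (g := fun _ => 2)]
    · simp
    · ext; simp
    · intro x hx
      simp only [Finset.mem_compl] at hx
      simp [hx]
    · intro x hx
      simp only [Finset.mem_filter] at hx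
      simp [hx]
  -- Complementation outside `S`. The ones of `f` and of `φ f` partition the complement of `S`, so
  -- one of the two functions has at least `t` ones.
  let φ : (X → Bool) → X → Bool := fun f x => if x ∈ S then false else !f x
  have hφ : Set.InjOn φ Z := by
    intro f hf g hg h
    simp only [hZ, Finset.coe_filter, Finset.mem_univ, true_and, Set.mem_ofPred_eq] at hf hg
    funext x
    by_cases hx : x ∈ S
    · rw [hf x hx, hg x hx]
    · have := congrFun h x
      simpa [φ, hx] using this
  have hsub : Z ⊆ Y ∪ Z.filter fun f => φ f ∈ Y := by
    intro f hf
    have hf' : ∀ x ∈ S, f x = false := by simpa [hZ] using hf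
    have h1 : (Finset.univ.filter fun x => f x = true).card +
        (Finset.univ.filter fun x => φ f x = true).card = Sᶜ.card := by
      rw [← Finset.card_union_of_disjoint]
      · congr 1
        ext x
        simp only [Finset.mem_union, Finset.mem_filter, Finset.mem_univ, true_and,
          Finset.mem_compl, φ]
        by_cases hx : x ∈ S
        · simp [hx, hf' x hx]
        · cases f x <;> simp [hx]
      · rw [Finset.disjoint_filter]
        intro x _ hx
        simp [φ, hx]
    rw [Finset.mem_union]
    by_cases h2 : t ≤ (Finset.univ.filter fun x => f x = true).card
    · left
      rw [hY, Finset.mem_filter]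
      exact ⟨Finset.mem_univ _, hf', h2⟩
    · right
      have h3 : φ f ∈ Y := by
        rw [hY, Finset.mem_filter]
        exact ⟨Finset.mem_univ _, fun x hx => by simp [φ, hx], by omega⟩
      exact Finset.mem_filter.2 ⟨hf, h3⟩
  have h3 : (Z.filter fun f => φ f ∈ Y).card ≤ Y.card := by
    refine Finset.card_le_card_of_injOn φ (fun f hf => ?_) (hφ.mono ?_)
    · exact (Finset.mem_filter.1 hf).2
    · exact Finset.coe_subset.2 (Finset.filter_subset _ _)
  have h4 := (Finset.card_le_card hsub).trans (Finset.card_union_le _ _)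
  omega

theorem bitString_bijective (n : ℕ) :
    Function.Bijective fun i : Fin (2 ^ n) => bitString n i := by
  rw [Fintype.bijective_iff_injective_and_card]
  refine ⟨fun a b h => Fin.ext (Nat.eq_of_testBit_eq fun j => ?_), by simp⟩
  rcases lt_or_ge j n with hj | hj
  · simpa [bitString] using congrFun h (Fin.rev ⟨j, hj⟩)
  · have : 2 ^ n ≤ 2 ^ j := Nat.pow_le_pow_right (by norm_num) hj
    rw [Nat.testBit_lt_two_pow (a.isLt.trans_le this),
      Nat.testBit_lt_two_pow (b.isLt.trans_le this)]

theorem truthTable_injective {m : ℕ} : Function.Injective (truthTable (n := m)) := by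
  intro f g h
  rw [truthTable, truthTable, List.ofFn_inj] at h
  funext x
  obtain ⟨i, rfl⟩ := (bitString_bijective m).2 x
  exact congrFun h i

theorem largeness_discrimination (γ : ℕ → ℕ) (hle : ∀ m : ℕ, 1 ≤ m → (γ m : ℝ) ≤ (2 : ℝ) ^ m / m) :
    ∀ᶠ n in Filter.atTop, (2 : ℝ) ^ (2 ^ n) * (1 / 2 * (2 : ℝ) ^
      (-(psi (Nat.log 2 n) (γ (Nat.log 2 n)) : ℤ))) ≤ ((discrimination γ n).ncard : ℝ) := by
  classical
  filter_upwards [Filter.eventually_ge_atTop (2 ^ 256)] with n hn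
  by_cases hp : ∃ m, n = 2 ^ m
  · obtain ⟨m, rfl⟩ := hp
    have hm : 256 ≤ m := (Nat.pow_le_pow_iff_right (by norm_num)).1 hn
    have hg : γ m * m ≤ 2 ^ m := by
      have h := hle m (by omega)
      rw [le_div_iff₀ (by exact_mod_cast (by omega : 0 < m))] at h
      exact_mod_cast h
    -- The strict inequality for the code length leaves at least half of all points free.
    have hψ : psi m (γ m) ≤ 2 ^ (2 ^ m - 1) :=
      (psi_le (Nat.lt_size_self _).le).trans
        (Nat.pow_le_pow_right (by norm_num) (Nat.le_sub_one_of_lt (codeLength_lt hm hg)))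
    rw [Nat.log_pow (by norm_num)]
    set n := 2 ^ m with hn'
    have h2n : 2 ^ n = 2 * 2 ^ (n - 1) := by
      rw [← pow_succ', Nat.sub_add_cancel (Nat.one_le_two_pow)]
    let S : Finset (Fin n → Bool) := Finset.univ.filter fun x =>
      ∃ h : BoolFun m, ComputableWithGates (γ m) h ∧ List.ofFn x = truthTable h
    have hS : S.card ≤ psi m (γ m) := by
      have h1 : (S : Set (Fin n → Bool)) ⊆
          (fun (h : BoolFun m) (i : Fin n) => h (bitString m i)) ''
            {h : BoolFun m | ComputableWithGates (γ m) h} := by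
        intro x hx
        obtain ⟨h, hh, he⟩ := (Finset.mem_filter.1 hx).2
        exact ⟨h, hh, (List.ofFn_injective he).symm⟩
      rw [← Set.ncard_coe_finset]
      exact (Set.ncard_le_ncard h1 (Set.toFinite _)).trans (Set.ncard_image_le (Set.toFinite _))
    have hX : Fintype.card (Fin n → Bool) = 2 ^ n := by simp
    -- The threshold is half of the `2 ^ (n - 1)` points that are certainly free. It exceeds the
    -- required `2 ^ n / n` because `n ≥ 4`.
    have h1 := two_pow_card_sub_le S (t := 2 ^ (n - 2)) (by
      have : 2 ^ (n - 1) = 2 * 2 ^ (n - 2) := by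
        rw [← pow_succ']; congr 1; omega
      omega)
    have h2 : {f : BoolFun n | (∀ x ∈ S, f x = false) ∧ 2 ^ (n - 2) ≤ {x | f x = true}.ncard}.ncard ≤
        (discrimination γ n).ncard := by
      refine Set.ncard_le_ncard (fun f hf => ?_) (Set.toFinite _)
      obtain ⟨h3, h4⟩ := hf
      refine .inr ⟨m, rfl, ?_, fun x h hh he => h3 x (Finset.mem_filter.2
        ⟨Finset.mem_univ _, h, hh, he⟩)⟩
      have h6 : 2 ^ n ≤ 2 ^ (n - 2) * n := by
        calc 2 ^ n = 2 ^ (n - 2) * 4 := by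
              rw [show (4 : ℕ) = 2 ^ 2 by norm_num, ← pow_add]; congr 1; omega
          _ ≤ _ := Nat.mul_le_mul_left _ (by omega)
      rw [div_le_iff₀ (by positivity)]
      exact_mod_cast h6.trans (Nat.mul_le_mul_right n h4)
    have h3 : (2 : ℝ) ^ (2 ^ n - S.card) ≤ 2 * ((discrimination γ n).ncard : ℝ) := by
      rw [hX] at h1
      exact_mod_cast h1.trans (Nat.mul_le_mul_left 2 h2)
    have h4 : (2 : ℝ) ^ (2 ^ n) * (2 : ℝ) ^ (-(psi m (γ m) : ℤ)) ≤ (2 : ℝ) ^ (2 ^ n - S.card) := by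
      rw [zpow_neg, zpow_natCast, ← div_eq_mul_inv, div_le_iff₀ (by positivity), ← pow_add]
      exact pow_le_pow_right₀ (by norm_num) (by omega)
    linarith
  · have h1 : discrimination γ n = Set.univ := Set.eq_univ_of_forall fun f => .inl hp
    have h2 : (2 : ℝ) ^ (-(psi (Nat.log 2 n) (γ (Nat.log 2 n)) : ℤ)) ≤ 1 := by
      rw [zpow_neg, zpow_natCast]
      exact inv_le_one_of_one_le₀ (one_le_pow₀ (by norm_num))
    rw [h1, Set.ncard_univ, Nat.card_eq_fintype_card, Fintype.card_fun, Fintype.card_fun,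
      Fintype.card_bool, Fintype.card_fin]
    push_cast
    nlinarith [show (0 : ℝ) < 2 ^ (2 ^ n) by positivity]

end AlmostNatural

namespace AlmostNatural

/-! ### Stable sorting of tagged keys -/

/-- A key with a tag: `(k, true, _)` is a query of the key `k`, and `(k, false, b)` is a record that
assigns the bit `b` to the key `k`. -/
abbrev Item : Type := List Bool × Bool × Bool

/-- The number with the given binary digits, least significant digit first. -/
def keyVal (l : List Bool) : ℕ := horner l.reverse

theorem keyVal_concat (l : List Bool) (b : Bool) :
    keyVal (l ++ [b]) = keyVal l + 2 ^ l.length * b.toNat := by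
  induction l with
  | nil => simp [keyVal, horner]
  | cons a l ih =>
    simp only [keyVal, List.cons_append, List.reverse_cons, List.length_cons] at ih ⊢
    rw [horner_concat, horner_concat, ih]
    ring

theorem keyVal_lt (l : List Bool) : keyVal l < 2 ^ l.length := by
  rw [keyVal, ← l.length_reverse]
  exact horner_lt _

theorem keyVal_injective {k l : List Bool} (hl : k.length = l.length) (h : keyVal k = keyVal l) :
    k = l := by
  induction k generalizing l with
  | nil => exact (List.eq_nil_of_length_eq_zero hl.symm).symm
  | cons a k ih =>
    obtain ⟨b, l, rfl⟩ := List.exists_cons_of_length_eq_add_one hl.symm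
    simp only [keyVal, List.reverse_cons, horner_concat] at h ih
    have ha := Bool.toNat_lt a
    have hb := Bool.toNat_lt b
    rw [ih (by simpa using hl) (by omega)]
    have : a.toNat = b.toNat := by omega
    cases a <;> cases b <;> simp_all

/-- Stable partition by the bit with index `j`. -/
def partitionBit (j : ℕ) (l : List Item) : List Item :=
  (l.filter fun x => !x.1.getD j false) ++ l.filter fun x => x.1.getD j false

/-- Stable sort by the first `j` bits; later bits are more significant. -/
def radixSort : ℕ → List Item → List Item
  | 0, l => l
  | j + 1, l => partitionBit j (radixSort j l)

theorem mem_radixSort {j : ℕ} {l : List Item} {x : Item} : x ∈ radixSort j l ↔ x ∈ l := by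
  induction j with
  | zero => rfl
  | succ j ih =>
    rw [radixSort, partitionBit, List.mem_append, List.mem_filter, List.mem_filter, ih]
    cases x.1.getD j false <;> simp

theorem keyVal_take_succ {k : List Bool} {j : ℕ} (hj : j < k.length) :
    keyVal (k.take (j + 1)) = keyVal (k.take j) + 2 ^ j * (k.getD j false).toNat := by
  rw [List.take_succ_eq_append_getElem hj, keyVal_concat, List.length_take,
    min_eq_left hj.le]
  simp [hj]

/-- The more significant bit `j` decides first, and ties keep the order of the previous pass. The
relation `r` records the original order, so the second alternative expresses stability. -/
theorem pairwise_radixSort {n : ℕ} {l : List Item} (hl : ∀ x ∈ l, x.1.length = n)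
    {r : Item → Item → Prop} (h : l.Pairwise r) {j : ℕ} (hj : j ≤ n) :
    (radixSort j l).Pairwise fun x y => keyVal (x.1.take j) < keyVal (y.1.take j) ∨
      keyVal (x.1.take j) = keyVal (y.1.take j) ∧ r x y := by
  induction j with
  | zero => simpa [radixSort] using h
  | succ j ih =>
    have ih := ih (by omega)
    have hlen : ∀ x ∈ radixSort j l, j < x.1.length := fun x hx => by
      rw [hl x (mem_radixSort.1 hx)]; omega
    rw [radixSort, partitionBit, List.pairwise_append]
    refine ⟨?_, ?_, ?_⟩
    · refine (ih.filter _).imp_of_mem fun {x y} hx hy hxy => ?_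
      obtain ⟨hx, hx'⟩ := List.mem_filter.1 hx
      obtain ⟨hy, hy'⟩ := List.mem_filter.1 hy
      rw [keyVal_take_succ (hlen x hx), keyVal_take_succ (hlen y hy)]
      simp only [Bool.not_eq_true'] at hx' hy'
      rw [hx', hy']
      simpa using hxy
    · refine (ih.filter _).imp_of_mem fun {x y} hx hy hxy => ?_
      obtain ⟨hx, hx'⟩ := List.mem_filter.1 hx
      obtain ⟨hy, hy'⟩ := List.mem_filter.1 hy
      rw [keyVal_take_succ (hlen x hx), keyVal_take_succ (hlen y hy), hx', hy']
      simpa using hxy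
    · intro x hx y hy
      obtain ⟨hx, hx'⟩ := List.mem_filter.1 hx
      obtain ⟨hy, hy'⟩ := List.mem_filter.1 hy
      left
      rw [keyVal_take_succ (hlen x hx), keyVal_take_succ (hlen y hy), hy']
      simp only [Bool.not_eq_true'] at hx'
      rw [hx']
      have := keyVal_lt (x.1.take j)
      rw [List.length_take, min_eq_left (hlen x hx).le] at this
      simp only [Bool.toNat_false, Bool.toNat_true]
      omega

/-- The bit of the last record in `l`, or `d` if there is none. -/
def lastBit (d : Bool) (l : List Item) : Bool := l.foldl (fun d x => bif x.2.1 then d else x.2.2) d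

/-- Whether some query in `l` comes directly after a record with the bit `true`, up to other
queries. -/
def scan : Bool → List Item → Bool
  | _, [] => false
  | d, x :: l => bif x.2.1 then d || scan d l else scan x.2.2 l

theorem scan_eq_true {d : Bool} {l : List Item} :
    scan d l = true ↔ ∃ l₁ x l₂, l = l₁ ++ x :: l₂ ∧ x.2.1 = true ∧ lastBit d l₁ = true := by
  induction l generalizing d with
  | nil => simp [scan]
  | cons y l ih =>
    obtain ⟨k, t, b⟩ := y
    constructor
    · intro h
      cases t
      · obtain ⟨l₁, x, l₂, rfl, h1, h2⟩ := ih.1 (by simpa [scan] using h)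
        exact ⟨(k, false, b) :: l₁, x, l₂, rfl, h1, by simpa [lastBit] using h2⟩
      · simp only [scan, cond_true, Bool.or_eq_true] at h
        rcases h with h | h
        · exact ⟨[], (k, true, b), l, rfl, rfl, h⟩
        · obtain ⟨l₁, x, l₂, rfl, h1, h2⟩ := ih.1 h
          exact ⟨(k, true, b) :: l₁, x, l₂, rfl, h1, by simpa [lastBit] using h2⟩
    · rintro ⟨l₁, x, l₂, h, h1, h2⟩
      match l₁ with
      | [] =>
        obtain ⟨rfl, rfl⟩ := List.cons.inj h
        have ht : t = true := h1
        subst ht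
        simp only [lastBit, List.foldl_nil] at h2
        simp [scan, h2]
      | z :: l₁ =>
        obtain ⟨rfl, rfl⟩ := List.cons.inj h
        cases t
        · simp only [scan, cond_false]
          exact ih.2 ⟨l₁, x, l₂, rfl, h1, by simpa [lastBit] using h2⟩
        · simp only [scan, cond_true, Bool.or_eq_true]
          exact .inr (ih.2 ⟨l₁, x, l₂, rfl, h1, by simpa [lastBit] using h2⟩)

theorem lastBit_append_of_query {d : Bool} {l l' : List Item} (h : ∀ x ∈ l', x.2.1 = true) :
    lastBit d (l ++ l') = lastBit d l := by
  rw [lastBit, List.foldl_append]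
  change lastBit (lastBit d l) l' = _
  generalize lastBit d l = e
  induction l' with
  | nil => rfl
  | cons x l' ih =>
    rw [lastBit, List.foldl_cons, h x (by simp), cond_true]
    exact ih fun x hx => h x (by simp [hx])

/-- Sorting the records `ws` and the queries `qs`, where every queried key has exactly one record,
followed by a scan detects whether the bit `true` is assigned to some queried key. -/
theorem scan_radixSort {n : ℕ} {ws qs : List Item} (hws : ∀ x ∈ ws, x.2.1 = false)
    (hqs : ∀ x ∈ qs, x.2.1 = true) (hlen : ∀ x ∈ ws ++ qs, x.1.length = n)
    (hnd : ws.Pairwise fun x y => x.1 ≠ y.1) (hex : ∀ x ∈ qs, ∃ y ∈ ws, y.1 = x.1) :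
    scan false (radixSort n (ws ++ qs)) = true ↔ ∃ x ∈ qs, ∃ y ∈ ws, y.1 = x.1 ∧ y.2.2 = true := by
  -- Of two items with equal keys the later one is a query, because records come first and have
  -- distinct keys. Stability carries this over to the sorted list.
  have h0 : (ws ++ qs).Pairwise fun x y => y.2.1 = true ∨ x.1 ≠ y.1 := by
    rw [List.pairwise_append]
    refine ⟨hnd.imp .inr, ?_, fun x _ y hy => .inl (hqs y hy)⟩
    exact (List.pairwise_of_forall_mem_list fun x _ y hy => .inl (hqs y hy))
  have h1 := pairwise_radixSort hlen h0 le_rfl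
  have hmem : ∀ x, x ∈ radixSort n (ws ++ qs) → x.1.take n = x.1 := fun x hx =>
    List.take_of_length_le (hlen x (mem_radixSort.1 hx)).le
  set L := radixSort n (ws ++ qs) with hL
  have key : ∀ l₁ x l₂, L = l₁ ++ x :: l₂ → x.2.1 = true → ∀ y ∈ ws, y.1 = x.1 →
      lastBit false l₁ = y.2.2 := by
    intro l₁ x l₂ hLx hx y hy hyx
    have hyL : y ∈ L := by rw [hL, mem_radixSort]; simp [hy]
    rw [hLx] at hyL h1 hmem
    have hkx := hmem x (by simp)
    have hky := hmem y hyL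
    rw [List.pairwise_append, List.pairwise_cons] at h1
    obtain ⟨hp1, ⟨hp2, _⟩, hp3⟩ := h1
    have hy1 : y ∈ l₁ := by
      rcases List.mem_append.1 hyL with h | h
      · exact h
      · exfalso
        rcases List.mem_cons.1 h with rfl | h
        · rw [hws y hy] at hx; cases hx
        · have := hp2 y h
          rw [hkx, hky, hyx] at this
          simp [hws y hy] at this
    obtain ⟨a, b, rfl⟩ := List.append_of_mem hy1
    rw [List.pairwise_append, List.pairwise_cons] at hp1
    -- Whatever stands between the record `y` and the query `x` has the same key by sortedness, so
    -- it is a query and does not overwrite the remembered bit.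
    have hb : ∀ e ∈ b, e.2.1 = true := by
      intro e he
      have h2 := hp1.2.1.1 e he
      have h3 := hp3 e (by simp [he]) x (by simp)
      have hke := hmem e (by simp [he])
      rw [hke, hky] at h2
      rw [hke, hkx, ← hyx] at h3
      have h4 : keyVal y.1 = keyVal e.1 := by omega
      have h5 : y.1 = e.1 := by
        refine keyVal_injective ?_ h4
        rw [hlen y (by simp [hy]), hlen e]
        rw [← mem_radixSort (j := n), ← hL, hLx]
        simp [he]
      rcases h2 with h2 | ⟨-, h2 | h2⟩
      · omega
      · exact h2
      · exact absurd h5 h2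
    have : a ++ y :: b = (a ++ [y]) ++ b := by simp
    rw [this, lastBit_append_of_query hb, lastBit, List.foldl_append]
    simp [hws y hy]
  rw [scan_eq_true]
  constructor
  · rintro ⟨l₁, x, l₂, h2, h3, h4⟩
    have hx : x ∈ ws ++ qs := by
      rw [← mem_radixSort (j := n), ← hL, h2]; simp
    have hxq : x ∈ qs := by
      rcases List.mem_append.1 hx with h | h
      · rw [hws x h] at h3; cases h3
      · exact h
    obtain ⟨y, hy, hyx⟩ := hex x hxq
    exact ⟨x, hxq, y, hy, hyx, by rw [← key l₁ x l₂ h2 h3 y hy hyx, h4]⟩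
  · rintro ⟨x, hx, y, hy, hyx, hy2⟩
    have hxL : x ∈ L := by rw [hL, mem_radixSort]; simp [hx]
    obtain ⟨l₁, l₂, h2⟩ := List.append_of_mem hxL
    exact ⟨l₁, x, l₂, h2, hqs x hx, by rw [key l₁ x l₂ h2 (hqs x hx) y hy hyx, hy2]⟩

/-- Move the first bit of the key to the end. -/
def rotateKey (j : ℕ) (x : Item) : Item := (x.1.rotate j, x.2)

/-- A stack gives access only to the first bit of a key. Rotating once per pass brings bit `j` to
the front in pass `j`, and a full turn restores the key. -/
theorem head_rotateKey {x : Item} {j : ℕ} (hj : j < x.1.length) :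
    ∃ k, (rotateKey j x).1 = x.1.getD j false :: k ∧
      (rotateKey (j + 1) x).1 = k ++ [x.1.getD j false] := by
  have h1 : (x.1.rotate j) = x.1.getD j false :: (x.1.drop (j + 1) ++ x.1.take j) := by
    rw [List.rotate_eq_drop_append_take hj.le, List.drop_eq_getElem_cons hj, List.cons_append,
      List.getD_eq_getElem _ _ hj]
  refine ⟨_, h1, ?_⟩
  rw [rotateKey, ← List.rotate_rotate, h1]
  simp

end AlmostNatural

namespace AlmostNatural

open Function Cmd

/-! ### The decision procedure: evaluation of codes -/

/-- The stacks of the decision procedure. -/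
inductive Reg
  | w | w2 | x | y | P | B | n | m | g | r | tmp | F | H | c | c2 | a | p | T | V | G | I | J | A
  | B0 | B1 | D | Z | Z2 | U | h
  deriving DecidableEq

variable {O : List Bool → List Bool → ℕ → Prop}

open Reg

instance : Fintype Reg :=
  .ofList [w, w2, x, y, P, B, n, m, g, r, tmp, F, H, c, c2, a, p, T, V, G, I, J, A, B0, B1, D, Z,
    Z2, U, h] fun q => by cases q <;> simp

/-- Read the binary digits of an index from `c`. -/
def readIndex : Cmd Reg :=
  .seq (copy r h tmp) <| each h fun _ => .pop c (fun b => .seq (.push c2 b) <|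
    .seq (double I J) (bif b then .push I true else .skip)) .skip

/-- Horner's rule in unary, which is affordable because the index is below `2 ^ R`. If the code ends
early, the remaining rounds do nothing, in agreement with `take` and `drop`. The bits are saved on
`c2` so that the code can be restored. -/
theorem run_readIndex {s : Store Reg} {R : ℕ} {y : List Bool} (hr : s r = .replicate R true)
    (hI : s I = []) (hJ : s J = []) (hh : s h = []) (ht : s tmp = []) (hc : s c = y) :
    Run O readIndex s (2 * R + 2 + (R * (3 * 2 ^ R + 3) + 1))
      (update (update (update s c (y.drop R)) c2 ((y.take R).reverse ++ s c2)) I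
        (.replicate (horner (y.take R)) true)) := by
  have h1 := run_copy (O := O) (a := r) (b := h) (c := tmp) (by decide) (by decide) (by decide) ht
  have h2 := run_each (O := O) (a := h) (τ := 3 * 2 ^ R + 2) (w := .replicate R true)
    (P := fun _ => .pop c (fun b => .seq (.push c2 b) <|
      .seq (double I J) (bif b then .push I true else .skip)) .skip)
    (fun d l => update (update (update (update s h l) c (y.drop d.length)) c2
      ((y.take d.length).reverse ++ s c2)) I (.replicate (horner (y.take d.length)) true))
    (fun d l _ => by simp) (fun d x l hd => by
      have hdR : d.length < R := by
        have := congrArg List.length hd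
        simp at this; omega
      rcases lt_or_ge d.length y.length with hdy | hdy
      · have hdrop := List.drop_eq_getElem_cons hdy
        have htake := List.take_succ_eq_append_getElem hdy
        set z := y[d.length] with hz
        set k := horner (y.take d.length) with hk
        have hkR : k ≤ 2 ^ R := (horner_lt _).le.trans (Nat.pow_le_pow_right (by norm_num) (by
          rw [List.length_take]; omega))
        have h3 : horner (y.take (d.length + 1)) = 2 * k + z.toNat := by
          rw [htake, horner_concat]
        have h4 := run_double (O := O) (I := I) (J := J) (by decide) (k := k)
          (s := update (update (update (update (update (update s h l) c (y.drop (d.length + 1))) c2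
            ((y.take d.length).reverse ++ s c2)) I (.replicate k true)) c (y.drop (d.length + 1)))
              c2 (z :: ((y.take d.length).reverse ++ s c2))) (by simp [hJ]) (by simp)
        have h5 : (y.take (d ++ [x]).length).reverse = z :: (y.take d.length).reverse := by
          rw [List.length_append, List.length_singleton, htake]; simp
        have h6 : horner (y.take (d ++ [x]).length) = 2 * k + z.toNat := by
          rw [List.length_append, List.length_singleton, h3]
        refine (Run.pop_some (b := z) (l := y.drop (d.length + 1)) ?_
          ((Run.push _ _ _).seq ((h4.convert ?_ rfl le_rfl).seq (t' := 0) (s'' := update (update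
            (update (update s h l) c (y.drop (d ++ [x]).length)) c2
              ((y.take (d ++ [x]).length).reverse ++ s c2)) I
                (.replicate (horner (y.take (d ++ [x]).length)) true)) ?_))).of_eq rfl ?_
        · rw [update_of_ne (by decide), update_of_ne (by decide), update_of_ne (by decide),
            update_self, hdrop]
        · funext q; simp only [update_apply]; grind
        · rw [h5, h6, List.length_append, List.length_singleton]
          cases z
          · refine (Run.skip _).of_eq ?_ le_rfl
            funext q; simp only [update_apply, Bool.toNat_false, Nat.add_zero]; grind
          · refine Run.push' ?_
            funext q; simp only [update_apply, Bool.toNat_true, List.replicate_succ]; grind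
        · omega
      · have e1 : y.drop d.length = [] := List.drop_eq_nil_of_le hdy
        have e2 : y.drop (d ++ [x]).length = [] := List.drop_eq_nil_of_le (by simp; omega)
        have e3 : y.take d.length = y := List.take_of_length_le hdy
        have e4 : y.take (d ++ [x]).length = y := List.take_of_length_le (by simp; omega)
        refine (Run.pop_none (by simp [e1]) (.skip _)).of_eq ?_ (by omega)
        rw [e1, e2, e3, e4]
        funext q; simp only [update_apply]
        grind)
  refine (h1.seq (h2.convert ?_ rfl le_rfl)).of_eq ?_ ?_
  · funext q; simp only [update_apply, hr]
    simp [horner]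
    grind
  · simp only [List.length_replicate]
    funext q; simp only [update_apply]
    grind
  · simp [hr]

/-- The store that holds a state of the evaluation of a code. -/
def setEval (s : Store Reg) (e : EvalState Bool) : Store Reg :=
  update (update (update s V e.V) T e.T) G (.replicate e.G true)

/-- Push the table entry with index `I` to `V`. -/
def lookup : Cmd Reg :=
  .seq (each I fun _ => .pop T (fun x => .push J x) .skip) <|
    .seq (.pop T (fun x => .seq (.push T x) (.push V x)) .skip) (move J T)

/-- The table is unwound to `J` as far as the index demands and then wound back. An index beyond the
table pushes nothing, as in `EvalState.ref`. -/
theorem run_lookup {s : Store Reg} (hI : s I = []) (hJ : s J = []) (e : EvalState Bool) (i : ℕ) :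
    Run O lookup (update (setEval s e) I (.replicate i true)) (i + e.T.length + 2)
      (setEval s (e.ref i)) := by
  obtain ⟨V', T', G'⟩ := e
  have h1 := run_each (O := O) (a := I) (τ := 0) (w := .replicate i true)
    (P := fun _ => .pop T (fun x => .push J x) .skip)
    (fun d l => update (update (setEval s ⟨V', T'.drop d.length, G'⟩) I l) J
      (T'.take d.length).reverse) (fun d l _ => by simp) (fun d x l hd => by
      rcases lt_or_ge d.length T'.length with hdy | hdy
      · have hdrop := List.drop_eq_getElem_cons hdy
        have htake := List.take_succ_eq_append_getElem hdy
        refine (Run.pop_some (b := T'[d.length]) (l := T'.drop (d.length + 1)) ?_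
          (.push _ _ _)).of_eq ?_ (by omega)
        · simp only [setEval, update_apply]; grind
        rw [List.length_append, List.length_singleton, htake]
        funext q; simp only [update_apply, setEval]
        grind
      · have e1 : T'.drop d.length = [] := List.drop_eq_nil_of_le hdy
        have e2 : T'.drop (d ++ [x]).length = [] := List.drop_eq_nil_of_le (by simp; omega)
        have e3 : T'.take d.length = T' := List.take_of_length_le hdy
        have e4 : T'.take (d ++ [x]).length = T' := List.take_of_length_le (by simp; omega)
        refine (Run.pop_none (by simp [setEval, e1]) (.skip _)).of_eq ?_ (by omega)
        rw [e1, e2, e3, e4]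
        funext q; simp only [update_apply]
        grind)
  have h2 : Run O (.pop T (fun x => .seq (.push T x) (.push V x)) .skip)
      (update (update (setEval s ⟨V', T'.drop i, G'⟩) I []) J (T'.take i).reverse) 0
      (update (update (setEval s ⟨T'[i]?.toList ++ V', T'.drop i, G'⟩) I []) J
        (T'.take i).reverse) := by
    rcases lt_or_ge i T'.length with hi | hi
    · have hdrop := List.drop_eq_getElem_cons hi
      refine (Run.pop_some (b := T'[i]) (l := T'.drop (i + 1)) ?_
        ((Run.push _ _ _).seq (Run.push _ _ _))).of_eq ?_ le_rfl
      · simp only [setEval, update_apply]; grind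
      rw [List.getElem?_eq_getElem hi]
      funext q; simp only [update_apply, setEval]
      grind
    · have e1 : T'.drop i = [] := List.drop_eq_nil_of_le hi
      refine (Run.pop_none (by simp [setEval, e1]) (.skip _)).of_eq ?_ le_rfl
      simp [hi]
  have h3 := run_move (O := O) (a := J) (b := T) (by decide)
    (update (update (setEval s ⟨T'[i]?.toList ++ V', T'.drop i, G'⟩) I []) J (T'.take i).reverse)
  refine ((h1.convert ?_ ?_ le_rfl).seq (h2.seq h3)).of_eq ?_ ?_
  · funext q; simp only [update_apply, setEval]
    simp
    grind
  · simp
  · simp only [EvalState.ref, update_apply, setEval]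
    funext q; simp only [update_apply]
    have : (T'.take i) ++ (T'.drop i) = T' := List.take_append_drop ..
    grind
  · simp
    omega

/-- Apply a gate to the two topmost operands. -/
def applyOp (op : Bool → Bool → Bool) : Cmd Reg :=
  .pop V (fun v₂ => .pop V (fun v₁ =>
    .pop G (fun _ => .seq (.push V (op v₁ v₂)) (.push T (op v₁ v₂)))
      (.seq (.push V v₁) (.push V v₂))) (.push V v₂)) .skip

theorem run_applyOp (s : Store Reg) (e : EvalState Bool) (op : Bool → Bool → Bool) :
    Run O (applyOp op) (setEval s e) 0 (setEval s (e.gate (fun op => op) op)) := by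
  obtain ⟨V', T', G'⟩ := e
  match V', G' with
  | [], _ => exact .pop_none (by simp [setEval]) (.skip _)
  | [v], _ =>
    refine .pop_some (b := v) (l := []) (by simp [setEval]) (.pop_none (by simp) (Run.push' ?_))
    funext q; simp only [EvalState.gate, update_apply, setEval]
    grind
  | v₂ :: v₁ :: V', 0 =>
    refine (Run.pop_some (b := v₂) (l := v₁ :: V') (by simp [setEval]) (.pop_some (b := v₁) (l := V')
      (by simp) (.pop_none (by simp [setEval]) ((Run.push _ _ _).seq (Run.push _ _ _))))).of_eq ?_
        le_rfl
    funext q; simp only [EvalState.gate, update_apply, setEval]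
    grind
  | v₂ :: v₁ :: V', k + 1 =>
    refine (Run.pop_some (b := v₂) (l := v₁ :: V') (by simp [setEval]) (.pop_some (b := v₁) (l := V')
      (by simp) (.pop_some (b := true) (l := .replicate k true) (by simp [setEval,
        List.replicate_succ]) ((Run.push _ _ _).seq (Run.push _ _ _))))).of_eq ?_ le_rfl
    funext q; simp only [EvalState.gate, update_apply, setEval]
    grind

/-- Read the truth table of a gate from `c` and apply it. -/
def readGate : Cmd Reg :=
  .pop c (fun b₁ => .seq (.push c2 b₁) <| .pop c (fun b₂ => .seq (.push c2 b₂) <|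
    .pop c (fun b₃ => .seq (.push c2 b₃) <| .pop c (fun b₄ => .seq (.push c2 b₄) <|
      applyOp (gateOp b₁ b₂ b₃ b₄)) .skip) .skip) .skip) .skip

/-- Evaluate the code in `c`, moving it to `c2`. -/
def evalLoop : Cmd Reg :=
  each c fun b => .seq (.push c2 b) (bif b then readGate else .seq readIndex lookup)

/-- The state of the evaluation of a code, together with the code. -/
def setCode (s : Store Reg) (e : EvalState Bool) (y z : List Bool) : Store Reg :=
  update (update (setEval s e) c y) c2 z

/-- Table length plus budget never changes and stays below `b`, so a lookup costs O(b). Together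
with the unary arithmetic for an index, every bit of the code can be charged `20 * (b * b)`. -/
theorem run_evalLoop {s : Store Reg} {R b : ℕ} (hr : s r = .replicate R true) (hI : s I = [])
    (hJ : s J = []) (hh : s h = []) (ht : s tmp = []) (hR : 2 ^ R ≤ b) (y z : List Bool)
    (e : EvalState Bool) (hb : e.T.length + e.G ≤ b) :
    Run O evalLoop (setCode s e y z) (y.length * (20 * (b * b)) + 1)
      (setCode s (evalCode (fun op => op) R y e) [] (y.reverse ++ z)) := by
  have hb1 : 1 ≤ b := Nat.one_le_two_pow.trans hR
  have hRb : R ≤ b := (Nat.lt_two_pow_self).le.trans hR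
  have hRR : R * 2 ^ R ≤ b * b := Nat.mul_le_mul hRb hR
  have hbb : b ≤ b * b := Nat.le_mul_of_pos_left _ hb1
  fun_induction evalCode (fun op => op) R y e generalizing z with
  | case1 e =>
    refine (Run.loop_none ?_ (.skip _)).of_eq ?_ (by omega)
    · simp [setCode]
    · simp [setCode]
  | case2 b₁ b₂ b₃ b₄ y e ih =>
    have h1 := run_applyOp (O := O) (update (update s c y) c2 (b₄ :: b₃ :: b₂ :: b₁ :: true :: z)) e
      (gateOp b₁ b₂ b₃ b₄)
    have h2 : e.T.length + e.G = (e.gate (fun op => op) (gateOp b₁ b₂ b₃ b₄)).T.length +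
        (e.gate (fun op => op) (gateOp b₁ b₂ b₃ b₄)).G := by
      obtain ⟨V', T', G'⟩ := e
      match V', G' with
      | [], _ => rfl
      | [v], _ => rfl
      | v₂ :: v₁ :: V', 0 => rfl
      | v₂ :: v₁ :: V', k + 1 => simp [EvalState.gate]; omega
    refine (Run.loop_cont (b := true) (l := b₁ :: b₂ :: b₃ :: b₄ :: y) (t := 0) (by simp [setCode])
      rfl (s' := setCode s (e.gate (fun op => op) (gateOp b₁ b₂ b₃ b₄)) y
        (b₄ :: b₃ :: b₂ :: b₁ :: true :: z)) ?_ (ih (b₄ :: b₃ :: b₂ :: b₁ :: true :: z) (by omega))).of_eq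
      ?_ ?_
    · refine (Run.push _ _ _).seq (t := 0) (t' := 0) (.pop_some (b := b₁) (l := b₂ :: b₃ :: b₄ :: y)
        (by simp) ?_)
      refine (Run.push _ _ _).seq (t := 0) (t' := 0) (.pop_some (b := b₂) (l := b₃ :: b₄ :: y)
        (by simp) ?_)
      refine (Run.push _ _ _).seq (t := 0) (t' := 0) (.pop_some (b := b₃) (l := b₄ :: y)
        (by simp) ?_)
      refine (Run.push _ _ _).seq (t := 0) (t' := 0) (.pop_some (b := b₄) (l := y)
        (by simp) ?_)
      refine (Run.push _ _ _).seq (t := 0) (t' := 0) (h1.convert ?_ ?_ le_rfl)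
      · funext q; simp only [setCode, setEval, update_apply]; grind
      · funext q; simp only [setCode, setEval, update_apply]; grind
    · simp
    · simp only [List.length_cons]
      nlinarith
  -- A truncated gate instruction: the machine consumes the fewer than four remaining bits and
  -- applies nothing, as `evalCode` prescribes.
  | case3 y e hy =>
    have h0 : ∀ l, Run O (.loop c (fun _ => true) (fun b => .seq (.push c2 b)
        (bif b then readGate else .seq readIndex lookup)) .skip) (setCode s e [] l) 1
        (setCode s e [] l) := fun l => (Run.loop_none (by simp [setCode]) (.skip _))
    refine (Run.loop_cont (b := true) (l := y) (t := 0) (by simp [setCode])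
      rfl (s' := setCode s e [] (y.reverse ++ true :: z)) ?_ (h0 _)).of_eq ?_ ?_
    · refine (Run.push _ _ _).seq (t := 0) (t' := 0) ?_
      match y with
      | [] =>
        refine (Run.pop_none (by simp) (.skip _)).of_eq ?_ le_rfl
        funext q; simp only [setCode, setEval, update_apply]; grind
      | [b₁] =>
        refine (Run.pop_some (b := b₁) (l := []) (by simp) ((Run.push _ _ _).seq (t := 0) (t' := 0)
          (Run.pop_none (by simp) (.skip _)))).of_eq ?_ le_rfl
        funext q; simp only [setCode, setEval, update_apply]; grind
      | [b₁, b₂] =>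
        refine (Run.pop_some (b := b₁) (l := [b₂]) (by simp) ((Run.push _ _ _).seq (t := 0)
          (t' := 0) (Run.pop_some (b := b₂) (l := []) (by simp) ((Run.push _ _ _).seq (t := 0)
          (t' := 0) (Run.pop_none (by simp) (.skip _)))))).of_eq ?_ le_rfl
        funext q; simp only [setCode, setEval, update_apply]; grind
      | [b₁, b₂, b₃] =>
        refine (Run.pop_some (b := b₁) (l := [b₂, b₃]) (by simp) ((Run.push _ _ _).seq (t := 0)
          (t' := 0) (Run.pop_some (b := b₂) (l := [b₃]) (by simp) ((Run.push _ _ _).seq (t := 0)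
          (t' := 0) (Run.pop_some (b := b₃) (l := []) (by simp) ((Run.push _ _ _).seq (t := 0)
          (t' := 0) (Run.pop_none (by simp) (.skip _)))))))).of_eq ?_ le_rfl
        funext q; simp only [setCode, setEval, update_apply]; grind
      | b₁ :: b₂ :: b₃ :: b₄ :: y => exact absurd rfl (hy b₁ b₂ b₃ b₄ y)
    · simp
    · simp only [List.length_cons]
      nlinarith
  | case4 y e ih =>
    have h1 := run_readIndex (O := O) (s := update (update (setEval s e) c y) c2 (false :: z))
      (R := R) (y := y) (by simp [setEval, hr]) (by simp [setEval, hI]) (by simp [setEval, hJ])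
      (by simp [setEval, hh]) (by simp [setEval, ht]) (by simp)
    have h2 := run_lookup (O := O) (s := update (update s c (y.drop R)) c2
      ((y.take R).reverse ++ false :: z)) (by simp [hI]) (by simp [hJ]) e (horner (y.take R))
    have hlt : horner (y.take R) ≤ 2 ^ R := (horner_lt _).le.trans
      (Nat.pow_le_pow_right (by norm_num) (by rw [List.length_take]; omega))
    have h3 := ih ((y.take R).reverse ++ false :: z) hb
    refine (Run.loop_cont (b := false) (l := y) (by simp [setCode]) rfl
      ((Run.push _ _ _).seq ((h1.convert ?_ ?_ le_rfl).seq h2)) (h3.convert ?_ ?_ le_rfl)).of_eq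
      rfl ?_
    · funext q; simp only [setCode, setEval, update_apply]; grind
    · funext q; simp only [setEval, update_apply]; grind
    · funext q; simp only [setCode, setEval, update_apply]; grind
    · congr 1
      rw [← List.append_assoc, ← List.reverse_append, List.take_append_drop, List.reverse_cons,
        List.append_assoc, List.singleton_append]
    · have h4 : (y.drop R).length ≤ y.length := by simp
      have h5 := Nat.mul_le_mul_right (20 * (b * b)) h4
      simp only [List.length_cons, add_mul, mul_add]
      simp only [one_mul]
      nlinarith

end AlmostNatural

namespace AlmostNatural

open Function Cmd Reg

variable {O : List Bool → List Bool → ℕ → Prop}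

/-! ### The decision procedure: queries and records -/

theorem EvalState.length_gate (op : Bool → Bool → Bool) (e : EvalState Bool) :
    (e.gate (fun op => op) op).T.length + (e.gate (fun op => op) op).G = e.T.length + e.G ∧
      (e.gate (fun op => op) op).V.length ≤ e.V.length := by
  obtain ⟨V', T', G'⟩ := e
  match V', G' with
  | [], _ => exact ⟨rfl, le_rfl⟩
  | [v], _ => exact ⟨rfl, le_rfl⟩
  | v₂ :: v₁ :: V', 0 => exact ⟨rfl, le_rfl⟩
  | v₂ :: v₁ :: V', k + 1 => simp [EvalState.gate]; omega

theorem length_evalCode (k : ℕ) (l : List Bool) (e : EvalState Bool) :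
    (evalCode (fun op => op) k l e).T.length + (evalCode (fun op => op) k l e).G =
      e.T.length + e.G ∧ (evalCode (fun op => op) k l e).V.length ≤ e.V.length + l.length := by
  fun_induction evalCode (fun op => op) k l e with
  | case1 e => simp
  | case2 b₁ b₂ b₃ b₄ l e ih =>
    have := e.length_gate (gateOp b₁ b₂ b₃ b₄)
    simp only [List.length_cons]
    omega
  | case3 l e hy => simp
  | case4 l e ih =>
    have h1 : (e.ref (horner (l.take k))).V.length ≤ e.V.length + 1 := by
      simp only [EvalState.ref, List.length_append]
      cases e.T[horner (l.take k)]? <;> simp; omega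
    have h2 : (e.ref (horner (l.take k))).T = e.T := rfl
    have h3 : (e.ref (horner (l.take k))).G = e.G := rfl
    rw [h2, h3] at ih
    simp only [List.length_cons, List.length_drop] at ih ⊢
    omega

/-- Evaluate the code in `c` at the complement of the counter `a` and push the result to `A`. -/
def evalAssign : Cmd Reg :=
  .seq (move a tmp) <| .seq (each tmp fun b => .seq (.push a b) (.push T !b)) <|
  .seq (.pop T (fun b => .seq (.push T b) (.push V b)) .skip) <|
  .seq (copy g G tmp) <| .seq evalLoop <|
  .seq (.pop V (fun b => .seq (.push A b) (.push A true)) .skip) <|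
  .seq (clear V) <| .seq (clear T) <| .seq (clear G) <| move c2 c

/-- The parameters of the enumeration of codes are set, and the working stacks are empty. -/
structure Ready (s : Store Reg) (k γ R : ℕ) : Prop where
  hg : s g = .replicate γ true
  hr : s r = .replicate R true
  ha : s a = bitsLE k 0
  hT : s T = []
  hV : s V = []
  hG : s G = []
  hI : s I = []
  hJ : s J = []
  hh : s h = []
  htmp : s tmp = []
  hc2 : s c2 = []
  hZ : s Z = []
  hZ2 : s Z2 = []

theorem bitsLE_compl {k i : ℕ} (hi : i < 2 ^ k) :
    (bitsLE k i).map (fun b => !b) = bitsLE k (2 ^ k - 1 - i) := by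
  rw [bitsLE, bitsLE, List.map_map]
  refine List.map_congr_left fun j hj => ?_
  rw [List.mem_range] at hj
  have : 2 ^ k - 1 - i = 2 ^ k - (i + 1) := by omega
  rw [this, Nat.testBit_two_pow_sub_succ hi]
  simp [hj]

theorem run_evalAssign {s : Store Reg} {k γ R b i : ℕ} (hs : Ready s k γ R) (hk : 1 ≤ k)
    (hi : i < 2 ^ k) (hR : 2 ^ R ≤ b) (hb : k + γ ≤ b) (hy : (s c).length ≤ b) :
    Run O evalAssign (update s a (bitsLE k i)) (40 * (b * b * b)) (update (update s a (bitsLE k i)) A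
      (true :: codedFun k γ R (s c) (bitString k (2 ^ k - 1 - i)) :: s A)) := by
  obtain ⟨hg, hr, ha, hT, hV, hG, hI, hJ, hh, htmp, hc2, hZ, hZ2⟩ := hs
  have h1 := run_move (O := O) (a := a) (b := tmp) (by decide) (update s a (bitsLE k i))
  set l := bitsLE k i with hl
  set e : EvalState Bool := .init (bitsLE k (2 ^ k - 1 - i)) γ with he
  set e' := evalCode (fun op => op) R (s c) e with he'
  have h2 := run_each (O := O) (a := tmp) (P := fun b => .seq (.push a b) (.push T !b)) (τ := 0)
    (w := l.reverse) (fun d l' => update (update (update s tmp l') a d.reverse) T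
      (d.reverse.map fun b => !b)) (fun d l' _ => by simp) (fun d x l' _ =>
      (Run.push' rfl).seq (t := 0) (Run.push' (by
        funext q; simp only [update_apply, List.reverse_append, List.reverse_singleton,
          List.singleton_append, List.map_cons]; grind)))
  -- Complementing all digits of `i` gives the digits of `2 ^ k - 1 - i`.
  rw [List.reverse_reverse, hl, bitsLE_compl hi, ← hl] at h2
  obtain ⟨z, L, hzL⟩ : ∃ z L, bitsLE k (2 ^ k - 1 - i) = z :: L :=
    List.exists_cons_of_length_pos (by simp; omega)
  have h3 : Run O (.pop T (fun b => .seq (.push T b) (.push V b)) .skip)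
      (update (update s a l) T (bitsLE k (2 ^ k - 1 - i))) 0
      (update (update (update s a l) T e.T) V e.V) := by
    refine (Run.pop_some (b := z) (l := L) (by simp [hzL])
      ((Run.push _ _ _).seq (Run.push _ _ _))).of_eq ?_ le_rfl
    funext q; simp only [update_apply, he, EvalState.init, hzL, List.take_succ_cons, List.take_zero]
    grind
  have h4 := run_copy (O := O) (a := g) (b := G) (c := tmp) (by decide) (by decide) (by decide)
    (s := (update (update (update s a l) T e.T) V e.V)) (by simp [htmp])
  have hlen : e.T.length + e.G ≤ b := by simpa [he, EvalState.init] using hb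
  have h5 := run_evalLoop (O := O) (s := update s a l) (R := R) (b := b) (by simp [hr])
    (by simp [hI]) (by simp [hJ]) (by simp [hh]) (by simp [htmp]) hR (s c) [] e hlen
  obtain ⟨V', hV'⟩ := evalCode_bitsLE hk γ R (2 ^ k - 1 - i) (s c)
  set v := codedFun k γ R (s c) (bitString k (2 ^ k - 1 - i)) with hv
  have hV'' : e'.V = v :: V' := hV'
  have h6 : Run O (.pop V (fun b => .seq (.push A b) (.push A true)) .skip)
      (setCode (update s a l) e' [] ((s c).reverse ++ [])) 0
      (setCode (update (update s a l) A (true :: v :: s A)) ⟨V', e'.T, e'.G⟩ [] (s c).reverse) := by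
    refine (Run.pop_some (b := v) (l := V') (by simp [setCode, setEval, hV''])
      ((Run.push _ _ _).seq (Run.push _ _ _))).of_eq ?_ le_rfl
    funext q; simp only [update_apply, setCode, setEval]; grind
  have h7 := run_clear (O := O) V
    (setCode (update (update s a l) A (true :: v :: s A)) ⟨V', e'.T, e'.G⟩ [] (s c).reverse)
  have h8 := run_clear (O := O) T
    (setCode (update (update s a l) A (true :: v :: s A)) ⟨[], e'.T, e'.G⟩ [] (s c).reverse)
  have h9 := run_clear (O := O) G
    (setCode (update (update s a l) A (true :: v :: s A)) ⟨[], [], e'.G⟩ [] (s c).reverse)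
  have h10 := run_move (O := O) (a := c2) (b := c) (by decide)
    (update (update (update (update s a l) A (true :: v :: s A)) c []) c2 (s c).reverse)
  have hL := length_evalCode R (s c) e
  rw [← he'] at hL
  have hVl : e.V.length ≤ 1 := by simp [he, EvalState.init]
  rw [hV'', List.length_cons] at hL
  refine (h1.seq ((h2.convert ?_ ?_ le_rfl).seq (h3.seq (h4.seq ((h5.convert ?_ rfl le_rfl).seq
    (h6.seq ((h7.convert rfl ?_ le_rfl).seq ((h8.convert rfl ?_ le_rfl).seq ((h9.convert rfl ?_
      le_rfl).seq h10))))))))).of_eq ?_ ?_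
  · funext q; simp only [update_apply]; simp; grind
  · funext q; simp only [update_apply]; grind
  · funext q; simp only [update_apply, setCode, setEval]; simp [he, EvalState.init]; grind
  · funext q; simp only [update_apply, setCode, setEval]; grind
  · funext q; simp only [update_apply, setCode, setEval]; grind
  · funext q; simp only [update_apply, setCode, setEval]; grind
  · funext q; simp only [update_apply]; grind
  · have e1 : (update s a l a).length = k := by simp [hl]
    have e2 : l.reverse.length = k := by simp [hl]
    have e3 : ((update (update (update s a l) T e.T) V e.V) g).length = γ := by simp [hg]
    have e4 : (setCode (update (update s a l) A (true :: v :: s A)) ⟨V', e'.T, e'.G⟩ []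
      (s c).reverse V).length = V'.length := by simp [setCode, setEval]
    have e5 : (setCode (update (update s a l) A (true :: v :: s A)) ⟨[], e'.T, e'.G⟩ []
      (s c).reverse T).length = e'.T.length := by simp [setCode, setEval]
    have e6 : (setCode (update (update s a l) A (true :: v :: s A)) ⟨[], [], e'.G⟩ []
      (s c).reverse G).length = e'.G := by simp [setCode, setEval]
    have e7 : ((update (update (update (update s a l) A (true :: v :: s A)) c []) c2
      (s c).reverse) c2).length = (s c).length := by simp
    rw [e1, e2, e3, e4, e5, e6, e7]
    have hb1 : 1 ≤ b := by omega
    have hbb : b ≤ b * b := Nat.le_mul_of_pos_left _ hb1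
    have hbbb : b * b ≤ b * b * b := Nat.le_mul_of_pos_right _ hb1
    have := Nat.mul_le_mul_right (20 * (b * b)) hy
    have e8 : b * (20 * (b * b)) = 20 * (b * b * b) := by ring
    omega

/-- The representation of an item on a stack. -/
def encItem (q : Item) : List Bool := q.1.flatMap (fun b => [true, b]) ++ [false, q.2.1, q.2.2]

/-- The representation of a list of items on a stack. -/
def encItems (l : List Item) : List Bool := l.flatMap encItem

theorem encItems_cons (q : Item) (l : List Item) : encItems (q :: l) = encItem q ++ encItems l := by
  simp [encItems]

/-- The query for the truth table of a function. -/
def query {k : ℕ} (f : BoolFun k) : Item := (truthTable f, true, false)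

/-- Push the query for the function with code `c` to `A`. -/
def queryBody : Cmd Reg :=
  .seq (.push A false) <| .seq (.push A true) <| .seq (.push A false) <| countLoop a tmp Z2 evalAssign

/-- The value pushed last lies on top. Since the counter only counts upwards, evaluating at its
complement visits the arguments in descending order and leaves the truth table in the right order.
-/
theorem truthTable_eq {k : ℕ} (f : BoolFun k) : truthTable f =
    ((List.range (2 ^ k)).map fun i => f (bitString k (2 ^ k - 1 - i))).reverse := by
  rw [truthTable]
  refine List.ext_getElem (by simp) fun j h1 h2 => ?_
  simp only [List.length_ofFn] at h1
  rw [List.getElem_ofFn, List.getElem_reverse, List.getElem_map, List.getElem_range]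
  congr 2
  simp
  omega

theorem run_queryBody {s : Store Reg} {k γ R b : ℕ} (hs : Ready s k γ R) (hk : 1 ≤ k)
    (hR : 2 ^ R ≤ b) (hb : k + γ ≤ b) (hy : (s c).length ≤ b) :
    Run O queryBody s (2 ^ k * (40 * (b * b * b) + 2 * k + 3) + 1)
      (update s A (encItem (query (codedFun k γ R (s c))) ++ s A)) := by
  let F : ℕ → Store Reg := fun j => update (update s a (bitsLE k j)) A
    (((List.range j).map fun i => codedFun k γ R (s c)
      (bitString k (2 ^ k - 1 - i))).reverse.flatMap (fun b => [true, b]) ++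
        false :: true :: false :: s A)
  have hF : ∀ j, update (update (F j) a (bitsLE k j)) A (true :: codedFun k γ R (s c)
      (bitString k (2 ^ k - 1 - j)) :: F j A) = update (F (j + 1)) a (bitsLE k j) := by
    intro j
    simp only [F, List.range_succ, List.map_append, List.map_cons, List.map_nil,
      List.reverse_append, List.reverse_singleton, List.singleton_append, List.flatMap_cons]
    funext q; simp only [update_apply]; grind
  have hready : ∀ j, Ready (update (F j) a (bitsLE k 0)) k γ R := fun j => by
    obtain ⟨hg, hr, ha, hT, hV, hG, hI, hJ, hh, htmp, hc2, hZ, hZ2⟩ := hs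
    constructor <;> simp [F, *]
  have h1 := run_countLoop (O := O) (c := a) (tmp := tmp) (Z := Z2) (P := evalAssign) (L := k)
    (τ := 40 * (b * b * b)) (by decide) (by decide) (by decide) F
    (fun j => update (F (j + 1)) a (bitsLE k j))
    (fun i _ => (by simp [F, hs.hZ2])) (fun i hi => ?_) (fun i _ => by simp)
    (fun i _ => by simp [F, hs.htmp]) (fun i _ => by simp [F, hs.hZ2])
    (fun i _ => by funext q; simp only [F, update_apply]; grind)
  · refine ((Run.push _ _ _).seq (t := 0) ((Run.push _ _ _).seq (t := 0) ((Run.push _ _ _).seq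
      (t := 0) (h1.convert ?_ rfl le_rfl)))).of_eq ?_ (by omega)
    · simp only [F, ← hs.ha]
      funext q; simp only [update_apply]; simp; grind
    · simp only [F, bitsLE_two_pow, ← hs.ha, encItem, query, truthTable_eq]
      funext q; simp only [update_apply]; simp; grind
  · have := run_evalAssign (O := O) (i := i) (b := b) (hready i) hk hi hR hb (by simpa [F] using hy)
    refine this.convert ?_ ?_ le_rfl
    · funext q; simp only [F, update_apply]; grind
    · rw [← hF]
      funext q; simp only [F, update_apply]; grind

/-- The queries for all functions with codes of length `L`. -/
def queries (k γ R L : ℕ) : List Item :=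
  ((List.range (2 ^ L)).map fun i => query (codedFun k γ R (bitsLE L i))).reverse

/-- Push the queries for all codes to `A`. -/
def queryLoop : Cmd Reg := countLoop c tmp Z queryBody

theorem run_queryLoop {s : Store Reg} {k γ R b L : ℕ} (hs : Ready s k γ R) (hk : 1 ≤ k)
    (hR : 2 ^ R ≤ b) (hb : k + γ ≤ b) (hL : L ≤ b) (hc : s c = bitsLE L 0) :
    Run O queryLoop s (2 ^ L * ((2 ^ k * (40 * (b * b * b) + 2 * k + 3) + 1) + 2 * L + 3) + 1)
      (update s A (encItems (queries k γ R L) ++ s A)) := by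
  let F : ℕ → Store Reg := fun j => update (update s c (bitsLE L j)) A
    (encItems ((List.range j).map fun i => query (codedFun k γ R (bitsLE L i))).reverse ++ s A)
  have hready : ∀ j, Ready (F j) k γ R := fun j => by
    obtain ⟨hg, hr, ha, hT, hV, hG, hI, hJ, hh, htmp, hc2, hZ, hZ2⟩ := hs
    constructor <;> simp [F, *]
  have h1 := run_countLoop (O := O) (c := c) (tmp := tmp) (Z := Z) (P := queryBody) (L := L)
    (τ := 2 ^ k * (40 * (b * b * b) + 2 * k + 3) + 1) (by decide) (by decide) (by decide) F
    (fun j => update (F (j + 1)) c (bitsLE L j))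
    (fun i _ => (by simp [F, hs.hZ])) (fun i hi => ?_) (fun i _ => by simp)
    (fun i _ => by simp [F, hs.htmp]) (fun i _ => by simp [F, hs.hZ])
    (fun i _ => by funext q; simp only [F, update_apply]; grind)
  · refine h1.convert ?_ ?_ le_rfl
    · simp only [F, ← hc]
      funext q; simp only [update_apply]; simp [encItems]; grind
    · simp only [F, bitsLE_two_pow, ← hc, queries]
      funext q; simp only [update_apply]; grind
  · have := run_queryBody (O := O) (b := b) (hready i) hk hR hb (by simpa [F] using hL)
    refine this.convert rfl ?_ le_rfl
    simp only [F, List.range_succ, List.map_append, List.map_cons, List.map_nil,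
      List.reverse_append, List.reverse_singleton, List.singleton_append, encItems_cons]
    funext q; simp only [update_apply]; simp; grind

/-- The records for the positions of the input `l`. -/
def records (k : ℕ) (l : List Bool) : List Item :=
  ((List.range (2 ^ k)).map fun i => ((bitsLE k i).reverse, false, l.getD i false)).reverse

/-- Push the records for all positions of the input `w` to `A`. -/
def recordLoop : Cmd Reg :=
  countLoop p tmp Z <| .seq (.pop w (fun b => .push A b) .skip) <| .seq (.push A false) <|
    .seq (.push A false) <| .seq (each p fun b => .seq (.push tmp b) <| .seq (.push A b)
      (.push A true)) <| move tmp p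

/-- The counter `p` advances together with the input. Pushing its digits reverses them, so the keys
have the most significant digit first, like the arguments behind the input bits. -/
theorem run_recordLoop {s : Store Reg} {k : ℕ} (hw : (s w).length = 2 ^ k) (ht : s tmp = [])
    (hZ : s Z = []) (hp : s p = bitsLE k 0) :
    Run O recordLoop s (2 ^ k * (4 * k + 5) + 1)
      (update (update s w []) A (encItems (records k (s w)) ++ s A)) := by
  let F : ℕ → Store Reg := fun j => update (update (update s p (bitsLE k j)) A
    (encItems ((List.range j).map fun i => ((bitsLE k i).reverse, false,
      (s w).getD i false)).reverse ++ s A)) w ((s w).drop j)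
  have h1 := run_countLoop (O := O) (c := p) (tmp := tmp) (Z := Z) (P := .seq (.pop w
      (fun b => .push A b) .skip) <| .seq (.push A false) <|
      .seq (.push A false) <| .seq (each p fun b => .seq (.push tmp b) <| .seq (.push A b)
      (.push A true)) <| move tmp p) (L := k)
    (τ := 2 * k + 2) (by decide) (by decide) (by decide) F
    (fun j => update (F (j + 1)) p (bitsLE k j))
    (fun i _ => (by simp [F, hZ])) (fun i hi => ?_) (fun i _ => by simp)
    (fun i _ => by simp [F, ht]) (fun i _ => by simp [F, hZ])
    (fun i _ => by funext q; simp only [F, update_apply]; grind)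
  · refine h1.convert ?_ ?_ (by ring_nf; omega)
    · simp only [F, ← hp]
      funext q; simp only [update_apply]; simp [encItems]; grind
    · have hd : (s w).drop (2 ^ k) = [] := by rw [← hw, List.drop_length]
      simp only [F, bitsLE_two_pow, ← hp, records, hd]
      funext q; simp only [update_apply]; grind
  · have hi' : i < (s w).length := hw ▸ hi
    set v := (s w).getD i false with hv
    have h2 : (s w).drop i = v :: (s w).drop (i + 1) := by
      rw [List.drop_eq_getElem_cons hi', hv, List.getD_eq_getElem _ _ hi']
    have h3 := run_each (O := O) (a := p) (P := fun b => .seq (.push tmp b) <| .seq (.push A b)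
      (.push A true)) (τ := 0) (w := bitsLE k i)
      (fun d l => update (update (update (update (F i) w ((s w).drop (i + 1))) p l) tmp d.reverse) A
        (d.reverse.flatMap (fun b => [true, b]) ++ false :: false :: v :: F i A))
      (fun d l _ => by simp) (fun d x l _ => (Run.push' rfl).seq (t := 0) ((Run.push' rfl).seq
        (t := 0) (Run.push' (by
          simp only [List.reverse_append, List.reverse_singleton, List.singleton_append,
            List.flatMap_cons]
          funext q; simp only [update_apply]; grind))))
    have h4 := run_move (O := O) (a := tmp) (b := p) (by decide)
      (update (update (update (update (F i) w ((s w).drop (i + 1))) p []) tmp (bitsLE k i).reverse) A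
        ((bitsLE k i).reverse.flatMap (fun b => [true, b]) ++ false :: false :: v :: F i A))
    refine (Run.seq (t := 0) (.pop_some (b := v) (l := (s w).drop (i + 1)) (by simp [F, h2])
      (.push _ _ _)) ((Run.push _ _ _).seq (t := 0) ((Run.push _ _ _).seq (t := 0)
      ((h3.convert ?_ rfl le_rfl).seq h4)))).of_eq ?_ ?_
    · funext q; simp only [F, update_apply]; simp; grind
    · simp only [F, List.range_succ, List.map_append, List.map_cons, List.map_nil,
        List.reverse_append, List.reverse_singleton, List.singleton_append, encItems_cons, encItem]
      funext q; simp only [update_apply]; simp; grind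
    · simp
      omega

end AlmostNatural

namespace AlmostNatural

open Function Cmd Reg

variable {O : List Bool → List Bool → ℕ → Prop}

/-! ### The decision procedure: sorting -/

/-- Move the rest of an item from `A` to `q`, appending the bit `b` to its key. -/
def itemRest (q : Reg) (b : Bool) : Cmd Reg :=
  .loop A id (fun x => bif x then .seq (.push q true) (.pop A (fun x => .push q x) .skip) else
    .seq (.push q true) <| .seq (.push q b) <| .seq (.push q false) <|
    .seq (.pop A (fun x => .push q x) .skip) (.pop A (fun x => .push q x) .skip)) .skip

theorem run_itemRest {q : Reg} (hq : q ≠ A) (b v t : Bool) (rest k : List Bool) {s : Store Reg}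
    (hA : s A = k.flatMap (fun b => [true, b]) ++ false :: v :: t :: rest) :
    Run O (itemRest q b) s (k.length + 1)
      (update (update s A rest) q ((encItem (k ++ [b], v, t)).reverse ++ s q)) := by
  induction k generalizing s with
  | nil =>
    refine (Run.loop_exit (b := false) hA rfl ((Run.push _ _ _).seq (t := 0) ((Run.push _ _ _).seq
      (t := 0) ((Run.push _ _ _).seq (t := 0) (.seq (t := 0) (t' := 0)
      (.pop_some (b := v) (l := t :: rest) (by simp [hq.symm]) (.push _ _ _))
      (.pop_some (b := t) (l := rest) (by simp [hq.symm]) (.push _ _ _))))))).of_eq ?_ (by simp)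
    simp only [encItem]
    funext q; simp only [update_apply]; simp; grind
  | cons z k ih =>
    refine (Run.loop_cont (b := true) hA rfl ((Run.push _ _ _).seq (t := 0) (t' := 0)
      (.pop_some (b := z) (l := k.flatMap (fun b => [true, b]) ++ false :: v :: t :: rest)
      (by simp [hq.symm]; rfl) (.push _ _ _))) (ih ?_)).of_eq ?_ (by simp)
    · simp only [update_apply]; grind
    · simp only [encItem, List.cons_append, List.flatMap_cons]
      funext q; simp only [update_apply]; simp; grind

/-- Partition the items in `A` by the first bit of their keys, and move this bit to the end. -/
def sortPass : Cmd Reg :=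
  .seq (each A fun _ => .pop A (fun b => bif b then itemRest B1 true else itemRest B0 false) .skip) <|
    .seq (move B1 A) (move B0 A)

theorem length_encItem (x : Item) : (encItem x).length = 2 * x.1.length + 3 := by
  simp [encItem, mul_comm]

theorem length_encItems {l : List Item} {N : ℕ} (hl : ∀ x ∈ l, x.1.length = N) :
    (encItems l).length = l.length * (2 * N + 3) := by
  induction l with
  | nil => simp [encItems]
  | cons x l ih =>
    rw [encItems_cons, List.length_append, length_encItem, ih fun x hx => hl x (by simp [hx]),
      hl x (by simp), List.length_cons]
    ring

theorem encItems_append (l l' : List Item) : encItems (l ++ l') = encItems l ++ encItems l' := by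
  simp [encItems]

/-- Distribution to `B0` and `B1` reverses the items and moving them back reverses them again, so
the order within each class survives. Moving `B1` first leaves the items with bit 0 on top. -/
theorem run_sortPass {s : Store Reg} {l : List Item} {N j : ℕ} (hj : j < N)
    (hl : ∀ x ∈ l, x.1.length = N) (h0 : s B0 = []) (h1 : s B1 = [])
    (hA : s A = encItems (l.map (rotateKey j))) :
    Run O sortPass s (l.length * (3 * N + 4) + 3)
      (update s A (encItems ((partitionBit j l).map (rotateKey (j + 1))))) := by
  have key : ∀ (l : List Item) (s : Store Reg), (∀ x ∈ l, x.1.length = N) →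
      s A = encItems (l.map (rotateKey j)) →
      Run O (each A fun _ => .pop A (fun b => bif b then itemRest B1 true else itemRest B0 false)
        .skip) s (l.length * (N + 1) + 1) (update (update (update s A [])
          B0 ((encItems ((l.filter fun x => !x.1.getD j false).map (rotateKey (j + 1)))).reverse ++
            s B0))
          B1 ((encItems ((l.filter fun x => x.1.getD j false).map (rotateKey (j + 1)))).reverse ++
            s B1)) := by
    intro l
    induction l with
    | nil =>
      intro s _ hA
      refine (Run.loop_none hA (.skip _)).of_eq ?_ (by simp)
      have : s A = [] := hA
      simp only [List.filter_nil, List.map_nil, encItems, List.flatMap_nil]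
      funext q; simp only [update_apply]; simp; grind
    | cons x l ih =>
      intro s hl hA
      have hx := hl x (by simp)
      obtain ⟨k, hk, hk'⟩ := head_rotateKey (x := x) (j := j) (by omega)
      have hk2 : k.length + 1 = N := by
        have := congrArg List.length hk
        simp [rotateKey] at this
        omega
      have hx2 : (rotateKey j x).2 = x.2 := rfl
      have hx3 : rotateKey (j + 1) x = (k ++ [x.1.getD j false], x.2.1, x.2.2) := by
        rw [← hk']; rfl
      set b := x.1.getD j false with hb
      have hA' : s A = true :: b :: (k.flatMap (fun b => [true, b]) ++ false :: x.2.1 :: x.2.2 ::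
          encItems (l.map (rotateKey j))) := by
        rw [hA, List.map_cons, encItems_cons, encItem, hk, hx2]; simp
      have h2 := ih (update (update (update s A (encItems (l.map (rotateKey j))))
          B0 ((encItems ((([x] : List Item).filter fun x => !x.1.getD j false).map
            (rotateKey (j + 1)))).reverse ++ s B0))
          B1 ((encItems ((([x] : List Item).filter fun x => x.1.getD j false).map
            (rotateKey (j + 1)))).reverse ++ s B1)) (fun x hx => hl x (by simp [hx])) (by simp)
      refine (Run.loop_cont (b := true) (t := N) hA' rfl (.pop_some (b := b) (update_self ..) ?_)
        h2).of_eq ?_ ?_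
      · rw [← hk2]
        cases hbb : b
        · refine (run_itemRest (q := B0) (by decide) false x.2.1 x.2.2
            (encItems (l.map (rotateKey j))) k (by simp)).of_eq ?_ le_rfl
          rw [List.filter_cons_of_pos (by rw [← hb, hbb]; rfl),
            List.filter_cons_of_neg (by rw [← hb, hbb]; decide)]
          simp only [List.filter_nil, List.map_cons, List.map_nil, hx3, hbb, encItems,
            List.flatMap_nil]
          funext q; simp only [update_apply]; simp; grind
        · refine (run_itemRest (q := B1) (by decide) true x.2.1 x.2.2
            (encItems (l.map (rotateKey j))) k (by simp)).of_eq ?_ le_rfl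
          rw [List.filter_cons_of_neg (by rw [← hb, hbb]; decide),
            List.filter_cons_of_pos (by rw [← hb, hbb])]
          simp only [List.filter_nil, List.map_cons, List.map_nil, hx3, hbb, encItems,
            List.flatMap_nil]
          funext q; simp only [update_apply]; simp; grind
      · have e : x :: l = [x] ++ l := rfl
        rw [e, List.filter_append, List.filter_append, List.map_append, List.map_append,
          encItems_append, encItems_append, List.reverse_append, List.reverse_append]
        funext q; simp only [update_apply]; simp; grind
      · rw [List.length_cons]; ring_nf; omega
  have h2 := key l s hl hA
  rw [h0, h1, List.append_nil, List.append_nil] at h2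
  set l0 := (l.filter fun x => !x.1.getD j false).map (rotateKey (j + 1)) with hl0
  set l1 := (l.filter fun x => x.1.getD j false).map (rotateKey (j + 1)) with hl1
  have h3 := run_move (O := O) (a := B1) (b := A) (by decide)
    (update (update (update s A []) B0 (encItems l0).reverse) B1 (encItems l1).reverse)
  have h4 := run_move (O := O) (a := B0) (b := A) (by decide)
    (update (update s A (encItems l1)) B0 (encItems l0).reverse)
  refine (h2.seq ((h3.convert rfl ?_ le_rfl).seq h4)).of_eq ?_ ?_
  · funext q; simp only [update_apply]; simp; grind
  · rw [partitionBit, List.map_append, ← hl0, ← hl1, encItems_append]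
    funext q; simp only [update_apply]; simp; grind
  · have e0 : (encItems l0).length = l0.length * (2 * N + 3) := length_encItems (by
      simp only [hl0, List.mem_map, List.mem_filter]
      rintro _ ⟨x, ⟨hx, _⟩, rfl⟩
      simp [rotateKey, hl x hx])
    have e1 : (encItems l1).length = l1.length * (2 * N + 3) := length_encItems (by
      simp only [hl1, List.mem_map, List.mem_filter]
      rintro _ ⟨x, ⟨hx, _⟩, rfl⟩
      simp [rotateKey, hl x hx])
    have e2 : l1.length + l0.length = l.length := by
      rw [hl0, hl1, List.length_map, List.length_map, List.length_eq_length_filter_add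
        (f := fun x => x.1.getD j false) (l := l)]
    simp only [update_self, List.length_reverse, e0, e1]
    rw [← e2]
    ring_nf
    omega

/-- Sort the items in `A`. -/
def sortLoop : Cmd Reg := each n fun _ => sortPass

theorem length_radixSort (j : ℕ) (l : List Item) : (radixSort j l).length = l.length := by
  induction j with
  | zero => rfl
  | succ j ih =>
    rw [← ih, radixSort, partitionBit, List.length_append, add_comm,
      ← List.length_eq_length_filter_add]

theorem run_sortLoop {s : Store Reg} {l : List Item} {N : ℕ} (hn : s n = .replicate N true)
    (hl : ∀ x ∈ l, x.1.length = N) (h0 : s B0 = []) (h1 : s B1 = []) (hA : s A = encItems l) :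
    Run O sortLoop s (N * (l.length * (3 * N + 4) + 4) + 1)
      (update (update s n []) A (encItems (radixSort N l))) := by
  have h2 := run_each (O := O) (a := n) (τ := l.length * (3 * N + 4) + 3) (w := .replicate N true)
    (P := fun _ => sortPass) (fun d l' => update (update s n l') A
      (encItems ((radixSort d.length l).map (rotateKey d.length)))) (fun d l' _ => by simp)
    (fun d x l' hd => by
      have hdN : d.length < N := by
        have := congrArg List.length hd
        simp at this; omega
      have := run_sortPass (O := O) (l := radixSort d.length l) (N := N) (j := d.length) hdN
        (fun x hx => hl x (mem_radixSort.1 hx)) (s := update (update s n l') A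
          (encItems ((radixSort d.length l).map (rotateKey d.length)))) (by simp [h0])
          (by simp [h1]) (by simp)
      rw [length_radixSort] at this
      refine this.convert ?_ ?_ le_rfl
      · funext q; simp only [update_apply]; grind
      · rw [List.length_append, List.length_singleton, radixSort]
        funext q; simp only [update_apply]; grind)
  refine h2.convert ?_ ?_ (by simp)
  · have : (radixSort 0 l).map (rotateKey 0) = l := by
      rw [radixSort]
      exact (List.map_congr_left (g := id) fun x _ => by simp [rotateKey]).trans (List.map_id _)
    rw [List.length_nil, this]
    funext q; simp only [update_apply]; grind
  · have : (radixSort N l).map (rotateKey N) = radixSort N l := by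
      refine (List.map_congr_left (g := id) fun x hx => ?_).trans (List.map_id _)
      rw [rotateKey, ← hl x (mem_radixSort.1 hx), List.rotate_length]
      rfl
    rw [List.length_replicate, this]

/-- Push a bit to `F` if a query in `A` comes after a record with the bit `true`. -/
def scanLoop : Cmd Reg :=
  each A fun b => bif b then .pop A (fun _ => .skip) .skip else
    .pop A (fun q => .pop A (fun t =>
      bif q then .pop D (fun _ => .seq (.push D true) (.push F true)) .skip
      else .seq (clear D) (bif t then .push D true else .skip)) .skip) .skip

theorem run_scanLoop (l : List Item) (d : Bool) {s : Store Reg} (hA : s A = encItems l)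
    (hD : s D = .replicate d.toNat true) :
    ∃ s', Run O scanLoop s (3 * (encItems l).length + 1) s' ∧
      (s' F = [] ↔ s F = [] ∧ scan d l = false) := by
  induction l generalizing s d with
  | nil =>
    exact ⟨s, (Run.loop_none hA (.skip _)).mono (by simp), by simp [scan]⟩
  | cons x l ih =>
    -- Key bits are skipped in pairs. Keys need not be compared, since sorting has already put each
    -- query behind its record.
    have hkey : ∀ (k rest : List Bool) (s s' : Store Reg) (t : ℕ),
        s A = k.flatMap (fun b => [true, b]) ++ rest →
        Run O scanLoop (update s A rest) t s' → Run O scanLoop s (k.length + t) s' := by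
      intro k
      induction k with
      | nil =>
        intro rest s s' t hA h
        refine h.convert ?_ rfl (by simp)
        rw [← show s A = rest from hA, update_eq_self]
      | cons z k ihk =>
        intro rest s s' t hA h
        refine (Run.loop_cont (b := true) (t := 0) hA rfl (.pop_some (b := z)
          (l := k.flatMap (fun b => [true, b]) ++ rest) (by simp; rfl) (.skip _))
          (ihk rest _ s' t (update_self ..) (h.convert ?_ rfl le_rfl))).mono
            (by simp only [List.length_cons]; omega)
        funext q; simp only [update_apply]; grind
    obtain ⟨k, q, t⟩ := x
    have hA' : s A = k.flatMap (fun b => [true, b]) ++ false :: q :: t :: encItems l := by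
      rw [hA, encItems_cons, encItem]; simp
    have hlen : (encItems ((k, q, t) :: l)).length = 2 * k.length + 3 + (encItems l).length := by
      rw [encItems_cons, List.length_append, length_encItem]
    suffices ∃ s₁ s', Run O (.pop A (fun q => .pop A (fun t =>
        bif q then .pop D (fun _ => .seq (.push D true) (.push F true)) .skip
        else .seq (clear D) (bif t then .push D true else .skip)) .skip) .skip)
        (update s A (q :: t :: encItems l)) 2 s₁ ∧
        Run O scanLoop s₁ (3 * (encItems l).length + 1) s' ∧
        (s' F = [] ↔ s F = [] ∧ scan d ((k, q, t) :: l) = false) by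
      obtain ⟨s₁, s', h1, h2, h3⟩ := this
      refine ⟨s', (hkey k _ s s' _ hA' (.loop_cont (update_self ..) rfl (h1.convert ?_ rfl le_rfl)
        h2)).mono (by omega), h3⟩
      funext q; simp only [update_apply]; grind
    cases q
    · obtain ⟨s', h1, h2⟩ := ih t (s := update (update s A (encItems l)) D (.replicate t.toNat true))
        (by simp) (by simp)
      refine ⟨_, s', .pop_some (b := false) (update_self ..) (.pop_some (b := t) (l := encItems l)
        (by simp) ?_), h1, by simpa [scan] using h2⟩
      have h3 := run_clear (O := O) D (update (update (update s A (false :: t :: encItems l)) A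
        (t :: encItems l)) A (encItems l))
      refine Run.of_eq (t := 2 + 0) ((h3.mono ?_).seq (s'' := update (update s A (encItems l)) D
        (.replicate t.toNat true)) ?_) rfl le_rfl
      · cases d <;> simp [hD]
      · cases t
        · refine (Run.skip _).of_eq ?_ le_rfl
          funext q; simp only [update_apply]; simp; grind
        · refine Run.push' ?_
          funext q; simp only [update_apply]; simp; grind
    · obtain ⟨s', h1, h2⟩ := ih d (s := update (update s A (encItems l)) F
        (.replicate d.toNat true ++ s F)) (by simp) (by simp [hD])
      refine ⟨_, s', .pop_some (b := true) (update_self ..) (.pop_some (b := t) (l := encItems l)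
        (by simp) ?_), h1, ?_⟩
      · cases d
        · refine (Run.pop_none (by simp [hD]) (.skip _)).of_eq ?_ (by omega)
          funext q; simp only [update_apply]; simp; grind
        · refine (Run.pop_some (b := true) (l := []) (by simp [hD]) ((Run.push _ _ _).seq
            (Run.push _ _ _))).of_eq ?_ (by omega)
          funext q; simp only [update_apply]; simp; grind
      · rw [h2]
        cases d <;> simp [scan]

/-! ### The decision procedure: counting -/

/-- Push a bit to `F` if less than `1 / n` of the bits in `w` are `true`. -/
def countPhase : Cmd Reg :=
  .seq (each w fun b => .seq (.push w2 b) (bif b then copy n U tmp else .skip)) <|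
    each w2 fun b => .seq (.push w b) (.pop U (fun _ => .skip) (.push F true))

/-- Each one in the input earns `N` tokens on `U`, and each input bit then costs one token. A
deficit shows on `F`, so this tests the density without multiplication. -/
theorem run_countPhase {s : Store Reg} {N : ℕ} (hn : s n = .replicate N true) (ht : s tmp = [])
    (hw2 : s w2 = []) (hU : s U = []) :
    Run O countPhase s ((s w).length * (2 * N + 4) + 2)
      (update (update s U (.replicate (N * (s w).count true - (s w).length) true))
        F (.replicate ((s w).length - N * (s w).count true) true ++ s F)) := by
  have h1 := run_each (O := O) (a := w) (τ := 2 * N + 2) (w := s w)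
    (P := fun b => .seq (.push w2 b) (bif b then copy n U tmp else .skip))
    (fun d l => update (update (update s w l) w2 d.reverse) U (.replicate (N * d.count true) true))
    (fun d l _ => by simp) (fun d b l _ => by
      refine Run.of_eq (t := 0 + (2 * N + 2)) ((Run.push _ _ _).seq (s'' := update (update
        (update s w l) w2 (d ++ [b]).reverse) U (.replicate (N * (d ++ [b]).count true) true)) ?_)
        rfl (by omega)
      cases b
      · refine (Run.skip _).of_eq ?_ (by omega)
        rw [List.count_append]
        funext q; simp only [update_apply]; simp; grind
      · refine (run_copy (by decide) (by decide) (by decide) (by simp [ht])).of_eq ?_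
          (by simp [hn])
        rw [List.count_append]
        funext q; simp only [update_apply]; simp [hn, mul_add]; grind)
  set C := N * (s w).count true with hC
  have h2 := run_each (O := O) (a := w2) (τ := 0) (w := (s w).reverse)
    (P := fun b => .seq (.push w b) (.pop U (fun _ => .skip) (.push F true)))
    (fun d l => update (update (update (update s w d.reverse) w2 l) U
      (.replicate (C - d.length) true)) F (.replicate (d.length - C) true ++ s F))
    (fun d l _ => by simp) (fun d b l _ => by
      refine (Run.push _ _ _).seq (t := 0) (t' := 0) ?_
      rcases lt_or_ge d.length C with h | h
      · have e : C - d.length = (C - (d ++ [b]).length) + 1 := by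
          rw [List.length_append, List.length_singleton]; omega
        have e2 : d.length - C = (d ++ [b]).length - C := by
          rw [List.length_append, List.length_singleton]; omega
        refine (Run.pop_some (b := true) (l := .replicate (C - (d ++ [b]).length) true) (by simp [e,
          List.replicate_succ]) (.skip _)).of_eq ?_ le_rfl
        rw [← e2]
        funext q; simp only [update_apply]; simp; grind
      · have e : C - d.length = 0 := by omega
        have e1 : C - (d ++ [b]).length = 0 := by
          rw [List.length_append, List.length_singleton]; omega
        have e2 : (d ++ [b]).length - C = (d.length - C) + 1 := by
          rw [List.length_append, List.length_singleton]; omega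
        refine Run.pop_none (by simp [e]) (Run.push' ?_)
        rw [e2, e1, e]
        funext q; simp only [update_apply]; simp [List.replicate_succ]; grind)
  rw [List.length_reverse, List.reverse_reverse] at h2
  refine ((h1.convert ?_ ?_ le_rfl).seq h2).of_eq ?_ ?_
  · funext q; simp only [update_apply]; simp; grind
  · funext q; simp only [update_apply]; simp; grind
  · funext q; simp only [update_apply]; grind
  · ring_nf; omega

end AlmostNatural

namespace AlmostNatural

open Function Cmd Reg

/-! ### The decision procedure: parameters -/

theorem horner_le_append (l l' : List Bool) : horner l ≤ horner (l ++ l') := by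
  induction l' using List.reverseRecOn with
  | nil => simp
  | append_singleton l' b ih => rw [← List.append_assoc, horner_concat]; omega

theorem horner_reverse_encodeNat (k : ℕ) : horner (Computability.encodeNat k).reverse = k ∧
    (Computability.encodeNat k).length ≤ k := by
  have key : ∀ p : PosNum, horner (Computability.encodePosNum p).reverse = (p : ℕ) ∧
      (Computability.encodePosNum p).length ≤ (p : ℕ) := by
    intro p
    induction p with
    | one => simp [Computability.encodePosNum, horner]
    | bit0 p ih =>
      have := PosNum.cast_pos (α := ℕ) p
      rw [Computability.encodePosNum, List.reverse_cons, horner_concat, ih.1, List.length_cons,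
        PosNum.cast_bit0]
      simp
      omega
    | bit1 p ih =>
      have := PosNum.cast_pos (α := ℕ) p
      rw [Computability.encodePosNum, List.reverse_cons, horner_concat, ih.1, List.length_cons,
        PosNum.cast_bit1]
      simp
      omega
  rw [Computability.encodeNat]
  have h1 : (((k : Num) : ℕ)) = k := Num.to_of_nat k
  cases h : (k : Num) with
  | zero =>
    rw [h] at h1
    subst h1
    simp [Computability.encodeNum, horner]
  | pos p =>
    rw [h] at h1
    rw [Computability.encodeNum, ← h1]
    exact key p

variable {O : List Bool → List Bool → ℕ → Prop}

/-- Push as many zeros to `d` as there are bits in `a`. -/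
def zeros {R : Type} (a b c d : R) : Cmd R := .seq (copy a b c) (each b fun _ => .push d false)

theorem run_zeros {R : Type} [DecidableEq R] {a b c d : R} (hab : a ≠ b) (hac : a ≠ c) (hbc : b ≠ c)
    (hbd : b ≠ d) {s : Store R} (hb : s b = []) (hc : s c = []) :
    Run O (zeros a b c d) s (3 * (s a).length + 3)
      (update s d (.replicate (s a).length false ++ s d)) := by
  have h1 := run_copy (O := O) hab hac hbc hc
  have h2 := run_each (O := O) (a := b) (P := fun _ => .push d false) (τ := 0) (w := s a)
    (fun e l => update (update s b l) d (.replicate e.length false ++ s d))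
    (fun e l _ => by simp [hbd]) (fun e x l _ => Run.push' (by
      rw [List.length_append, List.length_singleton, List.replicate_succ]
      funext q; simp only [update_apply]; grind))
  refine (h1.seq (h2.convert ?_ ?_ le_rfl)).mono (by omega)
  · rw [hb]
    funext q; simp only [update_apply]; simp; grind
  · funext q; simp only [update_apply]; grind

/-- Convert the binary number in `y` to unary. -/
def toUnary : Cmd Reg := each y fun b => .seq (double g J) (bif b then .push g true else .skip)

theorem run_toUnary {s : Store Reg} (hg : s g = []) (hJ : s J = []) :
    Run O toUnary s ((s y).length * (3 * horner (s y) + 3) + 1)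
      (update (update s y []) g (.replicate (horner (s y)) true)) := by
  set k := horner (s y) with hk
  have h1 := run_each (O := O) (a := y) (τ := 3 * k + 2) (w := s y)
    (P := fun b => .seq (double g J) (bif b then .push g true else .skip))
    (fun d l => update (update s y l) g (.replicate (horner d) true)) (fun d l _ => by simp)
    (fun d b l hd => by
      have h2 : horner d ≤ k := by rw [hk, ← hd]; exact horner_le_append _ _
      have h3 := run_double (O := O) (I := g) (J := J) (by decide) (k := horner d)
        (s := update (update (update s y (b :: l)) g (.replicate (horner d) true)) y l)
        (by simp [hJ]) (by simp)
      refine Run.of_eq (t := 3 * horner d + 2 + 0) (h3.seq (s'' := update (update s y l) g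
        (.replicate (horner (d ++ [b])) true)) ?_) rfl (by omega)
      rw [horner_concat]
      cases b
      · refine (Run.skip _).of_eq ?_ le_rfl
        funext q; simp only [update_apply]; simp; grind
      · refine Run.push' ?_
        funext q; simp only [update_apply]; simp [List.replicate_succ]; grind)
  refine h1.convert ?_ rfl le_rfl
  have : List.replicate (horner []) true = s g := by rw [hg]; rfl
  rw [this, update_eq_self, update_eq_self]

/-- Compute the parameters of the enumeration of codes from `m`. -/
def paramPhase : Cmd Reg :=
  .seq (copy m x tmp) <| .seq (.call x y) <| .seq toUnary <|
  .seq (copy m x tmp) <| .seq (copy g x tmp) <| .seq (toBin x y P B) <|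
  .seq (each B fun _ => .push r true) <| .seq (zeros m x tmp a) <|
  .seq (copy g x tmp) <| .seq (each x fun _ => .seq (zeros r h tmp c) <|
    .seq (.push c false) <| .seq (.push c false) <| .seq (.push c false) <| .seq (.push c false) <|
    .seq (.push c false) (.push c false)) <| .seq (zeros r h tmp c) (.push c false)

theorem run_paramPhase {s : Store Reg} {k γ t : ℕ} (hm : s m = .replicate k true)
    (hO : O (.replicate k true) (Computability.encodeNat γ) t) (hx : s x = []) (hy : s y = [])
    (hg : s g = []) (hP : s P = []) (hB : s B = []) (hJ : s J = []) (hh : s h = [])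
    (ht : s tmp = []) (hr : s r = []) (ha : s a = []) (hc : s c = []) {b : ℕ} (hb : k + γ ≤ b)
    (hb1 : 1 ≤ b) (hR : Nat.size (k + γ) ≤ b) :
    Run O paramPhase s (t + 60 * (b * b)) (update (update (update (update s
      g (.replicate γ true)) r (.replicate (Nat.size (k + γ)) true)) a (bitsLE k 0))
      c (bitsLE (codeLength γ (Nat.size (k + γ))) 0)) := by
  set R := Nat.size (k + γ) with hRdef
  obtain ⟨e1, e2⟩ := horner_reverse_encodeNat γ
  have h1 := run_copy (O := O) (a := m) (b := x) (c := tmp) (by decide) (by decide) (by decide)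
    (s := s) ht
  -- The unary input is invariant under reversal. The output arrives with its most significant digit
  -- on top, ready for Horner's rule.
  have h2 : Run O (.call x y) (update s x (.replicate k true)) (t + k + γ + 2)
      (update s y (Computability.encodeNat γ).reverse) := by
    have := Run.call (O := O) (a := x) (b := y) (s := update s x (.replicate k true))
      (l := Computability.encodeNat γ) (t := t) (by simpa using hO)
    refine this.of_eq ?_ ?_
    · funext q; simp only [update_apply]; simp; grind
    · simp; omega
  have h3 := run_toUnary (O := O) (s := update s y (Computability.encodeNat γ).reverse)
    (by simp [hg]) (by simp [hJ])
  rw [update_self, e1] at h3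
  set s₁ := update s g (.replicate γ true) with hs₁
  have h4 := run_copy (O := O) (a := m) (b := x) (c := tmp) (by decide) (by decide) (by decide)
    (s := s₁) (by simp [hs₁, ht])
  have h5 := run_copy (O := O) (a := g) (b := x) (c := tmp) (by decide) (by decide) (by decide)
    (s := update s₁ x (.replicate k true)) (by simp [hs₁, ht])
  have h6 := run_toBin (O := O) (x := x) (y := y) (P := P) (B := B) (by decide) (by decide)
    (by decide) (by decide) (by decide) (by decide) (k + γ) (update s₁ x (.replicate (k + γ) true))
    (by simp) (by simp [hs₁, hy]) (by simp [hs₁, hP])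
  have hBR : ((k + γ).bits.reverse).length = R := by
    rw [List.length_reverse, hRdef, Nat.size_eq_bits_len]
  have h7 := run_each (O := O) (a := B) (P := fun _ => .push r true) (τ := 0)
    (w := (k + γ).bits.reverse) (fun d l => update (update s₁ B l) r (.replicate d.length true))
    (fun d l _ => by simp) (fun d z l _ => Run.push' (by
      rw [List.length_append, List.length_singleton, List.replicate_succ]
      funext q; simp only [update_apply]; grind))
  rw [hBR] at h7
  set s₂ := update s₁ r (.replicate R true) with hs₂
  have h8 := run_zeros (O := O) (a := m) (b := x) (c := tmp) (d := a) (by decide) (by decide)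
    (by decide) (by decide) (s := s₂) (by simp [hs₁, hs₂, hx]) (by simp [hs₁, hs₂, ht])
  set s₃ := update s₂ a (bitsLE k 0) with hs₃
  have h9 := run_copy (O := O) (a := g) (b := x) (c := tmp) (by decide) (by decide) (by decide)
    (s := s₃) (by simp [hs₁, hs₂, hs₃, ht])
  have hr3 : s₃ r = .replicate R true := by simp [hs₂, hs₃]
  have hh3 : s₃ h = [] := by simp [hs₁, hs₂, hs₃, hh]
  have ht3 : s₃ tmp = [] := by simp [hs₁, hs₂, hs₃, ht]
  have hx3 : s₃ x = [] := by simp [hs₁, hs₂, hs₃, hx]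
  have hc3 : s₃ c = [] := by simp [hs₁, hs₂, hs₃, hc]
  have hg3 : s₃ g = .replicate γ true := by simp [hs₁, hs₂, hs₃]
  have h10 := run_each (O := O) (a := x) (τ := 3 * R + 3) (w := .replicate γ true)
    (P := fun _ => .seq (zeros r h tmp c) <|
    .seq (.push c false) <| .seq (.push c false) <| .seq (.push c false) <| .seq (.push c false) <|
    .seq (.push c false) (.push c false))
    (fun d l => update (update s₃ x l) c (.replicate (d.length * (R + 6)) false))
    (fun d l _ => by simp) (fun d z l _ => by
      have h11 := run_zeros (O := O) (a := r) (b := h) (c := tmp) (d := c) (by decide) (by decide)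
        (by decide) (by decide) (s := update (update (update s₃ x (z :: l)) c
          (.replicate (d.length * (R + 6)) false)) x l) (by simp [hh3]) (by simp [ht3])
      refine (h11.seq ((Run.push _ _ _).seq ((Run.push _ _ _).seq ((Run.push _ _ _).seq
        ((Run.push _ _ _).seq ((Run.push _ _ _).seq (Run.push _ _ _))))))).of_eq ?_ (by simp [hr3])
      have e3 : (d ++ [z]).length * (R + 6) = R + d.length * (R + 6) + 1 + 1 + 1 + 1 + 1 + 1 := by
        rw [List.length_append, List.length_singleton]; ring
      rw [e3]
      funext q; simp only [update_apply]; simp [List.replicate_succ, hr3]; grind)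
  rw [List.length_replicate] at h10
  have h12 := run_zeros (O := O) (a := r) (b := h) (c := tmp) (d := c) (by decide) (by decide)
    (by decide) (by decide) (s := update s₃ c (.replicate (γ * (R + 6)) false)) (by simp [hh3])
    (by simp [ht3])
  refine (h1.seq ((h2.convert ?_ rfl le_rfl).seq ((h3.convert rfl ?_ le_rfl).seq
    (h4.seq ((h5.convert ?_ rfl le_rfl).seq ((h6.convert ?_ rfl le_rfl).seq
    ((h7.convert ?_ ?_ le_rfl).seq ((h8.convert rfl ?_ le_rfl).seq (h9.seq
    ((h10.convert ?_ rfl le_rfl).seq ((h12.convert ?_ rfl le_rfl).seq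
      (Run.push _ _ _)))))))))))).of_eq ?_ ?_
  · rw [hm, hx, List.append_nil]
  · rw [hs₁]
    funext q; simp only [update_apply]; grind
  · have : s₁ m = .replicate k true := by simp [hs₁, hm]
    have h' : s₁ x = [] := by simp [hs₁, hx]
    rw [this, h', List.append_nil]
  · have : s₁ g = .replicate γ true := by simp [hs₁]
    simp [this, List.replicate_append_replicate, Nat.add_comm]
  · have h' : s₁ x = [] := by simp [hs₁, hx]
    have h'' : s₁ B = [] := by simp [hs₁, hB]
    have h''' : s₁ r = [] := by simp [hs₁, hr]
    funext q; simp only [update_apply]; simp; grind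
  · have h'' : s₁ B = [] := by simp [hs₁, hB]
    rw [hs₂]
    funext q; simp only [update_apply]; grind
  · have h' : s₂ m = .replicate k true := by simp [hs₁, hs₂, hm]
    have h'' : s₂ a = [] := by simp [hs₁, hs₂, ha]
    rw [hs₃, h', h'', bitsLE_zero]
    simp
  · rw [hg3, hx3]
    funext q; simp only [update_apply]; simp; grind
  · funext q; simp only [update_apply]; grind
  · have e3 : codeLength γ R = R + γ * (R + 6) + 1 := by rw [codeLength]; ring
    rw [bitsLE_zero, e3]
    funext q; simp only [update_apply]; simp [List.replicate_succ, hs₁, hs₂, hs₃]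
    grind
  · have e3 : (Computability.encodeNat γ).reverse.length ≤ γ := by simpa using e2
    have f1 := Nat.mul_le_mul_right (3 * γ + 3) e3
    have e4 : (s m).length = k := by simp [hm]
    have e5 : (s₁ m).length = k := by simp [hs₁, hm]
    have e6 : (update s₁ x (.replicate k true) g).length = γ := by simp [hs₁]
    have e7 : (s₂ m).length = k := by simp [hs₁, hs₂, hm]
    have e8 : (s₃ g).length = γ := by simp [hg3]
    have e9 : (update s₃ c (.replicate (γ * (R + 6)) false) r).length = R := by simp [hr3]
    rw [e4, e5, e6, e7, e8, e9]
    have f2 : γ * γ ≤ b * b := Nat.mul_le_mul (by omega) (by omega)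
    have f3 : γ * R ≤ b * b := Nat.mul_le_mul (by omega) hR
    have f4 : b ≤ b * b := Nat.le_mul_of_pos_left _ hb1
    ring_nf at f1 f2 f3 f4 ⊢
    omega

end AlmostNatural

namespace AlmostNatural

open Function

/-! ### Correctness of the decision procedure -/

theorem exists_bitsLE (l : List Bool) : ∃ j < 2 ^ l.length, bitsLE l.length j = l := by
  induction l with
  | nil => exact ⟨0, by simp, rfl⟩
  | cons b l ih =>
    obtain ⟨j, hj, h⟩ := ih
    have hb := Bool.toNat_lt b
    refine ⟨2 * j + b.toNat, by rw [List.length_cons, pow_succ]; omega, ?_⟩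
    rw [List.length_cons, bitsLE_succ, Nat.testBit_zero]
    have : (2 * j + b.toNat) / 2 = j := by omega
    rw [this, h]
    cases b <;> simp

theorem reverse_bitsLE (N i : ℕ) : (bitsLE N i).reverse = List.ofFn (bitString N i) := by
  refine List.ext_getElem (by simp) fun j h1 h2 => ?_
  simp only [List.length_reverse, length_bitsLE] at h1
  rw [List.getElem_reverse, List.getElem_ofFn]
  simp only [bitsLE, List.getElem_map, List.getElem_range, bitString, Fin.val_rev,
    List.length_map, List.length_range]
  congr 1
  omega

theorem length_truthTable {k : ℕ} (f : BoolFun k) : (truthTable f).length = 2 ^ k := by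
  simp [truthTable]

theorem exists_truthTable {l : List Bool} {N : ℕ} (hl : l.length = 2 ^ N) :
    ∃ f : BoolFun N, l = truthTable f := by
  let e := Equiv.ofBijective _ (bitString_bijective N)
  refine ⟨fun x => l.getD (e.symm x) false, List.ext_getElem (by simp [truthTable, hl])
    fun i h1 h2 => ?_⟩
  simp only [truthTable, List.getElem_ofFn]
  have : e.symm (bitString N i) = ⟨i, hl ▸ h1⟩ := e.symm_apply_apply ⟨i, hl ▸ h1⟩
  rw [this, List.getD_eq_getElem _ _ h1]

theorem getD_truthTable {N : ℕ} (f : BoolFun N) {i : ℕ} (hi : i < 2 ^ N) :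
    (truthTable f).getD i false = f (bitString N i) := by
  rw [List.getD_eq_getElem _ _ (by simpa [truthTable] using hi)]
  simp [truthTable]

theorem count_truthTable {N : ℕ} (f : BoolFun N) :
    (truthTable f).count true = {x | f x = true}.ncard := by
  classical
  let e := Equiv.ofBijective _ (bitString_bijective N)
  have h1 : {x | f x = true} = e '' {i | f (e i) = true} := by
    ext x
    simp only [Set.mem_ofPred_eq, Set.mem_image]
    exact ⟨fun h => ⟨e.symm x, by simpa using h, by simp⟩, by rintro ⟨i, h, rfl⟩; exact h⟩
  have h2 : {i | f (e i) = true} = ((Finset.univ.filter fun i => f (e i) = true : Finset _) : Set _) := by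
    simp
  rw [h1, Set.ncard_image_of_injective _ e.injective, h2, Set.ncard_coe_finset,
    truthTable, List.ofFn_eq_map, List.count, List.countP_map, List.countP_eq_length_filter]
  rw [← List.toFinset_card_of_nodup ((List.nodup_finRange _).filter _)]
  congr 1
  ext i
  simp [e]

theorem Circuit.eq_zero_of_inputs {g : ℕ} (C : Circuit 0 g) : g = 0 := by
  induction C with
  | nil => rfl
  | gate C op i j ih =>
    subst ih
    exact i.elim0

/-- A gate needs an operand, so a circuit without inputs has no node to serve as output. For `k = 0`
nothing is forbidden, and that case is excluded from the enumeration of codes. -/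
theorem not_computableWithGates_zero {g : ℕ} (h : BoolFun 0) : ¬ ComputableWithGates g h := by
  rintro ⟨g', -, C, out, -⟩
  obtain rfl := C.eq_zero_of_inputs
  exact out.elim0

/-- The queries for all functions of `k` variables with circuits of size at most `γ`. -/
def allQueries (k γ : ℕ) : List Item :=
  if k = 0 then [] else queries k γ (Nat.size (k + γ)) (codeLength γ (Nat.size (k + γ)))

/-- Soundness of the enumeration is `computableWithGates_codedFun`, completeness is
`exists_codedFun`. -/
theorem mem_allQueries {k γ : ℕ} {x : Item} :
    x ∈ allQueries k γ ↔ ∃ h : BoolFun k, ComputableWithGates γ h ∧ x = query h := by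
  rw [allQueries]
  split_ifs with hk
  · subst hk
    simp [not_computableWithGates_zero]
  · rw [queries, List.mem_reverse, List.mem_map]
    constructor
    · rintro ⟨i, -, rfl⟩
      exact ⟨_, computableWithGates_codedFun (by omega) _ _ _, rfl⟩
    · rintro ⟨h, hh, rfl⟩
      obtain ⟨y, hy, rfl⟩ := exists_codedFun (Nat.lt_size_self (k + γ)).le hh
      obtain ⟨j, hj, hj'⟩ := exists_bitsLE y
      rw [hy] at hj hj'
      exact ⟨j, List.mem_range.2 hj, by rw [hj']⟩

theorem mem_records {N : ℕ} {l : List Bool} {x : Item} :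
    x ∈ records N l ↔ ∃ i < 2 ^ N, x = (List.ofFn (bitString N i), false, l.getD i false) := by
  rw [records, List.mem_reverse, List.mem_map]
  simp only [List.mem_range, reverse_bitsLE]
  exact ⟨fun ⟨i, hi, h⟩ => ⟨i, hi, h.symm⟩, fun ⟨i, hi, h⟩ => ⟨i, hi, h.symm⟩⟩

theorem length_allQueries_le (k γ : ℕ) :
    (allQueries k γ).length ≤ 2 ^ codeLength γ (Nat.size (k + γ)) := by
  rw [allQueries]
  split_ifs
  · simp
  · simp [queries]

theorem length_records (N : ℕ) (l : List Bool) : (records N l).length = 2 ^ N := by simp [records]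

theorem length_key {N k γ : ℕ} (hN : N = 2 ^ k) (l : List Bool) :
    ∀ x ∈ records N l ++ allQueries k γ, x.1.length = N := by
  intro x hx
  rcases List.mem_append.1 hx with hx | hx
  · obtain ⟨i, -, rfl⟩ := mem_records.1 hx
    simp
  · obtain ⟨h, -, rfl⟩ := mem_allQueries.1 hx
    rw [query, length_truthTable, hN]

theorem scan_items {N k γ : ℕ} (hN : N = 2 ^ k) (f : BoolFun N) :
    scan false (radixSort N (records N (truthTable f) ++ allQueries k γ)) = false ↔
      ∀ (x : Fin N → Bool) (h : BoolFun k), ComputableWithGates γ h →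
        List.ofFn x = truthTable h → f x = false := by
  -- A truth table of a function of `k` variables has `2 ^ k = N` bits and is thus itself a position
  -- in the input, so every query meets a record.
  have hkey : ∀ h : BoolFun k, ∃ i < 2 ^ N, List.ofFn (bitString N i) = truthTable h := fun h => by
    have hlen : (truthTable h).length = N := by rw [length_truthTable, hN]
    obtain ⟨i, hi⟩ := (bitString_bijective N).2 fun j => (truthTable h)[j]'(by omega)
    refine ⟨i, i.isLt, ?_⟩
    change bitString N i = _ at hi
    rw [hi]
    exact List.ext_getElem (by simp [hlen]) fun j h1 h2 => by simp
  rw [← Bool.not_eq_true, scan_radixSort]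
  · constructor
    · intro hs x h hh hx
      by_contra hf
      obtain ⟨i, hi⟩ := (bitString_bijective N).2 x
      change bitString N i = x at hi
      refine hs ⟨query h, mem_allQueries.2 ⟨h, hh, rfl⟩, _, mem_records.2 ⟨i, i.isLt, rfl⟩, ?_, ?_⟩
      · rw [hi, hx]; rfl
      · rw [getD_truthTable f i.isLt, hi]
        simpa using hf
    · rintro hf ⟨q, hq, y, hy, h1, h2⟩
      obtain ⟨h, hh, rfl⟩ := mem_allQueries.1 hq
      obtain ⟨i, hi, rfl⟩ := mem_records.1 hy
      rw [getD_truthTable f hi] at h2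
      exact Bool.false_ne_true ((hf (bitString N i) h hh h1).symm.trans h2)
  · intro x hx
    obtain ⟨i, -, rfl⟩ := mem_records.1 hx
    rfl
  · intro x hx
    obtain ⟨h, -, rfl⟩ := mem_allQueries.1 hx
    rfl
  · exact length_key hN _
  · rw [records, List.pairwise_reverse, List.pairwise_map]
    refine List.nodup_range.imp_of_mem fun {i j} hi hj hij h => hij ?_
    rw [reverse_bitsLE, reverse_bitsLE, List.ofFn_inj] at h
    have := (bitString_bijective N).1 (a₁ := ⟨j, List.mem_range.1 hj⟩)
      (a₂ := ⟨i, List.mem_range.1 hi⟩) h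
    exact (congrArg Fin.val this).symm
  · intro x hx
    obtain ⟨h, -, rfl⟩ := mem_allQueries.1 hx
    obtain ⟨i, hi, h1⟩ := hkey h
    exact ⟨_, mem_records.2 ⟨i, hi, rfl⟩, h1⟩

theorem mem_language_of_not_pow {γ : ℕ → ℕ} {l : List Bool} {N : ℕ} (hl : l.length = 2 ^ N)
    (hN : ∀ k, N ≠ 2 ^ k) : l ∈ (discrimination γ).language := by
  obtain ⟨f, rfl⟩ := exists_truthTable hl
  exact ⟨N, f, .inl fun ⟨k, hk⟩ => hN k hk, rfl⟩

theorem length_of_mem_language {γ : ℕ → ℕ} {l : List Bool}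
    (h : l ∈ (discrimination γ).language) : ∃ N, l.length = 2 ^ N := by
  obtain ⟨N, f, -, rfl⟩ := h
  exact ⟨N, length_truthTable f⟩

theorem mem_language_iff {γ : ℕ → ℕ} {l : List Bool} {N k : ℕ} (hl : l.length = 2 ^ N)
    (hN : N = 2 ^ k) : l ∈ (discrimination γ).language ↔ 2 ^ N ≤ N * l.count true ∧
      scan false (radixSort N (records N l ++ allQueries k (γ k))) = false := by
  obtain ⟨f, rfl⟩ := exists_truthTable hl
  have hpos : (0 : ℝ) < N := by rw [hN]; positivity
  have h1 : truthTable f ∈ (discrimination γ).language ↔ IsDiscriminating γ f := by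
    constructor
    · rintro ⟨N', f', hf', h⟩
      have : N' = N := by
        have := congrArg List.length h
        rw [length_truthTable, length_truthTable] at this
        exact (Nat.pow_right_injective le_rfl this).symm
      subst this
      rw [truthTable_injective h]
      exact hf'
    · exact fun h => ⟨N, f, h, rfl⟩
  have h2 : (2 : ℝ) ^ N / N ≤ ({x | f x = true}.ncard : ℝ) ↔
      2 ^ N ≤ N * (truthTable f).count true := by
    rw [div_le_iff₀ hpos, count_truthTable, mul_comm]
    exact_mod_cast Iff.rfl
  rw [h1, scan_items hN, ← h2, IsDiscriminating]
  constructor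
  · rintro (h | ⟨k', hk', h⟩)
    · exact absurd ⟨k, hN⟩ h
    · obtain rfl : k = k' := Nat.pow_right_injective le_rfl (hN.symm.trans hk')
      exact h
  · exact fun h => .inr ⟨k, hN, h⟩

end AlmostNatural

namespace AlmostNatural

open Function Cmd Reg

variable {O : List Bool → List Bool → ℕ → Prop}

/-! ### The decision procedure -/

/-- Push the queries for all functions of `m` variables with small circuits to `A`. -/
def queryPhase : Cmd Reg :=
  .pop m (fun b => .seq (.push m b) (.seq paramPhase queryLoop)) .skip

/-- Decide whether `w` is the truth table of a discriminating function of `n = 2 ^ m` variables: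
in this case, `F` remains empty. -/
def mainPhase : Cmd Reg :=
  .seq countPhase <| .seq queryPhase <| .seq (zeros n x tmp p) <|
  .seq recordLoop <| .seq sortLoop scanLoop

/-- The length of codes for functions of `k` variables with circuits of size at most `γ`. -/
abbrev codeBits (k γ : ℕ) : ℕ := codeLength γ (Nat.size (k + γ))

theorem run_queryPhase {s : Store Reg} {k γ t b E : ℕ} (hm : s m = .replicate k true)
    (hs : ∀ q, q ≠ w → q ≠ n → q ≠ m → q ≠ U → q ≠ F → s q = [])
    (hb : 1 ≤ b) (hkb : 2 ^ k ≤ b) (hO : 1 ≤ k →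
      O (.replicate k true) (Computability.encodeNat γ) t ∧ k + γ ≤ b ∧
      2 ^ Nat.size (k + γ) ≤ b ∧ codeBits k γ ≤ b ∧ 2 ^ codeBits k γ ≤ E) :
    ∃ s', Run O queryPhase s (t + (60 * (b * b) + E * (60 * (b * b * (b * b))) + 1)) s' ∧
      s' A = encItems (allQueries k γ) ∧
      ∀ q, q ≠ g → q ≠ r → q ≠ a → q ≠ c → q ≠ A → s' q = s q := by
  rcases Nat.eq_zero_or_pos k with rfl | hk
  · refine ⟨s, (Run.pop_none (by simp [hm]) (.skip _)).mono (by omega), ?_, fun q _ _ _ _ _ => rfl⟩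
    rw [hs A (by decide) (by decide) (by decide) (by decide) (by decide)]
    simp [allQueries, encItems]
  · obtain ⟨hO', h1, h2, h3, h4⟩ := hO hk
    have e (q : Reg) (hq : q ∉ [w, n, m, U, F]) : s q = [] := by
      simp only [List.mem_cons, not_or] at hq
      exact hs q hq.1 hq.2.1 hq.2.2.1 hq.2.2.2.1 hq.2.2.2.2.1
    set R := Nat.size (k + γ) with hR
    set L := codeBits k γ with hL
    have hRb : R ≤ b := (Nat.lt_two_pow_self).le.trans h2
    have r1 := run_paramPhase (O := O) hm hO' (e x (by decide)) (e y (by decide)) (e g (by decide))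
      (e P (by decide)) (e B (by decide)) (e J (by decide)) (e h (by decide)) (e tmp (by decide))
      (e r (by decide)) (e a (by decide)) (e c (by decide)) h1 hb hRb
    rw [← hR] at r1
    set s₁ := update (update (update (update s g (.replicate γ true)) r (.replicate R true))
      a (bitsLE k 0)) c (bitsLE L 0) with hs₁
    have hready : Ready s₁ k γ R := by
      constructor
      · simp [hs₁]
      · simp [hs₁]
      · simp [hs₁]
      all_goals
        rw [hs₁, update_of_ne (by decide), update_of_ne (by decide), update_of_ne (by decide),
          update_of_ne (by decide)]
        exact e _ (by decide)
    have r2 := run_queryLoop (O := O) (L := L) hready hk h2 h1 h3 (by simp [hs₁])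
    obtain ⟨k', rfl⟩ : ∃ k', k = k' + 1 := ⟨k - 1, by omega⟩
    refine ⟨_, (Run.pop_some (b := true) (l := .replicate k' true) (by simp [hm,
      List.replicate_succ]) ((Run.push _ _ _).seq ((r1.convert ?_ rfl le_rfl).seq r2))).mono ?_,
      ?_, ?_⟩
    · have : true :: List.replicate k' true = s m := by rw [hm, List.replicate_succ]
      rw [update_self, update_idem, this, update_eq_self]
    · have hkk : k' + 1 ≤ b := (Nat.lt_two_pow_self).le.trans hkb
      have f1 : 2 ^ (k' + 1) * (40 * (b * b * b) + 2 * (k' + 1) + 3) + 1 + 2 * L + 3 ≤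
          b * (40 * (b * b * b) + 2 * b + 3) + 1 + 2 * b + 3 := by gcongr
      have f2 : b ≤ b * b := Nat.le_mul_of_pos_left _ hb
      have f3 : b * b ≤ b * b * (b * b) := Nat.le_mul_of_pos_left _ (by positivity)
      have f4 : b * (40 * (b * b * b) + 2 * b + 3) + 1 + 2 * b + 3 ≤ 60 * (b * b * (b * b)) := by
        have : b * (40 * (b * b * b) + 2 * b + 3) = 40 * (b * b * (b * b)) + 2 * (b * b) + 3 * b := by
          ring
        omega
      have f5 := Nat.mul_le_mul h4 (f1.trans f4)
      omega
    · have : s₁ A = [] := by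
        rw [hs₁, update_of_ne (by decide), update_of_ne (by decide), update_of_ne (by decide),
          update_of_ne (by decide)]
        exact e _ (by decide)
      rw [update_self, this, List.append_nil, allQueries, if_neg (by omega)]
    · intro q q1 q2 q3 q4 q5
      simp [*]

theorem run_mainPhase {s : Store Reg} {N k γ t b Q : ℕ} (hN : N = 2 ^ k)
    (hw : (s w).length = 2 ^ N) (hn : s n = .replicate N true) (hm : s m = .replicate k true)
    (hs : ∀ q, q ≠ w → q ≠ n → q ≠ m → s q = [])
    (hkb : N ≤ b) (hO : 1 ≤ k →
      O (.replicate k true) (Computability.encodeNat γ) t ∧ k + γ ≤ b ∧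
      2 ^ Nat.size (k + γ) ≤ b ∧ codeBits k γ ≤ b ∧ 2 ^ codeBits k γ ≤ Q * 2 ^ N) :
    ∃ s', Run O mainPhase s (t + 300 * ((Q + 1) * 2 ^ N * (b * b * (b * b)))) s' ∧
      (s' F = [] ↔ 2 ^ N ≤ N * (s w).count true ∧
        scan false (radixSort N (records N (s w) ++ allQueries k γ)) = false) := by
  have hN1 : 1 ≤ N := hN ▸ Nat.one_le_two_pow
  have hb : 1 ≤ b := hN1.trans hkb
  have e (q : Reg) (hq : q ∉ [w, n, m]) : s q = [] := by
    simp only [List.mem_cons, not_or] at hq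
    exact hs q hq.1 hq.2.1 hq.2.2.1
  have r1 := run_countPhase (O := O) hn (e tmp (by decide)) (e w2 (by decide)) (e U (by decide))
  rw [hw, e F (by decide), List.append_nil] at r1
  set C := N * (s w).count true with hC
  set s₁ := update (update s U (.replicate (C - 2 ^ N) true)) F (.replicate (2 ^ N - C) true)
    with hs₁
  have e1 (q : Reg) (hU : q ≠ U) (hF : q ≠ F) : s₁ q = s q := by simp [hs₁, hU, hF]
  obtain ⟨s₂, r2, hA2, h2⟩ := run_queryPhase (O := O) (s := s₁) (k := k) (γ := γ) (t := t)
    (E := Q * 2 ^ N) (by rw [e1 m (by decide) (by decide), hm]) (fun q q1 q2 q3 q4 q5 => by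
      rw [e1 q q4 q5, hs q q1 q2 q3]) hb (hN ▸ hkb) hO
  have e2 (q : Reg) (hq : q ∉ [g, r, a, c, A, U, F]) : s₂ q = s q := by
    simp only [List.mem_cons, not_or] at hq
    rw [h2 q hq.1 hq.2.1 hq.2.2.1 hq.2.2.2.1 hq.2.2.2.2.1, e1 q hq.2.2.2.2.2.1 hq.2.2.2.2.2.2.1]
  have e3 (q : Reg) (hq : q ∉ [g, r, a, c, A, U, F]) (hq' : q ∉ [w, n, m]) : s₂ q = [] := by
    rw [e2 q hq, e q hq']
  have r3 := run_zeros (O := O) (a := n) (b := x) (c := tmp) (d := p) (by decide) (by decide)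
    (by decide) (by decide) (s := s₂) (e3 x (by decide) (by decide))
    (e3 tmp (by decide) (by decide))
  have hn2 : (s₂ n).length = N := by rw [e2 n (by decide), hn, List.length_replicate]
  rw [e3 p (by decide) (by decide), List.append_nil, hn2, ← bitsLE_zero] at r3
  have hw3 : update s₂ p (bitsLE N 0) w = s w := by
    rw [update_of_ne (by decide), e2 w (by decide)]
  have r4 := run_recordLoop (O := O) (s := update s₂ p (bitsLE N 0)) (k := N) (by rw [hw3, hw])
    (by rw [update_of_ne (by decide), e3 tmp (by decide) (by decide)])
    (by rw [update_of_ne (by decide), e3 Z (by decide) (by decide)]) (update_self ..)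
  rw [hw3, update_of_ne (by decide), hA2, ← encItems_append] at r4
  set l := records N (s w) ++ allQueries k γ with hl
  set s₄ := update (update (update s₂ p (bitsLE N 0)) w []) A (encItems l) with hs₄
  have e4 (q : Reg) (hq : q ∉ [p, w, A]) : s₄ q = s₂ q := by
    simp only [List.mem_cons, not_or] at hq
    rw [hs₄, update_of_ne hq.2.2.1, update_of_ne hq.2.1, update_of_ne hq.1]
  have hlen := length_key (γ := γ) hN (s w)
  rw [← hl] at hlen
  have r5 := run_sortLoop (O := O) (s := s₄) (by rw [e4 n (by decide), e2 n (by decide), hn]) hlen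
    (by rw [e4 B0 (by decide), e3 B0 (by decide) (by decide)])
    (by rw [e4 B1 (by decide), e3 B1 (by decide) (by decide)]) (update_self ..)
  obtain ⟨s₆, r6, h6⟩ := run_scanLoop (O := O) (radixSort N l) false
    (s := update (update s₄ n []) A (encItems (radixSort N l))) (update_self ..)
    (by rw [update_of_ne (by decide), update_of_ne (by decide), e4 D (by decide),
      e3 D (by decide) (by decide)]; rfl)
  refine ⟨s₆, (r1.seq (r2.seq (r3.seq (r4.seq (r5.seq r6))))).mono ?_, ?_⟩
  · have hlenr : (encItems (radixSort N l)).length = l.length * (2 * N + 3) := by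
      rw [length_encItems fun x hx => hlen x (mem_radixSort.1 hx), length_radixSort]
    have hll : l.length ≤ (Q + 1) * 2 ^ N := by
      rw [hl, List.length_append, length_records, add_mul, one_mul]
      rcases Nat.eq_zero_or_pos k with rfl | hk
      · simp [allQueries]
      · have := (length_allQueries_le k γ).trans (hO hk).2.2.2.2
        omega
    rw [hlenr]
    have hE : 1 ≤ 2 ^ N := Nat.one_le_two_pow
    -- All costs are compared with `X * b ^ 4`, where `X = (Q + 1) * 2 ^ N` bounds the number of
    -- items and `b` bounds `N`. Once the monomials are named, the claim is linear.
    generalize 2 ^ N = E at hE hll ⊢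
    have f0 : E ≤ (Q + 1) * E := Nat.le_mul_of_pos_left _ (by omega)
    have f1 : Q * E ≤ (Q + 1) * E := Nat.mul_le_mul_right _ (by omega)
    generalize Q * E = X' at f1 ⊢
    generalize (Q + 1) * E = X at f0 f1 hll ⊢
    have f2 : b ≤ b * b := Nat.le_mul_of_pos_left _ hb
    have f3 : b * b ≤ b * b * (b * b) := Nat.le_mul_of_pos_left _ (by positivity)
    have f4 : b * b * (b * b) ≤ X * (b * b * (b * b)) := Nat.le_mul_of_pos_left _ (by omega)
    have f5 : X * b ≤ X * (b * b * (b * b)) := Nat.mul_le_mul_left _ (by omega)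
    have f6 : X * (b * b) ≤ X * (b * b * (b * b)) := Nat.mul_le_mul_left _ f3
    have g1 : E * (2 * N + 4) ≤ X * (6 * b) := Nat.mul_le_mul f0 (by omega)
    have g2 : X' * (60 * (b * b * (b * b))) ≤ X * (60 * (b * b * (b * b))) :=
      Nat.mul_le_mul_right _ f1
    have g3 : E * (4 * N + 5) ≤ X * (9 * b) := Nat.mul_le_mul f0 (by omega)
    have g4 : l.length * (3 * N + 4) ≤ X * (7 * b) := Nat.mul_le_mul hll (by omega)
    have g5 : N * (l.length * (3 * N + 4) + 4) ≤ b * (X * (7 * b) + 4) :=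
      Nat.mul_le_mul hkb (by omega)
    have g6 : l.length * (2 * N + 3) ≤ X * (5 * b) := Nat.mul_le_mul hll (by omega)
    have i1 : X * (6 * b) = 6 * (X * b) := by ring
    have i2 : X * (60 * (b * b * (b * b))) = 60 * (X * (b * b * (b * b))) := by ring
    have i3 : X * (9 * b) = 9 * (X * b) := by ring
    have i4 : b * (X * (7 * b) + 4) = 7 * (X * (b * b)) + 4 * b := by ring
    have i5 : X * (5 * b) = 5 * (X * b) := by ring
    omega
  · rw [h6, update_of_ne (by decide), update_of_ne (by decide), e4 F (by decide),
      h2 F (by decide) (by decide) (by decide) (by decide) (by decide), hs₁, update_self,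
      List.replicate_eq_nil_iff, Nat.sub_eq_zero_iff_le]

end AlmostNatural

/-! ### The complete machine and its running time -/

namespace AlmostNatural

open Function Cmd Reg

/-- Write the binary digits of the length of `q` to `B`. -/
def binLength (q : Reg) : Cmd Reg := .seq (copy q x tmp) (toBin x y P B)

theorem run_binLength {O : List Bool → List Bool → ℕ → Prop} {q : Reg} (hx : q ≠ x) (ht : q ≠ tmp)
    {s : Store Reg} (sx : s x = []) (sy : s y = []) (st : s tmp = []) (sP : s P = [])
    (sB : s B = []) :
    Run O (binLength q) s (10 * (s q).length + 3) (update s B (s q).length.bits.reverse) := by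
  have r1 := run_copy (O := O) hx ht (by decide) st
  rw [sx, List.append_nil] at r1
  have r2 := run_toBin (O := O) (x := x) (y := y) (P := P) (B := B) (by decide) (by decide)
    (by decide) (by decide) (by decide) (by decide) (s q).length (update s x (s q))
    (by simp) (by simp [sy]) (by simp [sP])
  refine (r1.seq r2).of_eq ?_ (by omega)
  funext q'; simp only [update_apply]; simp; grind

/-- Compute `n` and `m` from the length of the input `w`, and test whether `w` is the truth table
of a discriminating function: in this case, `F` remains empty. -/
def testPhase : Cmd Reg :=
  .seq (binLength w) <| .seq (isPow B n F) <|
  .pop F (fun _ => .push F true) <|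
  .seq (binLength n) <| .seq (isPow B m H) <|
  .pop H (fun _ => .skip) mainPhase

/-- Clear all stacks, and write to `w` whether `F` is empty. -/
noncomputable def finish : Cmd Reg :=
  .pop F (fun _ => .seq (forAll clear (Finset.univ (α := Reg)).toList) (.push w false))
    (.seq (forAll clear (Finset.univ (α := Reg)).toList) (.push w true))

/-- The output convention demands that all other stacks be empty. Clearing costs their total length,
which `Run.sum_length_le` bounds by the preceding running time. -/
theorem run_finish {O : List Bool → List Bool → ℕ → Prop} (s : Store Reg) :
    Run O finish s ((∑ q, (s q).length) + Fintype.card Reg) (single w [decide (s F = [])]) := by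
  match hF : s F with
  | [] =>
    refine .pop_none hF (Run.of_eq ((run_clearAll s).seq (.push _ _ _)) ?_ (Nat.add_zero _).le)
    simp [single]
  | b :: l =>
    have h1 := sum_update s F l
    rw [hF, List.length_cons] at h1
    refine .pop_some hF (Run.of_eq ((run_clearAll _).seq (.push _ _ _)) ?_ (by omega))
    simp [single]

theorem two_pow_size_le {a : ℕ} (ha : 1 ≤ a) : 2 ^ Nat.size a ≤ 2 * a := by
  have h1 : 0 < Nat.size a := Nat.size_pos.2 ha
  have h2 : 2 ^ (Nat.size a - 1) ≤ a := Nat.lt_size.1 (by omega)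
  have h3 : Nat.size a = (Nat.size a - 1) + 1 := by omega
  rw [h3, pow_succ]
  omega

theorem mul_le_two_pow {γ : ℕ → ℕ} (hle : ∀ m : ℕ, 1 ≤ m → (γ m : ℝ) ≤ (2 : ℝ) ^ m / m) {k : ℕ}
    (hk : 1 ≤ k) : γ k * k ≤ 2 ^ k := by
  have h := hle k hk
  rw [le_div_iff₀ (by exact_mod_cast hk)] at h
  exact_mod_cast h

/-- Bounds on the parameters of the enumeration of codes. -/
theorem exists_bounds {γ : ℕ → ℕ} (hle : ∀ m : ℕ, 1 ≤ m → (γ m : ℝ) ≤ (2 : ℝ) ^ m / m) :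
    ∃ C, 1 ≤ C ∧ ∀ k, 1 ≤ k → k + γ k ≤ C * 2 ^ k ∧ 2 ^ Nat.size (k + γ k) ≤ C * 2 ^ k ∧
      codeBits k (γ k) ≤ C * 2 ^ k ∧ 2 ^ codeBits k (γ k) ≤ C * 2 ^ 2 ^ k := by
  -- For `k < 256` the code length may exceed `2 ^ k`. The sum over these finitely many exceptions
  -- serves as a common bound.
  set S := ∑ k ∈ Finset.range 256, 2 ^ codeBits k (γ k) with hS
  refine ⟨S + 4, by omega, fun k hk => ?_⟩
  have h1 := mul_le_two_pow hle hk
  have h2 : γ k ≤ 2 ^ k := (Nat.le_mul_of_pos_right _ hk).trans h1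
  have h3 : k ≤ 2 ^ k := Nat.lt_two_pow_self.le
  have h4 : 4 * 2 ^ k ≤ (S + 4) * 2 ^ k := Nat.mul_le_mul_right _ (by omega)
  have h5 := two_pow_size_le (a := k + γ k) (by omega)
  refine ⟨by omega, by omega, ?_⟩
  rcases lt_or_ge k 256 with hk | hk
  · have h6 : 2 ^ codeBits k (γ k) ≤ S :=
      Finset.single_le_sum (f := fun k => 2 ^ codeBits k (γ k)) (fun _ _ => Nat.zero_le _)
        (Finset.mem_range.2 hk)
    have h7 : codeBits k (γ k) < 2 ^ codeBits k (γ k) := Nat.lt_two_pow_self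
    have h8 : S + 4 ≤ (S + 4) * 2 ^ k := Nat.le_mul_of_pos_right _ (by positivity)
    have h9 : S + 4 ≤ (S + 4) * 2 ^ 2 ^ k := Nat.le_mul_of_pos_right _ (by positivity)
    omega
  · have h6 : codeBits k (γ k) < 2 ^ k := codeLength_lt hk h1
    have h7 : 2 ^ codeBits k (γ k) ≤ 2 ^ 2 ^ k := Nat.pow_le_pow_right (by norm_num) h6.le
    have h8 : 2 ^ 2 ^ k ≤ (S + 4) * 2 ^ 2 ^ k := Nat.le_mul_of_pos_left _ (by omega)
    omega

theorem le_mul_log_pow (M : ℕ) : M ≤ M * Nat.log 2 M ^ 4 + 1 := by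
  rcases lt_or_ge M 2 with h | h
  · omega
  · have : 1 ≤ Nat.log 2 M ^ 4 := Nat.one_le_pow _ _ (Nat.log_pos (by norm_num) h)
    have := Nat.mul_le_mul_left M this
    omega

theorem length_bits_le (a : ℕ) : a.bits.length ≤ a := by
  rw [Nat.size_eq_bits_len]
  exact Nat.size_le.2 Nat.lt_two_pow_self

theorem exists_run_testPhase {γ : ℕ → ℕ} (hle : ∀ m : ℕ, 1 ≤ m → (γ m : ℝ) ≤ (2 : ℝ) ^ m / m)
    {O : List Bool → List Bool → ℕ → Prop} {τ : ℕ → ℕ} {K : ℕ}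
    (hO : ∀ k, O (.replicate k true) (Computability.encodeNat (γ k)) (τ k))
    (hτ : ∀ k, τ k ≤ K * (k + γ k) + K) :
    ∃ K', ∀ l, ∃ s', Run O testPhase (single w l)
      (K' * (l.length * Nat.log 2 l.length ^ 4) + K') s' ∧
      (s' F = [] ↔ l ∈ (discrimination γ).language) := by
  obtain ⟨C, hC, hbd⟩ := exists_bounds hle
  refine ⟨22 + 2 * K * C + 300 * (C + 1) * C ^ 4 + 50, fun l => ?_⟩
  set M := l.length with hM
  have hlog := le_mul_log_pow M
  have hw0 : single w l w = l := by simp [single]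
  have h0 (q : Reg) (hq : q ≠ w) : single w l q = [] := by simp [single, hq]
  have r1 := run_binLength (O := O) (q := w) (s := single w l) (by decide) (by decide)
    (h0 x (by decide)) (h0 y (by decide)) (h0 tmp (by decide)) (h0 P (by decide))
    (h0 B (by decide))
  rw [hw0, ← hM] at r1
  set s₁ := update (single w l) B M.bits.reverse with hs₁
  set T := M * Nat.log 2 M ^ 4 with hT
  suffices ∃ s' t, Run O testPhase (single w l) t s' ∧
      t ≤ 22 * M + (2 * K * C + 300 * (C + 1) * C ^ 4) * T + 10 ∧
      (s' F = [] ↔ l ∈ (discrimination γ).language) by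
    obtain ⟨s', t, h1, h2, h3⟩ := this
    exact ⟨s', h1.mono (by simp only [add_mul] at h2 ⊢; omega), h3⟩
  by_cases hN : ∃ N, M = 2 ^ N
  swap
  · rw [not_exists] at hN
    obtain ⟨s₂, hF, -, r2⟩ := run_isPow_of_ne (O := O) (B := B) (d := n) (f := F) (by decide)
      (by decide) (by decide) (a := M) (s := s₁) (by rw [hs₁, update_self]) hN
    obtain ⟨b, L, hbL⟩ := List.exists_cons_of_ne_nil hF
    refine ⟨_, _, r1.seq (r2.seq (.pop_some hbL (.push _ _ _))), ?_, ?_⟩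
    · have := length_bits_le M
      omega
    · rw [update_self]
      exact iff_of_false (by simp) fun h => by
        obtain ⟨N, h⟩ := length_of_mem_language h
        exact hN N h
  obtain ⟨N, hN⟩ := hN
  have r2 := run_isPow (O := O) (B := B) (d := n) (f := F) (by decide) (k := N) (s := s₁)
    (by rw [hs₁, update_self, hN]) (by rw [hs₁, update_of_ne (by decide), h0 n (by decide)])
  set s₂ := update (single w l) n (.replicate N true) with hs₂
  have e12 : update (update s₁ B []) n (.replicate N true) = s₂ := by
    rw [hs₁, update_idem, ← h0 B (by decide), update_eq_self]
  rw [e12] at r2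
  have h2 (q : Reg) (hq : q ≠ n) : s₂ q = single w l q := by rw [hs₂, update_of_ne hq]
  have h20 (q : Reg) (hq : q ≠ n) (hq' : q ≠ w) : s₂ q = [] := by rw [h2 q hq, h0 q hq']
  have hn2 : s₂ n = .replicate N true := update_self ..
  have r3 := run_binLength (O := O) (q := n) (s := s₂) (by decide) (by decide)
    (h20 x (by decide) (by decide)) (h20 y (by decide) (by decide))
    (h20 tmp (by decide) (by decide)) (h20 P (by decide) (by decide))
    (h20 B (by decide) (by decide))
  rw [hn2, List.length_replicate] at r3
  set s₃ := update s₂ B N.bits.reverse with hs₃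
  have hNM : N < M := hN ▸ Nat.lt_two_pow_self
  by_cases hk : ∃ k, N = 2 ^ k
  swap
  · rw [not_exists] at hk
    obtain ⟨s₄, hH, h4, r4⟩ := run_isPow_of_ne (O := O) (B := B) (d := m) (f := H) (by decide)
      (by decide) (by decide) (a := N) (s := s₃) (by rw [hs₃, update_self]) hk
    obtain ⟨b, L, hbL⟩ := List.exists_cons_of_ne_nil hH
    refine ⟨_, _, r1.seq (r2.seq (.pop_none (h20 F (by decide) (by decide))
      (r3.seq (r4.seq (.pop_some hbL (.skip _)))))), ?_, ?_⟩
    · have := length_bits_le N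
      omega
    · rw [update_of_ne (by decide), h4 F (by decide) (by decide) (by decide), hs₃,
        update_of_ne (by decide), h20 F (by decide) (by decide)]
      exact iff_of_true rfl (mem_language_of_not_pow hN hk)
  obtain ⟨k, hk⟩ := hk
  have r4 := run_isPow (O := O) (B := B) (d := m) (f := H) (by decide) (k := k) (s := s₃)
    (by rw [hs₃, update_self, hk])
    (by rw [hs₃, update_of_ne (by decide), h20 m (by decide) (by decide)])
  set s₄ := update s₂ m (.replicate k true) with hs₄
  have e34 : update (update s₃ B []) m (.replicate k true) = s₄ := by
    rw [hs₃, update_idem, ← h20 B (by decide) (by decide), update_eq_self]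
  rw [e34] at r4
  have h4 (q : Reg) (hq : q ≠ m) : s₄ q = s₂ q := by rw [hs₄, update_of_ne hq]
  have hw4 : s₄ w = l := by rw [h4 w (by decide), h2 w (by decide), hw0]
  have hN1 : 1 ≤ N := hk ▸ Nat.one_le_two_pow
  have hNC : N ≤ C * N := Nat.le_mul_of_pos_left _ hC
  have hlogN : Nat.log 2 M = N := by rw [hN, Nat.log_pow (by norm_num)]
  have hNT : N ≤ T := by
    rw [hT, hlogN]
    exact hNM.le.trans (Nat.le_mul_of_pos_right _ (by positivity))
  -- For `k = 0` the machine for `γ` is not called, and its time must not be charged, since the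
  -- bound on `γ` starts at 1.
  obtain ⟨s₅, r5, h5⟩ := run_mainPhase (O := O) (s := s₄) (N := N) (k := k) (γ := γ k)
    (t := if 1 ≤ k then τ k else 0) (b := C * N) (Q := C) hk (by rw [hw4, ← hM, hN])
    (by rw [h4 n (by decide), hn2]) (by rw [hs₄, update_self])
    (fun q q1 q2 q3 => by rw [h4 q q3, h20 q q2 q1]) hNC (fun hk1 => by
      obtain ⟨b1, b2, b3, b4⟩ := hbd k hk1
      rw [← hk] at b1 b2 b3 b4
      rw [if_pos hk1]
      exact ⟨hO k, b1, b2, b3, b4⟩)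
  refine ⟨s₅, _, r1.seq (r2.seq (.pop_none (h20 F (by decide) (by decide))
      (r3.seq (r4.seq (.pop_none ?_ r5))))), ?_, ?_⟩
  · rw [h4 H (by decide), h20 H (by decide) (by decide)]
  · have f1 : (if 1 ≤ k then τ k else 0) ≤ 2 * K * C * T := by
      split_ifs with hk1
      · obtain ⟨b1, -⟩ := hbd k hk1
        rw [← hk] at b1
        have f2 : K * (k + γ k) ≤ K * (C * N) := Nat.mul_le_mul_left _ b1
        have f3 : K ≤ K * (C * N) := Nat.le_mul_of_pos_right _ (by omega)
        have f4 : K * (C * N) ≤ K * (C * T) := by gcongr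
        have f5 : 2 * K * C * T = 2 * (K * (C * T)) := by ring
        have := hτ k
        omega
      · exact Nat.zero_le _
    -- With `b = C * N` and `N = log M`, the fourth power of `b` yields the exponent of the
    -- logarithm.
    have f6 : 300 * ((C + 1) * 2 ^ N * (C * N * (C * N) * (C * N * (C * N)))) =
        300 * (C + 1) * C ^ 4 * T := by
      rw [hT, hlogN, hN]; ring
    have hkN : k < N := hk ▸ Nat.lt_two_pow_self
    rw [f6, add_mul]
    omega
  · rw [h5, hw4, mem_language_iff (hM ▸ hN) hk]

/-- The truth tables of discriminating functions can be recognized in nearly linear time. -/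
theorem language_discrimination_mem {γ : ℕ → ℕ} (hγ : TimeConstructible γ)
    (hle : ∀ m : ℕ, 1 ≤ m → (γ m : ℝ) ≤ (2 : ℝ) ^ m / m) :
    (discrimination γ).language ∈ NearlyLinearTime := by
  refine Set.mem_iUnion.2 ⟨4, ?_⟩
  obtain ⟨M, hfin, K, hK⟩ := hγ
  have hun : ∀ k, Computability.unaryEncodeNat k = .replicate k true := fun k => by
    induction k with
    | zero => rfl
    | succ k ih => rw [Computability.unaryEncodeNat, ih, List.replicate_succ]
  obtain ⟨K', hK'⟩ := exists_run_testPhase (γ := γ) hle (O := Calls M.toTM2ComputableAux)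
    (τ := M.time) (K := K)
    (fun k => ⟨by have := M.outputsFun k; rw [hun, List.length_replicate] at this; exact this⟩) hK
  -- The time is that of the test plus that of clearing. The latter is at most the input length plus
  -- a constant multiple of the former.
  refine computableInTime_of_run (A := M.toTM2ComputableAux) hfin w (.seq testPhase finish)
    (fun N => (K' + testPhase.size * K' + 1) * (N * Nat.log 2 N ^ 4) +
      (K' + testPhase.size * (K' + 1) + 1 + Fintype.card Reg))
    (K' + testPhase.size * (K' + 1) + 1 + Fintype.card Reg) (fun N => ?_) fun l => ?_
  · refine Nat.add_le_add_right (Nat.mul_le_mul_right _ ?_) _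
    rw [mul_add testPhase.size]
    omega
  · obtain ⟨s', h1, h2⟩ := hK' l
    have h3 := h1.sum_length_le
    have h4 : ∑ q, (single w l q).length = l.length := by
      rw [Finset.sum_eq_single w]
      · simp [single]
      · intro q _ hq
        simp [single, hq]
      · simp
    have h5 := le_mul_log_pow l.length
    refine (h1.seq (run_finish s')).of_eq ?_ ?_
    · exact congrArg (fun b => single w [b]) (decide_eq_decide.2 h2)
    · rw [h4] at h3
      simp only [id_eq]
      generalize l.length * Nat.log 2 l.length ^ 4 = T at *
      have : testPhase.size * (K' * T + K' + 1) = testPhase.size * K' * T +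
        testPhase.size * (K' + 1) := by ring
      rw [this] at h3
      rw [add_mul, add_mul, one_mul]
      omega

end AlmostNatural

theorem lemma3p3 (γ : ℕ → ℕ) (hγ : AlmostNatural.TimeConstructible γ)
    (hle : ∀ m : ℕ, 1 ≤ m → (γ m : ℝ) ≤ (2 : ℝ) ^ m / m) :
    ∃ c : ℝ, 0 < c ∧
      AlmostNatural.IsNatural AlmostNatural.NearlyLinearTime
        (fun n => c * (2 : ℝ) ^
          (-(AlmostNatural.psi (Nat.log 2 n) (γ (Nat.log 2 n)) : ℤ)))
        (AlmostNatural.discrimination γ) := by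
  exact ⟨1 / 2, by norm_num, AlmostNatural.largeness_discrimination γ hle,
    AlmostNatural.language_discrimination_mem hγ hle⟩
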